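/- **Setting.** Let $f(x)=\max_{a\in A}(c_a+\langle a,x\rangle)$, with $A\subset\mathbb Z^2$ finite and non-empty, be a tropical Laurent polynomial. Its tropical curve $C\subset\mathbb R^2$ is the set where the maximum is attained at least twice, each leaf or edge carrying as weight the integer length of its dual edge in the dual subdivision of the Newton polygon. $C$ is *simple* if all polygons of the dual subdivision are triangles or parallelograms. *Nodes* of $C$ are the points dual to parallelograms, *vertices* those dual to triangles. The *normalization* $\tilde C$ is the proper transform of $C$ in the real blow-up of $\mathbb R^2$ at the nodes; $C$ is *irreducible* if $\tilde C$ is connected. The (open) edges and leaves of $C$ are the images of those of the graph $\tilde C$, so they go straight through nodes. The tripod $T_v$ is the union of the vertex $v$ and its three adjacent leaves or edges. **Tropical Harnack curves.** For an oriented loop $\lambda$ (a simple cycle of $\tilde C$), let $\Gamma_\lambda$ be the set of its oriented edges $\vec e$ that form, with the previous and the next edge of $\lambda$, a non-convex piecewise linear curve (the two turns are in opposite directions). $C$ is *tropical Harnack* if $\sum_{\vec e\in\Gamma_\lambda}w(e)\,v_{\vec e}\equiv 0 \pmod 2$ in $\mathbb Z^2$ for every $\lambda$, where $w(e)$ is the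 weight of $e$ and $v_{\vec e}$ the primitive integer vector supporting $\vec e$. **Phase-tropical curves.** Let $\mathcal A(z,w)=(\log|z|,\log|w|)$ on $(\mathbb C^*)^2$. The phase-tropical line $L$ is the union of the closure of the coamoeba (the set of arguments) of $\{z+w+1=0\}$, placed over the origin, and of the annuli $\{|z|<1,w=-1\}$, $\{|w|<1,z=-1\}$, $\{|z|=|w|>1,z=-w\}$. A *simple phase-tropical curve* $V$ above $C$ consists of a toric morphism $A_v(z,w)=(b_1z^{a_{11}}w^{a_{12}},b_2z^{a_{21}}w^{a_{22}})$, with $b_1,b_2\in\mathbb C^*$ and $(a_{ij})$ an integer matrix, for each vertex $v$, such that $\mathcal A(b_1,b_2)=v$ and the matrix $(a_{ij})$ maps $(-1,0),(0,-1),(1,1)$ onto the three outgoing primitive vectors of $T_v$ multiplied by their weights; and, for each edge $e$ with end points $v,v'$, of a homeomorphism, compatible with $A_v$ and $A_{v'}$, between the parts of the two copies of $L$ that lie above $e$ (so that $A_v(L)$ and $A_{v'}(L)$ coincide above $e$). It determines the surface obtained by gluing, with its map to $(\mathbb C^*)^2$, and we also write $V$ for the image $\bigcup_v A_v(L)\cap\mathcal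 A^{-1}(T_v)$. $V$ is *real* if complex conjugation commutes with all $A_v$ and all gluing homeomorphisms. The real part of the glued surface is mapped to $(\mathbb R^*)^2$, and further to four copies of $\mathbb R^2$, indexed by the signs $(\varepsilon,\delta)$ of the coordinates, by $(x,y)\mapsto(\varepsilon\ln|x|,\delta\ln|y|)$; call the resulting piecewise linear (parametrized) curve $\mathbb TV$. Its edges and leaves are the images of the connected components (two for each edge or leaf of $C$) of the real part of the glued surface above the edges and leaves of $C$. An *inflection pattern* of $\mathbb TV$ is a triple of consecutive edges or leaves, the middle one being an edge, that is not convex, i.e. whose first and last members lie on opposite sides of the line carrying the middle one. **Proposition.** Let $C\subset\mathbb R^2$ be an irreducible simple tropical curve with at least one vertex (i.e. $C$ is not a straight line). Then $C$ is tropical Harnack if and only if there is a simple real phase-tropical curve $V$ above $C$ such that $\mathcal A(V)=C$ and $\mathbb TV$ has no inflection pattern. In this case the subset $V\subset(\mathbb C^*)^2$ is unique up to the four sign changes $(z,w)\mapsto(\pm z,\pm w)$ of the coordinates. -/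

import Mathlib

open Filter Topology

namespace TropHarnack

noncomputable section

/-! ### Plane geometry -/

/-- The real vector of an integer vector. -/
def toReal (a : ℤ × ℤ) : ℝ × ℝ := ((a.1 : ℝ), (a.2 : ℝ))

/-- The pairing of an exponent with a point of the plane. -/
def pairing (a : ℤ × ℤ) (x : ℝ × ℝ) : ℝ := (a.1 : ℝ) * x.1 + (a.2 : ℝ) * x.2

/-- The determinant of two plane vectors: positive when `y` points to the left of `x`. -/
def cross (x y : ℝ × ℝ) : ℝ := x.1 * y.2 - x.2 * y.1

/-- Primitive integer vectors. -/
def IsPrimitive (u : ℤ × ℤ) : Prop := IsCoprime u.1 u.2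

/-- Nondegenerate triangles. -/
def IsTriangle (P : Set (ℝ × ℝ)) : Prop :=
  ∃ a x y : ℝ × ℝ, cross x y ≠ 0 ∧ P = convexHull ℝ {a, a + x, a + y}

/-- Nondegenerate parallelograms. -/
def IsParallelogram (P : Set (ℝ × ℝ)) : Prop :=
  ∃ a x y : ℝ × ℝ, cross x y ≠ 0 ∧ P = convexHull ℝ {a, a + x, a + y, a + x + y}

/-- The integer length of a segment with integer end points: number of integer points minus one. -/
def integerLength (P : Set (ℝ × ℝ)) : ℕ := {a : ℤ × ℤ | toReal a ∈ P}.ncard - 1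

/-- The class of the line spanned by a nonzero vector `y`, a point of the real projective line.
The projective line is realised as the unit circle of `ℂ`: the line spanned by a unit complex
number `e` corresponds to `e ^ 2`. -/
def lineClass (y : ℝ × ℝ) : ℂ :=
  (((y.1 : ℂ) + (y.2 : ℂ) * Complex.I) / (‖(y.1 : ℂ) + (y.2 : ℂ) * Complex.I‖ : ℂ)) ^ 2

/-! ### Plane tropical curves -/

/-- A tropical Laurent polynomial `max_{a ∈ supp} (coeff a + ⟨a, x⟩)`; it carries the plane tropical
curve that it defines, with its weights. -/
structure TropPoly where
  supp : Finset (ℤ × ℤ)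
  supp_nonempty : supp.Nonempty
  coeff : ℤ × ℤ → ℝ

namespace TropPoly

/-- The value at `x` of the tropical monomial with exponent `a`. -/
def monomial (C : TropPoly) (a : ℤ × ℤ) (x : ℝ × ℝ) : ℝ := C.coeff a + pairing a x

/-- The exponents of the monomials that are maximal at `x`. -/
def dominant (C : TropPoly) (x : ℝ × ℝ) : Set (ℤ × ℤ) :=
  {a | a ∈ C.supp ∧ ∀ a' ∈ C.supp, C.monomial a' x ≤ C.monomial a x}

/-- The tropical zero set: the points where the maximum is attained at least twice. -/
def curve (C : TropPoly) : Set (ℝ × ℝ) := {x | (C.dominant x).Nontrivial}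

/-- The cell of the dual subdivision of the Newton polygon that is dual to the stratum through `x`:
the projection of the upper face with outer normal `(x, 1)` of the lifted Newton polygon. The cells
of the dual subdivision are exactly these sets, for `x` in the plane. -/
def dualCell (C : TropPoly) (x : ℝ × ℝ) : Set (ℝ × ℝ) := convexHull ℝ (toReal '' C.dominant x)

/-- A tropical curve is simple if all polygons of its dual subdivision are triangles and
parallelograms. -/
def IsSimple (C : TropPoly) : Prop :=
  ∀ x, (interior (C.dualCell x)).Nonempty →
    IsTriangle (C.dualCell x) ∨ IsParallelogram (C.dualCell x)

/-- The (3-valent) vertices of a simple tropical curve, images of those of its normalization. -/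
def vertices (C : TropPoly) : Set (ℝ × ℝ) := {x | IsTriangle (C.dualCell x)}

/-- The nodes, i.e. 4-valent vertices, of a simple tropical curve. -/
def nodes (C : TropPoly) : Set (ℝ × ℝ) := {x | IsParallelogram (C.dualCell x)}

/-- The normalization: the proper transform of the curve under the real blow-up of the plane at all
nodes. The blow-up lies in the product of the plane with one projective line for each node, and the
proper transform is the closure of the part of the curve away from the nodes. -/
def normalization (C : TropPoly) : Set ((ℝ × ℝ) × (C.nodes → ℂ)) :=
  closure {q | q.1 ∈ C.curve ∧ q.1 ∉ C.nodes ∧ ∀ n : C.nodes, q.2 n = lineClass (q.1 - n)}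

/-- A simple tropical curve is irreducible if its normalization is connected. -/
def IsIrreducible (C : TropPoly) : Prop := IsConnected C.normalization

/-- `u` is the primitive integer vector that supports a leaf or edge leaving `v`. -/
def IsOutgoing (C : TropPoly) (v : ℝ × ℝ) (u : ℤ × ℤ) : Prop :=
  IsPrimitive u ∧ ∀ᶠ t : ℝ in 𝓝[>] 0, v + t • toReal u ∈ C.curve

/-- The open leaf or edge that leaves the vertex `v` in the direction `u`. It goes straight through
nodes and stops at the next vertex, if there is one. -/
def branch (C : TropPoly) (v : ℝ × ℝ) (u : ℤ × ℤ) : Set (ℝ × ℝ) :=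
  {x | ∃ t : ℝ, 0 < t ∧ x = v + t • toReal u ∧
    ∀ s : ℝ, 0 < s → s ≤ t → v + s • toReal u ∈ C.curve \ C.vertices}

/-- The tripod at `v`: the union of `v` and of its adjacent (open) leaves and edges. -/
def tripod (C : TropPoly) (v : ℝ × ℝ) : Set (ℝ × ℝ) :=
  {x | x = v ∨ ∃ u, C.IsOutgoing v u ∧ x ∈ C.branch v u}

/-- The monomials dominant at `v` that remain dominant when one leaves `v` in the direction `u`;
see `eventually_dominant`. -/
def dominantAlong (C : TropPoly) (v : ℝ × ℝ) (u : ℤ × ℤ) : Set (ℤ × ℤ) :=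
  {a | a ∈ C.dominant v ∧ ∀ a' ∈ C.dominant v, pairing a' (toReal u) ≤ pairing a (toReal u)}

/-- The weight of the leaf or edge that leaves `v` in the direction `u`: the integer length of the
dual edge of the dual subdivision. -/
def weight (C : TropPoly) (v : ℝ × ℝ) (u : ℤ × ℤ) : ℕ :=
  integerLength (convexHull ℝ (toReal '' C.dominantAlong v u))

theorem monomial_add (C : TropPoly) (a : ℤ × ℤ) (v : ℝ × ℝ) (t : ℝ) (u : ℤ × ℤ) :
    C.monomial a (v + t • toReal u) = C.monomial a v + t * pairing a (toReal u) := by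
  simp only [monomial, pairing, Prod.fst_add, Prod.snd_add, Prod.smul_fst, Prod.smul_snd,
    smul_eq_mul]
  ring

theorem exists_dominant (C : TropPoly) (x : ℝ × ℝ) : ∃ a, a ∈ C.dominant x := by
  obtain ⟨a, ha, h⟩ := C.supp.exists_max_image (fun a => C.monomial a x) C.supp_nonempty
  exact ⟨a, ha, h⟩

/-- The edge used in `weight` is the dual cell of the points of the leaf or edge close to `v`. -/
theorem eventually_dominant (C : TropPoly) (v : ℝ × ℝ) (u : ℤ × ℤ) :
    ∀ᶠ t : ℝ in 𝓝[>] 0, C.dominant (v + t • toReal u) = C.dominantAlong v u := by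
  have key : ∀ᶠ t : ℝ in 𝓝[>] 0, ∀ a ∈ C.supp, ∀ a' ∈ C.supp,
      C.monomial a v < C.monomial a' v →
        C.monomial a (v + t • toReal u) < C.monomial a' (v + t • toReal u) := by
    rw [Filter.eventually_all_finset]
    intro a _
    rw [Filter.eventually_all_finset]
    intro a' _
    by_cases h : C.monomial a v < C.monomial a' v
    · have hc : ContinuousAt (fun t : ℝ => C.monomial a v + t * pairing a (toReal u)) 0 := by
        fun_prop
      have hc' : ContinuousAt (fun t : ℝ => C.monomial a' v + t * pairing a' (toReal u)) 0 := by
        fun_prop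
      have := hc.eventually_lt hc' (by simpa using h)
      filter_upwards [nhdsWithin_le_nhds this] with t ht _
      simpa only [monomial_add] using ht
    · exact Eventually.of_forall fun t h' => absurd h' h
  filter_upwards [key, self_mem_nhdsWithin] with t ht hpos
  have hpos : (0 : ℝ) < t := hpos
  obtain ⟨m, hm⟩ := C.exists_dominant v
  have hsub : ∀ a, a ∈ C.dominant (v + t • toReal u) → a ∈ C.dominant v := by
    intro a ha
    refine ⟨ha.1, fun a' ha' => ?_⟩
    by_contra hlt
    exact absurd (ha.2 a' ha') (not_le.2 (ht a ha.1 a' ha' (not_le.1 hlt)))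
  ext a
  constructor
  · intro ha
    refine ⟨hsub a ha, fun a' ha' => ?_⟩
    have h1 := ha.2 a' ha'.1
    rw [monomial_add, monomial_add] at h1
    have h2 := ha'.2 a ha.1
    have h3 := (hsub a ha).2 a' ha'.1
    nlinarith
  · intro ha
    refine ⟨ha.1.1, fun a' ha' => ?_⟩
    obtain ⟨d, hd⟩ := C.exists_dominant (v + t • toReal u)
    refine (hd.2 a' ha').trans ?_
    rw [monomial_add, monomial_add]
    have h1 := ha.2 d (hsub d hd)
    have h2 := ha.1.2 d hd.1
    nlinarith

/-- `v` and `v'` are the two ends of an edge, which is then the open segment between them. -/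
def IsEdge (C : TropPoly) (v v' : ℝ × ℝ) : Prop :=
  v ∈ C.vertices ∧ v' ∈ C.vertices ∧ v ≠ v' ∧ openSegment ℝ v v' ⊆ C.curve \ C.vertices

/-- An oriented loop with `n` edges in the normalization: the `i`-th edge goes from `vert i` to
`vert (i + 1)` and is supported by the primitive integer vector `vec i`. -/
structure Loop (C : TropPoly) (n : ℕ) where
  three_le : 3 ≤ n
  vert : ZMod n → ℝ × ℝ
  vert_injective : Function.Injective vert
  isEdge : ∀ i, C.IsEdge (vert i) (vert (i + 1))
  vec : ZMod n → ℤ × ℤ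
  vec_primitive : ∀ i, IsPrimitive (vec i)
  vec_spec : ∀ i, ∃ t : ℝ, 0 < t ∧ vert (i + 1) = vert i + t • toReal (vec i)

/-- The `i`-th oriented edge forms with its predecessor and its successor in the loop a piecewise
linear curve that is not convex: the two turns are in opposite directions. -/
def Loop.IsInflection {C : TropPoly} {n : ℕ} (l : C.Loop n) (i : ZMod n) : Prop :=
  cross (toReal (l.vec (i - 1))) (toReal (l.vec i)) *
    cross (toReal (l.vec i)) (toReal (l.vec (i + 1))) < 0

open Classical in
/-- The loop condition that makes an irreducible simple tropical curve a tropical Harnack curve. -/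
def IsHarnack (C : TropPoly) : Prop :=
  ∀ (n : ℕ) [NeZero n] (l : C.Loop n),
    ∃ k : ℤ × ℤ,
      ∑ i : ZMod n with l.IsInflection i, (C.weight (l.vert i) (l.vec i) : ℤ) • l.vec i = (2 : ℤ) • k

end TropPoly

/-! ### Phase-tropical lines -/

/-- The complex torus of dimension two. -/
abbrev Torus : Type := ℂˣ × ℂˣ

/-- The amoeba map. -/
def amoeba (p : Torus) : ℝ × ℝ := (Real.log ‖(p.1 : ℂ)‖, Real.log ‖(p.2 : ℂ)‖)

/-- Complex conjugation on the torus. -/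
def conj (p : Torus) : Torus :=
  (Units.map (starRingEnd ℂ).toMonoidHom p.1, Units.map (starRingEnd ℂ).toMonoidHom p.2)

/-- Real points of the torus. -/
def IsRealPoint (p : Torus) : Prop := conj p = p

/-- The pair of signs of a real point. -/
def signs (p : Torus) : SignType × SignType :=
  (SignType.sign (p.1 : ℂ).re, SignType.sign (p.2 : ℂ).re)

/-- The reflection of the plane given by a pair of signs. -/
def reflect (s : SignType × SignType) (x : ℝ × ℝ) : ℝ × ℝ := ((s.1 : ℝ) * x.1, (s.2 : ℝ) * x.2)

/-- The map `𝒜ₛ` from the real points of the torus to four copies of the plane. -/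
def signedAmoeba (p : Torus) : (ℝ × ℝ) × (SignType × SignType) :=
  (reflect (signs p) (amoeba p), signs p)

/-- The coamoeba of the line `z + w + 1 = 0`, as a subset of the compact torus. -/
def coamoebaLine : Set Torus :=
  {p | ‖(p.1 : ℂ)‖ = 1 ∧ ‖(p.2 : ℂ)‖ = 1 ∧
    ∃ r s : ℝ, 0 < r ∧ 0 < s ∧ (r : ℂ) * p.1 + (s : ℂ) * p.2 + 1 = 0}

/-- The phase-tropical line: the Hausdorff limit of the images of the line `z + w + 1 = 0` under
the maps `H_t`, that is, the closed coamoeba with three holomorphic annuli glued to it. -/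
def phaseLine : Set Torus :=
  closure coamoebaLine ∪
  {p | ‖(p.1 : ℂ)‖ < 1 ∧ (p.2 : ℂ) = -1} ∪
  {p | ‖(p.2 : ℂ)‖ < 1 ∧ (p.1 : ℂ) = -1} ∪
  {p | 1 < ‖(p.1 : ℂ)‖ ∧ (p.1 : ℂ) = -(p.2 : ℂ)}

/-- Toric morphisms `(z, w) ↦ (b₁ z ^ a₁₁ w ^ a₁₂, b₂ z ^ a₂₁ w ^ a₂₂)`. -/
structure ToricMorphism where
  b : Torus
  a : Matrix (Fin 2) (Fin 2) ℤ

namespace ToricMorphism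

/-- The underlying map of a toric morphism. -/
def toFun (A : ToricMorphism) (p : Torus) : Torus :=
  (A.b.1 * p.1 ^ A.a 0 0 * p.2 ^ A.a 0 1, A.b.2 * p.1 ^ A.a 1 0 * p.2 ^ A.a 1 1)

/-- The linear part of the map of the plane to which a toric morphism descends. -/
def linear (A : ToricMorphism) (d : ℤ × ℤ) : ℤ × ℤ :=
  (A.a 0 0 * d.1 + A.a 0 1 * d.2, A.a 1 0 * d.1 + A.a 1 1 * d.2)

/-- The part of the phase-tropical line that the toric morphism sends above an open segment. -/
def above (A : ToricMorphism) (x y : ℝ × ℝ) : Set Torus :=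
  {p | p ∈ phaseLine ∧ amoeba (A.toFun p) ∈ openSegment ℝ x y}

end ToricMorphism

/-! ### Simple phase-tropical curves -/

/-- A simple phase-tropical curve above the simple tropical curve `C`.

Over the tripod of a vertex `v` it is a general phase-tropical line `Γ_v = A_v (L)`, where the toric
morphism `A_v = chart v` sends the tropical line (with the three outgoing primitive vectors
`(-1,0)`, `(0,-1)`, `(1,1)`) to the weighted tripod of `C` at `v`.
Over an edge, `Γ_v` and `Γ_{v'}` coincide and the two pairs of pants are glued along the
annuli that lie over the edge. These annuli are coverings, of degree the weight, of the common
annulus in the torus, and `glue` is an isomorphism of coverings (the only one, if the weight is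
one). The gluing yields a topological surface with a map to the torus. -/
structure SimplePhaseCurve (C : TropPoly) where
  chart : C.vertices → ToricMorphism
  chart_vertex : ∀ v : C.vertices, amoeba (chart v).b = v
  chart_weight : ∀ (v : C.vertices) (u : ℤ × ℤ), C.IsOutgoing v u →
    ∃ d ∈ ({(-1, 0), (0, -1), (1, 1)} : Set (ℤ × ℤ)),
      (chart v).linear d = (C.weight v u : ℤ) • u
  glue : ∀ v v' : C.vertices, C.IsEdge v v' →
    (chart v).above v v' ≃ₜ (chart v').above v' v
  glue_map : ∀ v v' h p, (chart v').toFun (glue v v' h p) = (chart v).toFun p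
  glue_symm : ∀ v v' h h' p, glue v' v h' (glue v v' h p) = p

namespace SimplePhaseCurve

variable {C : TropPoly}

/-- The general phase-tropical line `Γ_v`. -/
def line (V : SimplePhaseCurve C) (v : C.vertices) : Set Torus := (V.chart v).toFun '' phaseLine

/-- The subset of the torus swept out by a simple phase-tropical curve. -/
def carrier (V : SimplePhaseCurve C) : Set Torus :=
  ⋃ v : C.vertices, V.line v ∩ amoeba ⁻¹' C.tripod v

/-- A simple real-tropical curve: a simple phase-tropical curve invariant under complex
conjugation, which acts on the glued surface. -/
def IsReal (V : SimplePhaseCurve C) : Prop :=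
  (∀ v p, (V.chart v).toFun (conj p) = conj ((V.chart v).toFun p)) ∧
  ∀ (v v' : C.vertices) (h : C.IsEdge v v') (p q : (V.chart v).above v v'), (q : Torus) = conj (p : Torus) →
    (V.glue v v' h q : Torus) = conj (V.glue v v' h p : Torus)

/-- `p` and `q` lie on the same arc of the real part of the phase-tropical line: this real part is
the union of three broken lines, one in each quadrant but the positive one. -/
def SameRealArc (p q : Torus) : Prop :=
  p ∈ phaseLine ∧ q ∈ phaseLine ∧ IsRealPoint p ∧ IsRealPoint q ∧ signs p = signs q

/-- The curve `𝕋V` of a simple real-tropical curve has an inflection pattern: three consecutive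
elements of `LE(𝕋V)` that do not form a convex curve.

The middle one lies over the edge from `v` to `v'` and contains the image of the real point `p`
(which is `V.glue v v' h p` in the chart at `v'`). The first one contains the image `x` of `q`,
which lies on the same real arc over the tripod of `v` but on another leaf or edge; the last one
contains the image `x'` of `q'`, likewise at `v'`. All three lie in the copy of the plane indexed by
the signs `s`. They form a nonconvex curve when `x` and `x'` are on opposite sides of the line
that carries the middle one. -/
def HasInflectionPattern (V : SimplePhaseCurve C) : Prop :=
  ∃ (v v' : C.vertices) (h : C.IsEdge v v')
    (p : (V.chart v).above v v')
    (q q' : Torus) (s : SignType × SignType) (x x' : ℝ × ℝ),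
    SameRealArc p q ∧
    amoeba ((V.chart v).toFun q) ∈ C.tripod v \ ({(v : ℝ × ℝ)} ∪ openSegment ℝ (v : ℝ × ℝ) v') ∧
    SameRealArc (V.glue v v' h p) q' ∧
    amoeba ((V.chart v').toFun q') ∈
      C.tripod v' \ ({(v' : ℝ × ℝ)} ∪ openSegment ℝ (v : ℝ × ℝ) v') ∧
    signs ((V.chart v).toFun p) = s ∧
    signedAmoeba ((V.chart v).toFun q) = (x, s) ∧
    signedAmoeba ((V.chart v').toFun q') = (x', s) ∧
    cross (reflect s v' - reflect s v) (x - reflect s v) *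
      cross (reflect s v' - reflect s v) (x' - reflect s v') < 0

/-- `V` is a phase-tropical Harnack curve above `C`: a simple real-tropical curve with amoeba `C`
whose real part `𝕋V` has no inflection pattern. -/
def IsPhaseHarnack (V : SimplePhaseCurve C) : Prop :=
  V.IsReal ∧ amoeba '' V.carrier = C.curve ∧ ¬ V.HasInflectionPattern

end SimplePhaseCurve

/-- The change of the signs of the coordinates of the torus given by two units of `ℤ`. -/
def signChange (ε : ℤˣ × ℤˣ) (p : Torus) : Torus :=
  (Units.map (Int.castRingHom ℂ).toMonoidHom ε.1 * p.1,
    Units.map (Int.castRingHom ℂ).toMonoidHom ε.2 * p.2)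

end

end TropHarnack

/-!
The proof translates both sides of the equivalence into a statement about signs, that is, about
elements of `(ℤ / 2)²`, attached to the vertices of the curve.

A real chart at a vertex `v` is, up to a symmetry of the phase-tropical line, determined by the
signs `β v` of its translation part (`SimplePhaseCurve.exists_isChart`). The real part of the
phase-tropical line consists of three arcs, one opposite to each leg, and the chart sends the arc
opposite to the leg with weighted vector `m` to the quadrant with signs `β v * (-1) ^ m`
(`IsChart.toFun_real`). Over an edge from `v` to `v'` there are two parts of real arcs; one
continues at `v` along the leg on the left of the edge and one along the leg on its right, and
likewise at `v'`. There is no inflection pattern over the edge if and only if the gluing sends left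
to left and right to right. Comparing signs, this says that `β v' = β v * signCocycle v v'`, where
the cocycle is the product of the signs of the legs on the right of the edge at its two ends
(`SimplePhaseCurve.sign_relation`). Conversely, a solution `β` of these equations gives a real
phase-tropical curve without inflection patterns, glued along `t ↦ c / t` in suitable coordinates of
the annuli (`SimplePhaseCurve.ofSigns`). Thus a phase-tropical Harnack curve exists if and only if
the sign cocycle is a coboundary.

On a connected graph this holds if and only if the product of the cocycle over each simple cycle is
trivial (`exists_potential`). On a loop, a vertex where the loop turns left contributes twice the
same leg, hence nothing; at a vertex where it turns right the two legs are the edges of the loop. So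
an edge counts if the loop turns right at exactly one of its ends, and the product is
`(-1) ^ ∑ w(e) v_e`, the sum being over the edges with two opposite turns
(`TropPoly.prod_signCocycle_loop`). This is the loop condition. It uses that the legs at a vertex are
balanced (`TropPoly.exists_isLegSystem`) and that an edge has the same weight at both ends, as
opposite sides of a parallelogram have the same length (`TropPoly.weight_neg_eq_of_openSegment`).

That the graph of edges is connected, and that the tripods cover the curve, follows from the
connectedness of the normalization, because the tripods of a set of vertices that is closed under
adjacency are locally separated from the rest of the normalization (`TropPoly.exists_transfer`).

For uniqueness, two solutions `β`, `β'` on a connected graph differ by a constant sign, and charts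
with the same signs have the same image, because the phase-tropical line is invariant under the
permutations of its three directions (`permMorphism_mem_phaseLine`).
-/

namespace TropHarnack

noncomputable section

/-! ### Integer vectors and lattice segments -/

theorem pairing_eq_of_toReal_eq {c A X Y : ℤ × ℤ} {α β : ℝ}
    (h : toReal c = toReal A + α • toReal X + β • toReal Y) (d : ℝ × ℝ) :
    pairing c d = pairing A d + α * pairing X d + β * pairing Y d := by
  have h1 := congrArg Prod.fst h
  have h2 := congrArg Prod.snd h
  simp only [toReal, Prod.fst_add, Prod.snd_add, Prod.smul_fst, Prod.smul_snd, smul_eq_mul]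
    at h1 h2
  simp only [pairing, h1, h2]
  ring

theorem pairing_add_left (a b : ℤ × ℤ) (d : ℝ × ℝ) :
    pairing (a + b) d = pairing a d + pairing b d := by
  simp only [pairing, Prod.fst_add, Prod.snd_add]; push_cast; ring

theorem pairing_sub_left (a b : ℤ × ℤ) (d : ℝ × ℝ) :
    pairing (a - b) d = pairing a d - pairing b d := by
  simp only [pairing, Prod.fst_sub, Prod.snd_sub]; push_cast; ring

theorem pairing_neg_left (a : ℤ × ℤ) (d : ℝ × ℝ) : pairing (-a) d = -pairing a d := by
  simp only [pairing, Prod.fst_neg, Prod.snd_neg]; push_cast; ring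

theorem pairing_smul_right (a : ℤ × ℤ) (r : ℝ) (d : ℝ × ℝ) :
    pairing a (r • d) = r * pairing a d := by
  simp only [pairing, Prod.smul_fst, Prod.smul_snd, smul_eq_mul]; ring

theorem pairing_add_right (a : ℤ × ℤ) (d d' : ℝ × ℝ) :
    pairing a (d + d') = pairing a d + pairing a d' := by
  simp only [pairing, Prod.fst_add, Prod.snd_add]; ring

theorem pairing_neg_right (a : ℤ × ℤ) (d : ℝ × ℝ) : pairing a (-d) = -pairing a d := by
  simp only [pairing, Prod.fst_neg, Prod.snd_neg]; ring

theorem toReal_add (a b : ℤ × ℤ) : toReal (a + b) = toReal a + toReal b := by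
  simp [toReal]

theorem toReal_sub (a b : ℤ × ℤ) : toReal (a - b) = toReal a - toReal b := by
  simp [toReal]

theorem toReal_neg (a : ℤ × ℤ) : toReal (-a) = -toReal a := by
  simp [toReal]

theorem toReal_smul (n : ℤ) (a : ℤ × ℤ) : toReal (n • a) = (n : ℝ) • toReal a := by
  simp [toReal]

theorem toReal_injective : Function.Injective toReal := by
  intro a b h
  simp only [toReal, Prod.mk.injEq, Int.cast_inj] at h
  exact Prod.ext h.1 h.2

theorem IsPrimitive.ne_zero {u : ℤ × ℤ} (h : IsPrimitive u) : u ≠ 0 := by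
  rintro rfl
  obtain ⟨s, t, h⟩ := h
  simp at h

theorem IsPrimitive.neg {u : ℤ × ℤ} (h : IsPrimitive u) : IsPrimitive (-u) :=
  IsCoprime.neg_neg h

/-- A real multiple of a primitive vector that is an integer vector is an integer multiple. -/
theorem IsPrimitive.exists_int {u m : ℤ × ℤ} (h : IsPrimitive u) {r : ℝ}
    (hm : toReal m = r • toReal u) : ∃ k : ℤ, (k : ℝ) = r ∧ m = k • u := by
  obtain ⟨s, t, hst⟩ := h
  have h1 := congrArg Prod.fst hm
  have h2 := congrArg Prod.snd hm
  simp only [toReal, Prod.smul_fst, Prod.smul_snd, smul_eq_mul] at h1 h2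
  have hst' : (s : ℝ) * u.1 + t * u.2 = 1 := by exact_mod_cast hst
  have hk : ((s * m.1 + t * m.2 : ℤ) : ℝ) = r := by
    push_cast
    rw [h1, h2]
    linear_combination r * hst'
  refine ⟨s * m.1 + t * m.2, hk, toReal_injective ?_⟩
  rw [toReal_smul, hk, hm]

theorem IsPrimitive.eq_of_pos_smul {u u' : ℤ × ℤ} (h : IsPrimitive u) (h' : IsPrimitive u')
    {r : ℝ} (hr : 0 < r) (e : toReal u' = r • toReal u) : u' = u := by
  obtain ⟨k, hk, hku⟩ := h.exists_int e
  have e' : toReal u = r⁻¹ • toReal u' := by rw [e, smul_smul, inv_mul_cancel₀ hr.ne', one_smul]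
  obtain ⟨l, hl, -⟩ := h'.exists_int e'
  have hkl : k * l = 1 := by
    have : (k : ℝ) * l = 1 := by rw [hk, hl, mul_inv_cancel₀ hr.ne']
    exact_mod_cast this
  have hk0 : 0 < k := by rw [← hk] at hr; exact_mod_cast hr
  have hk1 : k = 1 := by
    rcases Int.isUnit_iff.1 (IsUnit.of_mul_eq_one _ hkl) with h | h <;> omega
  rw [hku, hk1, one_smul]

theorem exists_primitive_smul {E : ℤ × ℤ} (hE : E ≠ 0) :
    ∃ (g : ℕ) (u : ℤ × ℤ), 0 < g ∧ IsPrimitive u ∧ E = (g : ℤ) • u := by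
  have hg : 0 < Int.gcd E.1 E.2 := by
    rw [Nat.pos_iff_ne_zero]
    intro h
    rw [Int.gcd_eq_zero_iff] at h
    exact hE (Prod.ext h.1 h.2)
  refine ⟨Int.gcd E.1 E.2, (E.1 / Int.gcd E.1 E.2, E.2 / Int.gcd E.1 E.2), hg, ?_, ?_⟩
  · rw [IsPrimitive, Int.isCoprime_iff_gcd_eq_one]
    exact Int.gcd_ediv_gcd_ediv_gcd hg
  · ext
    · simp [Int.mul_ediv_cancel' (Int.gcd_dvd_left _ _)]
    · simp [Int.mul_ediv_cancel' (Int.gcd_dvd_right _ _)]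

/-- The integer length of a lattice segment is the index of the vector between its end points. -/
theorem integerLength_convexHull {F : Set (ℤ × ℤ)} {A e : ℤ × ℤ} {g : ℕ} (he : IsPrimitive e)
    (hA : A ∈ F) (hB : A + (g : ℤ) • e ∈ F)
    (hF : ∀ c ∈ F, ∃ θ : ℝ, 0 ≤ θ ∧ θ ≤ 1 ∧ toReal c = toReal A + θ • toReal ((g : ℤ) • e)) :
    integerLength (convexHull ℝ (toReal '' F)) = g := by
  have hconv : convexHull ℝ (toReal '' F) =
      segment ℝ (toReal A) (toReal (A + (g : ℤ) • e)) := by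
    apply Set.Subset.antisymm
    · refine convexHull_min ?_ (convex_segment _ _)
      rintro _ ⟨c, hc, rfl⟩
      obtain ⟨θ, h0, h1, h⟩ := hF c hc
      rw [segment_eq_image']
      exact ⟨θ, ⟨h0, h1⟩, by simp [h, toReal_add]⟩
    · exact segment_subset_convexHull ⟨A, hA, rfl⟩ ⟨_, hB, rfl⟩
  have hinj : Function.Injective fun k : ℕ => A + (k : ℤ) • e := by
    intro k l h
    have : ((k : ℤ) - l) • e = 0 := by
      rw [sub_smul, sub_eq_zero]; exact add_left_cancel h
    rcases smul_eq_zero.1 this with h | h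
    · omega
    · exact absurd h he.ne_zero
  have hset : {a : ℤ × ℤ | toReal a ∈ convexHull ℝ (toReal '' F)} =
      (fun k : ℕ => A + (k : ℤ) • e) '' (Finset.range (g + 1) : Finset ℕ) := by
    rw [hconv, segment_eq_image']
    ext a
    constructor
    · rintro ⟨θ, ⟨h0, h1⟩, h⟩
      simp only [toReal_add, add_sub_cancel_left, toReal_smul, smul_smul] at h
      have h' : toReal (a - A) = (θ * g) • toReal e := by
        rw [toReal_sub, ← h]; simp
      obtain ⟨k, hk, hka⟩ := he.exists_int h'
      have hk0 : 0 ≤ k := by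
        have : (0 : ℝ) ≤ k := by rw [hk]; positivity
        exact_mod_cast this
      have hkg : k ≤ g := by
        have : (k : ℝ) ≤ g := by rw [hk]; exact mul_le_of_le_one_left (by positivity) h1
        exact_mod_cast this
      refine ⟨k.toNat, by simp; omega, ?_⟩
      simp only [Int.toNat_of_nonneg hk0]
      rw [← hka]; abel
    · rintro ⟨k, hk, rfl⟩
      simp only [Finset.coe_range, Set.mem_Iio] at hk
      rcases Nat.eq_zero_or_pos g with rfl | hg
      · have : k = 0 := by omega
        subst this
        exact ⟨0, by simp, by simp⟩
      · have hg' : (0 : ℝ) < g := by exact_mod_cast hg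
        refine ⟨k / g, ⟨by positivity, ?_⟩, ?_⟩
        · rw [div_le_one hg']; exact_mod_cast (by omega : k ≤ g)
        · simp only [toReal_add, add_sub_cancel_left, toReal_smul, smul_smul, Int.cast_natCast]
          rw [div_mul_cancel₀ _ hg'.ne']
  rw [integerLength, hset, Set.ncard_image_of_injective _ hinj, Set.ncard_coe_finset]
  simp

/-- Rotation by a right angle, clockwise: it turns a side of a polygon that is run through
counterclockwise into an outer normal. -/
def rot (m : ℤ × ℤ) : ℤ × ℤ := (m.2, -m.1)

theorem rot_sub (a b : ℤ × ℤ) : rot (a - b) = rot a - rot b := by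
  ext <;> simp [rot]; ring

theorem rot_neg (a : ℤ × ℤ) : rot (-a) = -rot a := by
  ext <;> simp [rot]

/-! ### Faces of the dominant set and the local shape of the curve -/

namespace TropPoly

variable (C : TropPoly)

/-- The monomials dominant at `x` that stay dominant when one leaves `x` in the direction of the
real vector `d`. -/
def face (x d : ℝ × ℝ) : Set (ℤ × ℤ) :=
  {a | a ∈ C.dominant x ∧ ∀ a' ∈ C.dominant x, pairing a' d ≤ pairing a d}

theorem monomial_eq (a : ℤ × ℤ) (x y : ℝ × ℝ) :
    C.monomial a y = C.monomial a x + pairing a (y - x) := by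
  simp only [monomial, pairing, Prod.fst_sub, Prod.snd_sub]; ring

/-- Near `x` the curve is a fan with apex `x`. -/
theorem eventually_dominant_eq_face (x : ℝ × ℝ) :
    ∀ᶠ y in 𝓝 x, C.dominant y = C.face x (y - x) := by
  have key : ∀ᶠ y in 𝓝 x, ∀ a ∈ C.supp, ∀ a' ∈ C.supp,
      C.monomial a x < C.monomial a' x → C.monomial a y < C.monomial a' y := by
    rw [Filter.eventually_all_finset]
    intro a _
    rw [Filter.eventually_all_finset]
    intro a' _
    by_cases h : C.monomial a x < C.monomial a' x
    · have hc : ∀ a, ContinuousAt (fun y => C.monomial a y) x := by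
        intro a
        unfold monomial pairing
        fun_prop
      filter_upwards [(hc a).eventually_lt (hc a') h] with y hy _ using hy
    · exact Eventually.of_forall fun y h' => absurd h' h
  filter_upwards [key] with y hy
  have hsub : ∀ a, a ∈ C.dominant y → a ∈ C.dominant x := by
    intro a ha
    refine ⟨ha.1, fun a' ha' => ?_⟩
    by_contra hlt
    exact absurd (ha.2 a' ha') (not_le.2 (hy a ha.1 a' ha' (not_le.1 hlt)))
  ext a
  constructor
  · intro ha
    refine ⟨hsub a ha, fun a' ha' => ?_⟩
    have h1 := ha.2 a' ha'.1
    rw [C.monomial_eq a' x, C.monomial_eq a x] at h1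
    have h2 := ha'.2 a ha.1
    linarith
  · intro ha
    refine ⟨ha.1.1, fun a' ha' => ?_⟩
    obtain ⟨d, hd⟩ := C.exists_dominant y
    refine (hd.2 a' ha').trans ?_
    rw [C.monomial_eq d x, C.monomial_eq a x]
    have h1 := ha.2 d (hsub d hd)
    have h2 := ha.1.2 d hd.1
    linarith

theorem face_zero (x : ℝ × ℝ) : C.face x 0 = C.dominant x := by
  ext a; simp [face, pairing]

theorem face_smul (x d : ℝ × ℝ) {r : ℝ} (hr : 0 < r) : C.face x (r • d) = C.face x d := by
  ext a; simp only [face, pairing_smul_right, mul_le_mul_iff_right₀ hr, Set.mem_ofPred_eq]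

theorem dominantAlong_eq_face (x : ℝ × ℝ) (u : ℤ × ℤ) :
    C.dominantAlong x u = C.face x (toReal u) := rfl

theorem pairing_face {x d : ℝ × ℝ} {a b : ℤ × ℤ} (ha : a ∈ C.face x d) (hb : b ∈ C.face x d) :
    pairing a d = pairing b d := le_antisymm (hb.2 a ha.1) (ha.2 b hb.1)

theorem isOutgoing_iff {v : ℝ × ℝ} {u : ℤ × ℤ} :
    C.IsOutgoing v u ↔ IsPrimitive u ∧ (C.face v (toReal u)).Nontrivial := by
  refine and_congr_right fun _ => ?_
  have h : (∀ᶠ t : ℝ in 𝓝[>] 0, v + t • toReal u ∈ C.curve) ↔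
      ∀ᶠ t : ℝ in 𝓝[>] 0, (C.face v (toReal u)).Nontrivial := by
    apply eventually_congr
    filter_upwards [C.eventually_dominant v u] with t ht
    rw [curve, Set.mem_ofPred_eq, ht, dominantAlong_eq_face]
  rw [h, eventually_const]

/-- A set of integer points whose convex hull is a triangle with corners `A`, `A + X`, `A + Y`, in
counterclockwise order. -/
structure _root_.TropHarnack.HasTriangle (D : Set (ℤ × ℤ)) (A X Y : ℤ × ℤ) : Prop where
  pos : 0 < X.1 * Y.2 - X.2 * Y.1
  mem₀ : A ∈ D
  mem₁ : A + X ∈ D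
  mem₂ : A + Y ∈ D
  coord : ∀ c ∈ D, ∃ α β : ℝ, 0 ≤ α ∧ 0 ≤ β ∧ α + β ≤ 1 ∧
    toReal c = toReal A + α • toReal X + β • toReal Y

/-- A set of integer points whose convex hull is a parallelogram with corners `A`, `A + X`, `A + Y`,
`A + X + Y`. -/
structure _root_.TropHarnack.HasParallelogram (D : Set (ℤ × ℤ)) (A X Y : ℤ × ℤ) : Prop where
  pos : 0 < X.1 * Y.2 - X.2 * Y.1
  mem₀ : A ∈ D
  mem₁ : A + X ∈ D
  mem₂ : A + Y ∈ D
  mem₃ : A + X + Y ∈ D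
  coord : ∀ c ∈ D, ∃ α β : ℝ, 0 ≤ α ∧ 0 ≤ β ∧ α ≤ 1 ∧ β ≤ 1 ∧
    toReal c = toReal A + α • toReal X + β • toReal Y

/-- A point of a convex hull at which a linear form has a strict maximum belongs to the spanning
set. This yields that the corners of a dual polygon are exponents. -/
theorem _root_.TropHarnack.mem_of_mem_convexHull {S : Set (ℝ × ℝ)} {c m : ℝ × ℝ}
    (hc : c ∈ convexHull ℝ S) (h : ∀ s ∈ S, s ≠ c → cross m s < cross m c) : c ∈ S := by
  by_contra hcS
  have hconv : Convex ℝ {p : ℝ × ℝ | cross m p < cross m c} := by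
    intro p hp q hq s t hs ht hst
    simp only [Set.mem_ofPred_eq] at *
    have e : cross m (s • p + t • q) = s * cross m p + t * cross m q := by
      simp only [cross, Prod.fst_add, Prod.snd_add, Prod.smul_fst, Prod.smul_snd, smul_eq_mul]
      ring
    rw [e]
    rcases hs.eq_or_lt with rfl | hs
    · obtain rfl : t = 1 := by linarith
      linarith
    · calc s * cross m p + t * cross m q < s * cross m c + t * cross m c :=
            add_lt_add_of_lt_of_le (mul_lt_mul_of_pos_left hp hs)
              (mul_le_mul_of_nonneg_left hq.le ht)
        _ = cross m c := by rw [← add_mul, hst, one_mul]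
  have : c ∈ {p : ℝ × ℝ | cross m p < cross m c} :=
    convexHull_min (fun s hs => h s hs (fun e => hcS (e ▸ hs))) hconv hc
  rw [Set.mem_ofPred_eq] at this
  exact lt_irrefl _ this

theorem _root_.TropHarnack.cross_coord (m a x y : ℝ × ℝ) (α β : ℝ) :
    cross m (a + α • x + β • y) = cross m a + α * cross m x + β * cross m y := by
  simp only [cross, Prod.fst_add, Prod.snd_add, Prod.smul_fst, Prod.smul_snd, smul_eq_mul]
  ring

theorem _root_.TropHarnack.cross_toReal (X Y : ℤ × ℤ) :
    cross (toReal X) (toReal Y) = ((X.1 * Y.2 - X.2 * Y.1 : ℤ) : ℝ) := by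
  simp [cross, toReal]

/-- The corners of a triangle spanned by integer points are integer points. -/
theorem _root_.TropHarnack.exists_hasTriangle {D : Set (ℤ × ℤ)}
    (h : IsTriangle (convexHull ℝ (toReal '' D))) : ∃ A X Y, HasTriangle D A X Y := by
  obtain ⟨a, x, y, hxy, hP⟩ : ∃ a x y : ℝ × ℝ, 0 < cross x y ∧
      convexHull ℝ (toReal '' D) = convexHull ℝ {a, a + x, a + y} := by
    obtain ⟨a, x, y, hxy, hP⟩ := h
    rcases lt_or_gt_of_ne hxy with h | h
    · refine ⟨a, y, x, ?_, ?_⟩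
      · simp only [cross] at h ⊢; linarith
      · rw [hP, Set.pair_comm]
    · exact ⟨a, x, y, h, hP⟩
  have hsub : convexHull ℝ ({a, a + x, a + y} : Set (ℝ × ℝ)) ⊆
      {p | ∃ α β : ℝ, 0 ≤ α ∧ 0 ≤ β ∧ α + β ≤ 1 ∧ p = a + α • x + β • y} := by
    refine convexHull_min ?_ ?_
    · rintro p (rfl | rfl | rfl)
      · exact ⟨0, 0, by simp⟩
      · exact ⟨1, 0, by simp⟩
      · exact ⟨0, 1, by simp⟩
    · rintro p ⟨α, β, h1, h2, h3, rfl⟩ q ⟨α', β', h1', h2', h3', rfl⟩ s t hs ht hst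
      refine ⟨s * α + t * α', s * β + t * β', by positivity, by positivity, by nlinarith, ?_⟩
      obtain rfl : t = 1 - s := by linarith
      module
  have hco : ∀ s ∈ toReal '' D, ∃ α β : ℝ, 0 ≤ α ∧ 0 ≤ β ∧ α + β ≤ 1 ∧
      s = a + α • x + β • y := fun s hs => hsub (hP ▸ subset_convexHull ℝ _ hs)
  have hmem : ∀ c ∈ ({a, a + x, a + y} : Set (ℝ × ℝ)), c ∈ convexHull ℝ (toReal '' D) :=
    fun c hc => hP ▸ subset_convexHull ℝ _ hc
  -- The linear form `cross m` has its maximum on the triangle only at the corner.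
  obtain ⟨A, hA, rfl⟩ : a ∈ toReal '' D := by
    refine mem_of_mem_convexHull (m := y - x) (hmem a (by simp)) fun s hs hne => ?_
    obtain ⟨α, β, h1, h2, h3, rfl⟩ := hco s hs
    have e1 : cross (y - x) x = -cross x y := by simp [cross]; ring
    have e2 : cross (y - x) y = -cross x y := by simp [cross]; ring
    rw [cross_coord, e1, e2]
    have : 0 < α + β := by
      rcases (add_nonneg h1 h2).eq_or_lt with h | h
      · obtain rfl : α = 0 := by linarith
        obtain rfl : β = 0 := by linarith
        simp at hne
      · exact h
    nlinarith
  obtain ⟨B, hB, hB'⟩ : toReal A + x ∈ toReal '' D := by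
    refine mem_of_mem_convexHull (m := -y) (hmem _ (by simp)) fun s hs hne => ?_
    obtain ⟨α, β, h1, h2, h3, rfl⟩ := hco s hs
    have e1 : cross (-y) x = cross x y := by simp [cross]; ring
    have e2 : cross (-y) y = 0 := by simp [cross]; ring
    have e3 := cross_coord (-y) (toReal A) x y 1 0
    rw [one_smul, zero_smul, add_zero] at e3
    rw [cross_coord, e3, e1, e2]
    have : α < 1 := by
      rcases (by linarith : α ≤ 1).eq_or_lt with rfl | h
      · obtain rfl : β = 0 := by linarith
        simp at hne
      · exact h
    nlinarith
  obtain ⟨B', hB2, hB2'⟩ : toReal A + y ∈ toReal '' D := by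
    refine mem_of_mem_convexHull (m := x) (hmem _ (by simp)) fun s hs hne => ?_
    obtain ⟨α, β, h1, h2, h3, rfl⟩ := hco s hs
    have e1 : cross x x = 0 := by simp [cross]; ring
    have e3 := cross_coord x (toReal A) x y 0 1
    rw [one_smul, zero_smul, add_zero] at e3
    rw [cross_coord, e3, e1]
    have : β < 1 := by
      rcases (by linarith : β ≤ 1).eq_or_lt with rfl | h
      · obtain rfl : α = 0 := by linarith
        simp at hne
      · exact h
    nlinarith
  obtain rfl : x = toReal (B - A) := by rw [toReal_sub, hB']; abel
  obtain rfl : y = toReal (B' - A) := by rw [toReal_sub, hB2']; abel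
  refine ⟨A, B - A, B' - A, ?_, hA, by simpa using hB, by simpa using hB2, ?_⟩
  · rw [cross_toReal] at hxy
    exact_mod_cast hxy
  · intro c hc
    exact hco _ ⟨c, hc, rfl⟩

/-- The corners of a parallelogram spanned by integer points are integer points. -/
theorem _root_.TropHarnack.exists_hasParallelogram {D : Set (ℤ × ℤ)}
    (h : IsParallelogram (convexHull ℝ (toReal '' D))) : ∃ A X Y, HasParallelogram D A X Y := by
  obtain ⟨a, x, y, hxy, hP⟩ : ∃ a x y : ℝ × ℝ, 0 < cross x y ∧
      convexHull ℝ (toReal '' D) = convexHull ℝ {a, a + x, a + y, a + x + y} := by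
    obtain ⟨a, x, y, hxy, hP⟩ := h
    rcases lt_or_gt_of_ne hxy with h | h
    · refine ⟨a, y, x, ?_, ?_⟩
      · simp only [cross] at h ⊢; linarith
      · rw [hP, Set.insert_comm (a + x), add_right_comm]
    · exact ⟨a, x, y, h, hP⟩
  have hsub : convexHull ℝ ({a, a + x, a + y, a + x + y} : Set (ℝ × ℝ)) ⊆
      {p | ∃ α β : ℝ, 0 ≤ α ∧ 0 ≤ β ∧ α ≤ 1 ∧ β ≤ 1 ∧ p = a + α • x + β • y} := by
    refine convexHull_min ?_ ?_
    · rintro p (rfl | rfl | rfl | rfl)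
      · exact ⟨0, 0, by simp⟩
      · exact ⟨1, 0, by simp⟩
      · exact ⟨0, 1, by simp⟩
      · exact ⟨1, 1, by simp⟩
    · rintro p ⟨α, β, h1, h2, h3, h4, rfl⟩ q ⟨α', β', h1', h2', h3', h4', rfl⟩ s t hs ht hst
      refine ⟨s * α + t * α', s * β + t * β', by positivity, by positivity, by nlinarith,
        by nlinarith, ?_⟩
      obtain rfl : t = 1 - s := by linarith
      module
  have hco : ∀ s ∈ toReal '' D, ∃ α β : ℝ, 0 ≤ α ∧ 0 ≤ β ∧ α ≤ 1 ∧ β ≤ 1 ∧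
      s = a + α • x + β • y := fun s hs => hsub (hP ▸ subset_convexHull ℝ _ hs)
  have hmem : ∀ c ∈ ({a, a + x, a + y, a + x + y} : Set (ℝ × ℝ)),
      c ∈ convexHull ℝ (toReal '' D) := fun c hc => hP ▸ subset_convexHull ℝ _ hc
  -- In each case `m` is a linear form whose maximum on the parallelogram is only at the corner.
  have corner : ∀ (α₀ β₀ : ℝ) (m : ℝ × ℝ),
      a + α₀ • x + β₀ • y ∈ ({a, a + x, a + y, a + x + y} : Set (ℝ × ℝ)) →
      (∀ α β : ℝ, 0 ≤ α → 0 ≤ β → α ≤ 1 → β ≤ 1 →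
        α₀ * cross m x + β₀ * cross m y ≤ α * cross m x + β * cross m y → α = α₀ ∧ β = β₀) →
      a + α₀ • x + β₀ • y ∈ toReal '' D := by
    intro α₀ β₀ m h1 h2
    refine mem_of_mem_convexHull (m := m) (hmem _ h1) fun s hs hne => ?_
    obtain ⟨α, β, h3, h4, h5, h6, rfl⟩ := hco s hs
    rw [cross_coord, cross_coord]
    by_contra hlt
    obtain ⟨rfl, rfl⟩ := h2 α β h3 h4 h5 h6 (by linarith)
    exact hne rfl
  obtain ⟨A, hA, hA'⟩ : a + (0 : ℝ) • x + (0 : ℝ) • y ∈ toReal '' D := by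
    refine corner 0 0 (y - x) (by simp) fun α β h1 h2 h3 h4 h => ?_
    have e1 : cross (y - x) x = -cross x y := by simp [cross]; ring
    have e2 : cross (y - x) y = -cross x y := by simp [cross]; ring
    rw [e1, e2] at h
    constructor <;> nlinarith
  obtain ⟨B, hB, hB'⟩ : a + (1 : ℝ) • x + (0 : ℝ) • y ∈ toReal '' D := by
    refine corner 1 0 (-(x + y)) (by simp) fun α β h1 h2 h3 h4 h => ?_
    have e1 : cross (-(x + y)) x = cross x y := by simp [cross]; ring
    have e2 : cross (-(x + y)) y = -cross x y := by simp [cross]; ring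
    rw [e1, e2] at h
    constructor <;> nlinarith
  obtain ⟨B', hB2, hB2'⟩ : a + (0 : ℝ) • x + (1 : ℝ) • y ∈ toReal '' D := by
    refine corner 0 1 (x + y) (by simp) fun α β h1 h2 h3 h4 h => ?_
    have e1 : cross (x + y) x = -cross x y := by simp [cross]; ring
    have e2 : cross (x + y) y = cross x y := by simp [cross]; ring
    rw [e1, e2] at h
    constructor <;> nlinarith
  obtain ⟨B'', hB3, hB3'⟩ : a + (1 : ℝ) • x + (1 : ℝ) • y ∈ toReal '' D := by
    refine corner 1 1 (x - y) (by simp) fun α β h1 h2 h3 h4 h => ?_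
    have e1 : cross (x - y) x = cross x y := by simp [cross]; ring
    have e2 : cross (x - y) y = cross x y := by simp [cross]; ring
    rw [e1, e2] at h
    constructor <;> nlinarith
  simp only [one_smul, zero_smul, add_zero] at hA' hB' hB2' hB3'
  subst hA'
  obtain rfl : x = toReal (B - A) := by rw [toReal_sub, hB']; abel
  obtain rfl : y = toReal (B' - A) := by rw [toReal_sub, hB2']; abel
  have hB4 : B'' = A + (B - A) + (B' - A) := by
    apply toReal_injective; rw [hB3', toReal_add, toReal_add]
  refine ⟨A, B - A, B' - A, ?_, hA, by simpa using hB, by simpa using hB2, hB4 ▸ hB3, ?_⟩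
  · rw [cross_toReal] at hxy
    exact_mod_cast hxy
  · intro c hc
    exact hco _ ⟨c, hc, rfl⟩

theorem pairing_rot_self (X : ℤ × ℤ) : pairing X (toReal (rot X)) = 0 := by
  simp [pairing, toReal, rot]; ring

theorem pairing_rot (X Y : ℤ × ℤ) :
    pairing Y (toReal (rot X)) = -((X.1 * Y.2 - X.2 * Y.1 : ℤ) : ℝ) := by
  simp [pairing, toReal, rot]; ring

/-- The triangle, seen from its second corner. -/
theorem _root_.TropHarnack.HasTriangle.rotate {D : Set (ℤ × ℤ)} {A X Y : ℤ × ℤ}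
    (h : HasTriangle D A X Y) : HasTriangle D (A + X) (Y - X) (-X) where
  pos := by
    have := h.pos
    simp only [Prod.fst_sub, Prod.snd_sub, Prod.fst_neg, Prod.snd_neg]
    linarith
  mem₀ := h.mem₁
  mem₁ := by simpa using h.mem₂
  mem₂ := by simpa using h.mem₀
  coord c hc := by
    obtain ⟨α, β, h1, h2, h3, e⟩ := h.coord c hc
    refine ⟨β, 1 - α - β, h2, by linarith, by linarith, ?_⟩
    rw [e, toReal_add, toReal_sub, toReal_neg]
    module

variable {C}

theorem _root_.TropHarnack.eq_smul_rot {X Y : ℤ × ℤ} (hpos : 0 < X.1 * Y.2 - X.2 * Y.1)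
    {d : ℝ × ℝ} (hX : pairing X d = 0) :
    d = (-pairing Y d / ((X.1 * Y.2 - X.2 * Y.1 : ℤ) : ℝ)) • toReal (rot X) := by
  have hκ : (0 : ℝ) < ((X.1 * Y.2 - X.2 * Y.1 : ℤ) : ℝ) := by exact_mod_cast hpos
  rw [div_eq_inv_mul, ← smul_smul, eq_inv_smul_iff₀ hκ.ne']
  simp only [pairing] at hX ⊢
  ext
  · simp only [toReal, rot, Prod.smul_fst, smul_eq_mul]
    push_cast
    linear_combination Y.2 * hX
  · simp only [toReal, rot, Prod.smul_snd, smul_eq_mul]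
    push_cast
    linear_combination (-Y.1 : ℝ) * hX

theorem mem_face_of_hasTriangle {v : ℝ × ℝ} {A X Y : ℤ × ℤ}
    (h : HasTriangle (C.dominant v) A X Y) {d : ℝ × ℝ} (hX : pairing X d = 0)
    (hY : pairing Y d < 0) :
    A ∈ C.face v d ∧ A + X ∈ C.face v d ∧ ∀ c ∈ C.face v d,
      ∃ θ : ℝ, 0 ≤ θ ∧ θ ≤ 1 ∧ toReal c = toReal A + θ • toReal X := by
  have hmax : ∀ c ∈ C.dominant v, pairing c d ≤ pairing A d := by
    intro c hc
    obtain ⟨α, β, h1, h2, h3, e⟩ := h.coord c hc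
    rw [pairing_eq_of_toReal_eq e, hX]
    nlinarith
  refine ⟨⟨h.mem₀, hmax⟩, ⟨h.mem₁, fun c hc => ?_⟩, fun c hc => ?_⟩
  · rw [pairing_add_left, hX, add_zero]
    exact hmax c hc
  · obtain ⟨α, β, h1, h2, h3, e⟩ := h.coord c hc.1
    have h4 := hc.2 A h.mem₀
    rw [pairing_eq_of_toReal_eq e, hX] at h4
    obtain rfl : β = 0 := by nlinarith
    exact ⟨α, h1, by linarith, by rw [e, zero_smul, add_zero]⟩

theorem face_rot_of_hasTriangle {v : ℝ × ℝ} {A X Y : ℤ × ℤ}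
    (h : HasTriangle (C.dominant v) A X Y) {r : ℝ} (hr : 0 < r) :
    (C.face v (r • toReal (rot X))).Nontrivial := by
  rw [face_smul _ _ _ hr]
  have hκ : (0 : ℝ) < ((X.1 * Y.2 - X.2 * Y.1 : ℤ) : ℝ) := by exact_mod_cast h.pos
  obtain ⟨h1, h2, -⟩ := mem_face_of_hasTriangle h (d := toReal (rot X)) (pairing_rot_self X)
    (by rw [pairing_rot]; linarith)
  refine ⟨A, h1, A + X, h2, fun e => ?_⟩
  have : X = 0 := by simpa using e.symm
  subst this
  simpa using h.pos

theorem weight_of_hasTriangle {v : ℝ × ℝ} {A X Y u : ℤ × ℤ} {g : ℕ}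
    (h : HasTriangle (C.dominant v) A X Y) (hg : 0 < g) (hu : IsPrimitive u)
    (e : rot X = (g : ℤ) • u) : C.weight v u = g := by
  have hX : X = (g : ℤ) • ((-u.2, u.1) : ℤ × ℤ) := by
    have h1 := congrArg Prod.fst e
    have h2 := congrArg Prod.snd e
    simp only [rot, Prod.smul_fst, Prod.smul_snd, smul_eq_mul] at h1 h2
    ext <;> simp only [Prod.smul_fst, Prod.smul_snd, smul_eq_mul] <;> linarith
  have hκ : (0 : ℝ) < ((X.1 * Y.2 - X.2 * Y.1 : ℤ) : ℝ) := by exact_mod_cast h.pos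
  have hg' : (0 : ℝ) < g := by exact_mod_cast hg
  have hface : C.dominantAlong v u = C.face v (toReal (rot X)) := by
    rw [dominantAlong_eq_face, e, toReal_smul, Int.cast_natCast, face_smul _ _ _ hg']
  obtain ⟨h1, h2, h3⟩ := mem_face_of_hasTriangle h (d := toReal (rot X)) (pairing_rot_self X)
    (by rw [pairing_rot]; linarith)
  rw [weight, hface]
  have h2' : A + (g : ℤ) • ((-u.2, u.1) : ℤ × ℤ) ∈ C.face v (toReal (rot X)) := by
    rw [← hX]; exact h2
  refine integerLength_convexHull (e := (-u.2, u.1)) ?_ h1 h2' ?_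
  · obtain ⟨s, t, hst⟩ := hu
    exact ⟨-t, s, by linear_combination hst⟩
  · rwa [← hX]

/-- At a vertex the curve consists locally of three rays, orthogonal to the sides of the dual
triangle. -/
theorem face_nontrivial_of_hasTriangle {v : ℝ × ℝ} {A X Y : ℤ × ℤ}
    (h : HasTriangle (C.dominant v) A X Y) {d : ℝ × ℝ} (hd : (C.face v d).Nontrivial) :
    d = 0 ∨ (∃ r : ℝ, 0 < r ∧ d = r • toReal (rot X)) ∨
      (∃ r : ℝ, 0 < r ∧ d = r • toReal (rot (Y - X))) ∨
      ∃ r : ℝ, 0 < r ∧ d = r • toReal (rot (-Y)) := by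
  have side : ∀ {A X Y : ℤ × ℤ}, HasTriangle (C.dominant v) A X Y → pairing X d = 0 →
      pairing Y d < 0 → ∃ r : ℝ, 0 < r ∧ d = r • toReal (rot X) := by
    intro A X Y h h1 h2
    have hκ : (0 : ℝ) < ((X.1 * Y.2 - X.2 * Y.1 : ℤ) : ℝ) := by exact_mod_cast h.pos
    exact ⟨_, div_pos (by linarith) hκ, eq_smul_rot h.pos h1⟩
  -- A unique maximum at a corner contradicts nontriviality of the face.
  have corner : ∀ {A X Y : ℤ × ℤ}, HasTriangle (C.dominant v) A X Y → pairing X d < 0 →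
      pairing Y d < 0 → False := by
    intro A X Y h h1 h2
    have huniq : ∀ c ∈ C.face v d, c = A := by
      intro c hc
      obtain ⟨α, β, h3, h4, h5, e⟩ := h.coord c hc.1
      have h6 := hc.2 A h.mem₀
      rw [pairing_eq_of_toReal_eq e] at h6
      obtain rfl : α = 0 := by nlinarith
      obtain rfl : β = 0 := by nlinarith
      apply toReal_injective
      simpa using e
    obtain ⟨c, hc, c', hc', hne⟩ := hd
    exact hne ((huniq c hc).trans (huniq c' hc').symm)
  have h' := h.rotate
  have h'' := h'.rotate
  have e1 : -X - (Y - X) = -Y := by abel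
  have e2 : -(Y - X) = X - Y := by abel
  rw [e1, e2] at h''
  have c0 := @corner _ _ _ h
  have c1 := @corner _ _ _ h'
  have c2 := @corner _ _ _ h''
  have s0 := @side _ _ _ h
  have s1 := @side _ _ _ h'
  have s2 := @side _ _ _ h''
  simp only [pairing_sub_left, pairing_neg_left] at c1 c2 s1 s2
  rcases lt_trichotomy (pairing X d) 0 with hp | hp | hp
  · rcases lt_trichotomy (pairing Y d) 0 with hq | hq | hq
    · exact (c0 hp hq).elim
    · exact Or.inr (Or.inr (Or.inr (s2 (by linarith) (by linarith))))
    · exact (c2 (by linarith) (by linarith)).elim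
  · rcases lt_trichotomy (pairing Y d) 0 with hq | hq | hq
    · exact Or.inr (Or.inl (s0 hp hq))
    · left
      rw [eq_smul_rot h.pos hp, hq]
      simp
    · exact (c2 (by linarith) (by linarith)).elim
  · rcases lt_trichotomy (pairing Y d) (pairing X d) with hq | hq | hq
    · exact (c1 (by linarith) (by linarith)).elim
    · exact Or.inr (Or.inr (Or.inl (s1 (by linarith) (by linarith))))
    · exact (c2 (by linarith) (by linarith)).elim

variable (C) in
/-- The three leaves or edges that leave the vertex `v`, in counterclockwise order, given by their
primitive integer vectors. -/
structure IsLegSystem (v : ℝ × ℝ) (u : Fin 3 → ℤ × ℤ) : Prop where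
  primitive : ∀ i, IsPrimitive (u i)
  face_nontrivial : ∀ d, (C.face v d).Nontrivial ↔
    d = 0 ∨ ∃ i, ∃ r : ℝ, 0 < r ∧ d = r • toReal (u i)
  weight_pos : ∀ i, 0 < C.weight v (u i)
  balanced : ∑ i, (C.weight v (u i) : ℤ) • u i = 0
  ccw : ∀ i, 0 < cross (toReal (u i)) (toReal (u (i + 1)))

theorem exists_isLegSystem {v : ℝ × ℝ} (hv : v ∈ C.vertices) : ∃ u, C.IsLegSystem v u := by
  obtain ⟨A, X, Y, h⟩ := exists_hasTriangle hv
  have h' := h.rotate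
  have h'' := h'.rotate
  have e1 : -X - (Y - X) = -Y := by abel
  have e2 : -(Y - X) = X - Y := by abel
  rw [e1, e2] at h''
  have hne : ∀ {A X Y : ℤ × ℤ}, HasTriangle (C.dominant v) A X Y → rot X ≠ 0 := by
    intro A X Y h e
    have h1 := congrArg Prod.fst e
    have h2 := congrArg Prod.snd e
    have := h.pos
    simp only [rot, Prod.fst_zero, Prod.snd_zero, neg_eq_zero] at h1 h2
    simp [h1, h2] at this
  obtain ⟨g0, u0, hg0, hu0, E0⟩ := exists_primitive_smul (hne h)
  obtain ⟨g1, u1, hg1, hu1, E1⟩ := exists_primitive_smul (hne h')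
  obtain ⟨g2, u2, hg2, hu2, E2⟩ := exists_primitive_smul (hne h'')
  have w0 := weight_of_hasTriangle h hg0 hu0 E0
  have w1 := weight_of_hasTriangle h' hg1 hu1 E1
  have w2 := weight_of_hasTriangle h'' hg2 hu2 E2
  have hcross : ∀ {X Y u u' : ℤ × ℤ} {g g' : ℕ}, 0 < g → 0 < g' → rot X = (g : ℤ) • u →
      rot Y = (g' : ℤ) • u' → 0 < X.1 * Y.2 - X.2 * Y.1 →
      0 < cross (toReal u) (toReal u') := by
    intro X Y u u' g g' hg hg' e e' hpos
    rw [cross_toReal]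
    have h1 := congrArg Prod.fst e
    have h2 := congrArg Prod.snd e
    have h3 := congrArg Prod.fst e'
    have h4 := congrArg Prod.snd e'
    simp only [rot, Prod.smul_fst, Prod.smul_snd, smul_eq_mul] at h1 h2 h3 h4
    have : X.1 * Y.2 - X.2 * Y.1 = (g * g' : ℤ) * (u.1 * u'.2 - u.2 * u'.1) := by
      have h2' : X.1 = -(g * u.2) := by linarith
      have h4' : Y.1 = -(g' * u'.2) := by linarith
      rw [h1, h2', h3, h4']; ring
    rw [this] at hpos
    exact_mod_cast (mul_pos_iff_of_pos_left (by positivity)).1 hpos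
  have scale : ∀ {d : ℝ × ℝ} {X u : ℤ × ℤ} {g : ℕ}, 0 < g → rot X = (g : ℤ) • u →
      ((∃ r : ℝ, 0 < r ∧ d = r • toReal (rot X)) ↔ ∃ r : ℝ, 0 < r ∧ d = r • toReal u) := by
    intro d X u g hg e
    have hg' : (0 : ℝ) < g := by exact_mod_cast hg
    rw [e, toReal_smul, Int.cast_natCast]
    constructor
    · rintro ⟨r, hr, rfl⟩
      exact ⟨r * g, by positivity, by rw [smul_smul]⟩
    · rintro ⟨r, hr, rfl⟩
      exact ⟨r / g, by positivity, by rw [smul_smul, div_mul_cancel₀ _ hg'.ne']⟩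
  refine ⟨![u0, u1, u2], ?_, ?_, ?_, ?_, ?_⟩
  · intro i; fin_cases i <;> assumption
  · intro d
    have : (∃ i, ∃ r : ℝ, 0 < r ∧ d = r • toReal ((![u0, u1, u2] : Fin 3 → ℤ × ℤ) i)) ↔
        (∃ r : ℝ, 0 < r ∧ d = r • toReal (rot X)) ∨
        (∃ r : ℝ, 0 < r ∧ d = r • toReal (rot (Y - X))) ∨
        ∃ r : ℝ, 0 < r ∧ d = r • toReal (rot (-Y)) := by
      rw [scale hg0 E0, scale hg1 E1, scale hg2 E2]
      simp [Fin.exists_fin_succ]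
    rw [this]
    refine ⟨face_nontrivial_of_hasTriangle h, ?_⟩
    rintro (rfl | ⟨r, hr, rfl⟩ | ⟨r, hr, rfl⟩ | ⟨r, hr, rfl⟩)
    · rw [face_zero]
      have := face_rot_of_hasTriangle h one_pos
      exact this.mono fun a ha => ha.1
    · exact face_rot_of_hasTriangle h hr
    · exact face_rot_of_hasTriangle h' hr
    · exact face_rot_of_hasTriangle h'' hr
  · intro i; fin_cases i
    · exact w0 ▸ hg0
    · exact w1 ▸ hg1
    · exact w2 ▸ hg2
  · simp only [Fin.sum_univ_three, Matrix.cons_val_zero, Matrix.cons_val_one, Matrix.cons_val]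
    rw [w0, w1, w2, ← E0, ← E1, ← E2, rot_sub, rot_neg]
    abel
  · intro i; fin_cases i
    · refine hcross hg0 hg1 E0 E1 ?_
      have := h.pos; simp only [Prod.fst_sub, Prod.snd_sub]; linarith
    · refine hcross hg1 hg2 E1 E2 ?_
      have := h.pos; simp only [Prod.fst_sub, Prod.snd_sub, Prod.fst_neg, Prod.snd_neg]; linarith
    · refine hcross hg2 hg0 E2 E0 ?_
      have := h.pos; simp only [Prod.fst_neg, Prod.snd_neg]; linarith

/-! ### Points that are not vertices -/

/-- At a node the curve consists locally of two lines, orthogonal to the sides of the dual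
parallelogram. -/
theorem face_nontrivial_iff_of_hasParallelogram {x : ℝ × ℝ} {A X Y : ℤ × ℤ}
    (h : HasParallelogram (C.dominant x) A X Y) {d : ℝ × ℝ} :
    (C.face x d).Nontrivial ↔ pairing X d = 0 ∨ pairing Y d = 0 := by
  constructor
  · intro hd
    by_contra! hne
    -- Otherwise the linear form `d` is maximal on the parallelogram at a single corner.
    have huniq : ∃ α₀ β₀ : ℝ, ∀ c ∈ C.face x d,
        toReal c = toReal A + α₀ • toReal X + β₀ • toReal Y := by
      have hmax : ∀ c ∈ C.face x d, ∃ α β : ℝ, 0 ≤ α ∧ 0 ≤ β ∧ α ≤ 1 ∧ β ≤ 1 ∧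
          toReal c = toReal A + α • toReal X + β • toReal Y ∧
          0 ≤ α * pairing X d + β * pairing Y d ∧
          pairing X d ≤ α * pairing X d + β * pairing Y d ∧
          pairing Y d ≤ α * pairing X d + β * pairing Y d ∧
          pairing X d + pairing Y d ≤ α * pairing X d + β * pairing Y d := by
        intro c hc
        obtain ⟨α, β, h1, h2, h3, h4, e⟩ := h.coord c hc.1
        have m0 := hc.2 _ h.mem₀
        have m1 := hc.2 _ h.mem₁
        have m2 := hc.2 _ h.mem₂
        have m3 := hc.2 _ h.mem₃
        rw [pairing_eq_of_toReal_eq e] at m0 m1 m2 m3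
        simp only [pairing_add_left] at m1 m2 m3
        exact ⟨α, β, h1, h2, h3, h4, e, by linarith, by linarith, by linarith, by linarith⟩
      rcases lt_or_gt_of_ne hne.1 with hp | hp <;> rcases lt_or_gt_of_ne hne.2 with hq | hq
      · refine ⟨0, 0, fun c hc => ?_⟩
        obtain ⟨α, β, h1, h2, h3, h4, e, m0, m1, m2, m3⟩ := hmax c hc
        obtain rfl : α = 0 := by nlinarith
        obtain rfl : β = 0 := by nlinarith
        exact e
      · refine ⟨0, 1, fun c hc => ?_⟩
        obtain ⟨α, β, h1, h2, h3, h4, e, m0, m1, m2, m3⟩ := hmax c hc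
        obtain rfl : α = 0 := by nlinarith
        obtain rfl : β = 1 := by nlinarith
        exact e
      · refine ⟨1, 0, fun c hc => ?_⟩
        obtain ⟨α, β, h1, h2, h3, h4, e, m0, m1, m2, m3⟩ := hmax c hc
        obtain rfl : β = 0 := by nlinarith
        obtain rfl : α = 1 := by nlinarith
        exact e
      · refine ⟨1, 1, fun c hc => ?_⟩
        obtain ⟨α, β, h1, h2, h3, h4, e, m0, m1, m2, m3⟩ := hmax c hc
        obtain rfl : α = 1 := by nlinarith
        obtain rfl : β = 1 := by nlinarith
        exact e
    obtain ⟨α₀, β₀, huniq⟩ := huniq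
    obtain ⟨c, hc, c', hc', hne⟩ := hd
    exact hne (toReal_injective ((huniq c hc).trans (huniq c' hc').symm))
  · have hX : X ≠ 0 := by rintro rfl; simpa using h.pos
    have hY : Y ≠ 0 := by rintro rfl; simpa using h.pos
    have key : ∀ {a b : ℤ × ℤ}, a ∈ C.dominant x → b ∈ C.dominant x → a ≠ b →
        (∀ c ∈ C.dominant x, pairing c d ≤ pairing a d) → pairing a d = pairing b d →
        (C.face x d).Nontrivial := fun ha hb hne hm he =>
      ⟨_, ⟨ha, hm⟩, _, ⟨hb, fun c hc => he ▸ hm c hc⟩, hne⟩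
    rintro (h0 | h0)
    · rcases le_total (pairing Y d) 0 with hq | hq
      · refine key h.mem₀ h.mem₁ (by simpa using hX) (fun c hc => ?_)
          (by rw [pairing_add_left, h0, add_zero])
        obtain ⟨α, β, h1, h2, h3, h4, e⟩ := h.coord c hc
        rw [pairing_eq_of_toReal_eq e, h0]
        nlinarith
      · refine key h.mem₂ h.mem₃ (by rw [add_right_comm]; simpa using hX) (fun c hc => ?_)
          (by simp only [pairing_add_left, h0, add_zero])
        obtain ⟨α, β, h1, h2, h3, h4, e⟩ := h.coord c hc
        rw [pairing_eq_of_toReal_eq e, pairing_add_left, h0]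
        nlinarith
    · rcases le_total (pairing X d) 0 with hq | hq
      · refine key h.mem₀ h.mem₂ (by simpa using hY) (fun c hc => ?_)
          (by rw [pairing_add_left, h0, add_zero])
        obtain ⟨α, β, h1, h2, h3, h4, e⟩ := h.coord c hc
        rw [pairing_eq_of_toReal_eq e, h0]
        nlinarith
      · refine key h.mem₁ h.mem₃ (by simpa using hY) (fun c hc => ?_)
          (by simp only [pairing_add_left, h0, add_zero])
        obtain ⟨α, β, h1, h2, h3, h4, e⟩ := h.coord c hc
        rw [pairing_eq_of_toReal_eq e, pairing_add_left, h0]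
        nlinarith

theorem _root_.TropHarnack.HasParallelogram.rotate {D : Set (ℤ × ℤ)} {A X Y : ℤ × ℤ}
    (h : HasParallelogram D A X Y) : HasParallelogram D (A + X) Y (-X) where
  pos := by have := h.pos; simp only [Prod.fst_neg, Prod.snd_neg]; linarith
  mem₀ := h.mem₁
  mem₁ := h.mem₃
  mem₂ := by simpa using h.mem₀
  mem₃ := by rw [show A + X + Y + -X = A + Y by abel]; exact h.mem₂
  coord c hc := by
    obtain ⟨α, β, h1, h2, h3, h4, e⟩ := h.coord c hc
    refine ⟨β, 1 - α, h2, by linarith, h4, by linarith, ?_⟩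
    rw [e, toReal_add, toReal_neg]
    module

/-- Opposite sides of a lattice parallelogram have the same integer length. -/
theorem weight_neg_of_hasParallelogram {x : ℝ × ℝ} {A X Y u : ℤ × ℤ}
    (h : HasParallelogram (C.dominant x) A X Y) (hu : pairing X (toReal u) = 0) :
    C.weight x (-u) = C.weight x u := by
  have hX : X ≠ 0 := by rintro rfl; simpa using h.pos
  obtain ⟨g, e, hg, he, rfl⟩ := exists_primitive_smul hX
  set X := (g : ℤ) • e with hXdef
  have low : ∀ d : ℝ × ℝ, pairing X d = 0 → pairing Y d < 0 →
      integerLength (convexHull ℝ (toReal '' C.face x d)) = g := by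
    intro d h0 hq
    refine integerLength_convexHull he (A := A) ⟨h.mem₀, ?_⟩ ⟨h.mem₁, ?_⟩ ?_
    · intro c hc
      obtain ⟨α, β, h1, h2, h3, h4, e⟩ := h.coord c hc
      rw [pairing_eq_of_toReal_eq e, h0]
      nlinarith
    · intro c hc
      obtain ⟨α, β, h1, h2, h3, h4, e⟩ := h.coord c hc
      rw [pairing_eq_of_toReal_eq e, pairing_add_left, h0]
      nlinarith
    · intro c hc
      obtain ⟨α, β, h1, h2, h3, h4, e⟩ := h.coord c hc.1
      have m := hc.2 _ h.mem₀
      rw [pairing_eq_of_toReal_eq e, h0] at m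
      obtain rfl : β = 0 := by nlinarith
      exact ⟨α, h1, h3, by rw [e, zero_smul, add_zero]⟩
  have high : ∀ d : ℝ × ℝ, pairing X d = 0 → 0 < pairing Y d →
      integerLength (convexHull ℝ (toReal '' C.face x d)) = g := by
    intro d h0 hq
    refine integerLength_convexHull he (A := A + Y) ⟨h.mem₂, ?_⟩ ⟨?_, ?_⟩ ?_
    · intro c hc
      obtain ⟨α, β, h1, h2, h3, h4, e⟩ := h.coord c hc
      rw [pairing_eq_of_toReal_eq e, pairing_add_left, h0]
      nlinarith
    · rw [add_right_comm]; exact h.mem₃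
    · intro c hc
      obtain ⟨α, β, h1, h2, h3, h4, e⟩ := h.coord c hc
      rw [pairing_eq_of_toReal_eq e, pairing_add_left, pairing_add_left, h0]
      nlinarith
    · intro c hc
      obtain ⟨α, β, h1, h2, h3, h4, e⟩ := h.coord c hc.1
      have m := hc.2 _ h.mem₂
      rw [pairing_eq_of_toReal_eq e, pairing_add_left, h0] at m
      obtain rfl : β = 1 := by nlinarith
      exact ⟨α, h1, h3, by rw [e, one_smul, toReal_add]; abel⟩
  rw [weight, weight, dominantAlong_eq_face, dominantAlong_eq_face, toReal_neg]
  rcases lt_trichotomy (pairing Y (toReal u)) 0 with hq | hq | hq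
  · rw [low _ hu hq, high]
    · rw [pairing_neg_right, hu, neg_zero]
    · rw [pairing_neg_right]; linarith
  · have hu0 : toReal u = 0 := by rw [eq_smul_rot h.pos hu, hq]; simp
    rw [hu0, neg_zero]
  · rw [high _ hu hq, low]
    · rw [pairing_neg_right, hu, neg_zero]
    · rw [pairing_neg_right]; linarith

/-- Three points that are not collinear span a convex set with interior points. -/
theorem _root_.TropHarnack.interior_convexHull_nonempty {S : Set (ℝ × ℝ)} {a x y : ℝ × ℝ}
    (ha : a ∈ S) (hx : a + x ∈ S) (hy : a + y ∈ S) (hxy : cross x y ≠ 0) :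
    (interior (convexHull ℝ S)).Nonempty := by
  let U : Set (ℝ × ℝ) := {p | 0 < cross (p - a) y / cross x y ∧ 0 < cross x (p - a) / cross x y ∧
    cross (p - a) y / cross x y + cross x (p - a) / cross x y < 1}
  have hU : IsOpen U := by
    have h1 : Continuous fun p : ℝ × ℝ => cross (p - a) y / cross x y := by
      unfold cross; fun_prop
    have h2 : Continuous fun p : ℝ × ℝ => cross x (p - a) / cross x y := by
      unfold cross; fun_prop
    exact (isOpen_lt continuous_const h1).inter
      ((isOpen_lt continuous_const h2).inter (isOpen_lt (h1.add h2) continuous_const))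
  have hsub : U ⊆ convexHull ℝ S := by
    rintro p ⟨h1, h2, h3⟩
    set α := cross (p - a) y / cross x y
    set β := cross x (p - a) / cross x y
    have hp : p = (1 - α - β) • a + α • (a + x) + β • (a + y) := by
      have e1 : α * cross x y = cross (p - a) y := div_mul_cancel₀ _ hxy
      have e2 : β * cross x y = cross x (p - a) := div_mul_cancel₀ _ hxy
      simp only [cross, Prod.fst_sub, Prod.snd_sub] at e1 e2 hxy
      ext
      · simp only [Prod.fst_add, Prod.smul_fst, smul_eq_mul]
        apply mul_right_cancel₀ hxy
        linear_combination -x.1 * e1 - y.1 * e2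
      · simp only [Prod.snd_add, Prod.smul_snd, smul_eq_mul]
        apply mul_right_cancel₀ hxy
        linear_combination -x.2 * e1 - y.2 * e2
    rw [hp]
    have hc := (convex_convexHull ℝ S).sum_mem (t := Finset.univ) (w := ![1 - α - β, α, β])
      (z := ![a, a + x, a + y]) ?_ ?_ ?_
    · simpa [Fin.sum_univ_three] using hc
    · intro i _; fin_cases i <;> simp <;> linarith
    · simp only [Fin.sum_univ_three, Matrix.cons_val_zero, Matrix.cons_val_one, Matrix.cons_val]
      ring
    · intro i _; fin_cases i
      · exact subset_convexHull ℝ S ha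
      · exact subset_convexHull ℝ S hx
      · exact subset_convexHull ℝ S hy
  refine ⟨a + (1 / 3 : ℝ) • x + (1 / 3 : ℝ) • y, interior_maximal hsub hU ?_⟩
  have e1 : cross (a + (1 / 3 : ℝ) • x + (1 / 3 : ℝ) • y - a) y / cross x y = 1 / 3 := by
    rw [div_eq_iff hxy]; simp [cross]; ring
  have e2 : cross x (a + (1 / 3 : ℝ) • x + (1 / 3 : ℝ) • y - a) / cross x y = 1 / 3 := by
    rw [div_eq_iff hxy]; simp [cross]; ring
  simp only [U, Set.mem_ofPred_eq, e1, e2]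
  norm_num

variable (C) in
/-- The local shape of the curve at a point inside a leaf or edge that is not a node: a straight
line, with conormal vector `m`. -/
def IsSmoothAt (x : ℝ × ℝ) (m : ℤ × ℤ) : Prop :=
  m ≠ 0 ∧ ∀ d, (pairing m d = 0 → C.face x d = C.dominant x) ∧
    ((C.face x d).Nontrivial → pairing m d = 0)

/-- A dual cell without interior is a segment. -/
theorem exists_isSmoothAt {x : ℝ × ℝ} (hx : x ∈ C.curve)
    (hint : ¬ (interior (C.dualCell x)).Nonempty) : ∃ m, C.IsSmoothAt x m := by
  obtain ⟨a, ha, b, hb, hab⟩ := hx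
  have hcol : ∀ c ∈ C.dominant x, cross (toReal (b - a)) (toReal (c - a)) = 0 := by
    intro c hc
    by_contra h
    exact hint (interior_convexHull_nonempty (a := toReal a) ⟨a, ha, rfl⟩
      ⟨b, hb, by rw [toReal_sub]; abel⟩ ⟨c, hc, by rw [toReal_sub]; abel⟩ h)
  have hm : b - a ≠ 0 := sub_ne_zero.2 hab.symm
  have hm' : (toReal (b - a)).1 ≠ 0 ∨ (toReal (b - a)).2 ≠ 0 := by
    by_contra! h
    exact hm (toReal_injective (Prod.ext (h.1.trans (by simp [toReal]))
      (h.2.trans (by simp [toReal]))))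
  have hlam : ∀ c ∈ C.dominant x, ∃ θ : ℝ, toReal c = toReal a + θ • toReal (b - a) := by
    intro c hc
    have h := hcol c hc
    have h1 : (toReal c).1 - (toReal a).1 = (toReal (c - a)).1 := by rw [toReal_sub]; rfl
    have h2 : (toReal c).2 - (toReal a).2 = (toReal (c - a)).2 := by rw [toReal_sub]; rfl
    simp only [cross] at h
    rcases hm' with hm' | hm'
    · refine ⟨(toReal (c - a)).1 / (toReal (b - a)).1, Prod.ext ?_ ?_⟩
      · simp only [Prod.fst_add, Prod.smul_fst, smul_eq_mul]
        rw [div_mul_cancel₀ _ hm']; linarith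
      · simp only [Prod.snd_add, Prod.smul_snd, smul_eq_mul]
        rw [div_mul_eq_mul_div, ← sub_eq_iff_eq_add', eq_div_iff hm', h2]; linarith
    · refine ⟨(toReal (c - a)).2 / (toReal (b - a)).2, Prod.ext ?_ ?_⟩
      · simp only [Prod.fst_add, Prod.smul_fst, smul_eq_mul]
        rw [div_mul_eq_mul_div, ← sub_eq_iff_eq_add', eq_div_iff hm', h1]; linarith
      · simp only [Prod.snd_add, Prod.smul_snd, smul_eq_mul]
        rw [div_mul_cancel₀ _ hm']; linarith
  have hpair : ∀ c ∈ C.dominant x, ∀ d, ∃ θ : ℝ, toReal c = toReal a + θ • toReal (b - a) ∧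
      pairing c d = pairing a d + θ * pairing (b - a) d := by
    intro c hc d
    obtain ⟨θ, h⟩ := hlam c hc
    refine ⟨θ, h, ?_⟩
    have := pairing_eq_of_toReal_eq (c := c) (A := a) (X := b - a) (Y := 0) (α := θ) (β := 0)
      (by rw [h]; simp) d
    rw [this]; ring
  refine ⟨b - a, hm, fun d => ⟨fun h0 => ?_, fun ⟨c, hc, c', hc', hne⟩ => ?_⟩⟩
  · ext c
    refine ⟨fun hc => hc.1, fun hc => ⟨hc, fun c' hc' => ?_⟩⟩
    obtain ⟨θ, -, h⟩ := hpair c hc d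
    obtain ⟨θ', -, h'⟩ := hpair c' hc' d
    rw [h, h', h0, mul_zero, mul_zero]
  · obtain ⟨θ, e, h⟩ := hpair c hc.1 d
    obtain ⟨θ', e', h'⟩ := hpair c' hc'.1 d
    have h1 := C.pairing_face hc hc'
    rw [h, h'] at h1
    have h2 : (θ - θ') * pairing (b - a) d = 0 := by linarith
    rcases mul_eq_zero.1 h2 with h3 | h3
    · obtain rfl : θ = θ' := by linarith
      exact absurd (toReal_injective (e.trans e'.symm)) hne
    · exact h3

end TropPoly

theorem toReal_zero : toReal 0 = 0 := by
  ext <;> simp [toReal]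

theorem toReal_ne_zero {m : ℤ × ℤ} (h : m ≠ 0) : toReal m ≠ 0 := fun h0 =>
  h (toReal_injective (h0.trans toReal_zero.symm))

theorem rot_ne_zero {m : ℤ × ℤ} (h : m ≠ 0) : rot m ≠ 0 := by
  intro h0
  have e1 := congrArg Prod.fst h0
  have e2 := congrArg Prod.snd h0
  simp only [rot, Prod.fst_zero, Prod.snd_zero, neg_eq_zero] at e1 e2
  exact h (Prod.ext e2 e1)

theorem exists_smul_of_pairing_eq_zero {m : ℤ × ℤ} (hm : m ≠ 0) {u d : ℝ × ℝ} (hu : u ≠ 0)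
    (h1 : pairing m u = 0) (h2 : pairing m d = 0) : ∃ r : ℝ, d = r • u := by
  simp only [pairing] at h1 h2
  have hc : u.1 * d.2 = u.2 * d.1 := by
    have hm' : (m.1 : ℝ) ≠ 0 ∨ (m.2 : ℝ) ≠ 0 := by
      by_contra! h
      exact hm (Prod.ext (by exact_mod_cast h.1) (by exact_mod_cast h.2))
    rcases hm' with h | h
    · apply mul_left_cancel₀ h
      linear_combination d.2 * h1 - u.2 * h2
    · apply mul_left_cancel₀ h
      linear_combination u.1 * h2 - d.1 * h1
  by_cases hu1 : u.1 = 0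
  · have hu2 : u.2 ≠ 0 := fun h => hu (Prod.ext hu1 h)
    refine ⟨d.2 / u.2, Prod.ext ?_ ?_⟩
    · rw [hu1, zero_mul] at hc
      rcases mul_eq_zero.1 hc.symm with h | h
      · exact absurd h hu2
      · simp [hu1, h]
    · simp [div_mul_cancel₀ _ hu2]
  · refine ⟨d.1 / u.1, Prod.ext ?_ ?_⟩
    · simp [div_mul_cancel₀ _ hu1]
    · simp only [Prod.smul_snd, smul_eq_mul]
      rw [div_mul_eq_mul_div, eq_div_iff hu1]; linarith

theorem lineClass_smul {r : ℝ} (hr : r ≠ 0) (y : ℝ × ℝ) : lineClass (r • y) = lineClass y := by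
  have e : (((r • y).1 : ℝ) : ℂ) + (((r • y).2 : ℝ) : ℂ) * Complex.I =
      (r : ℂ) * ((y.1 : ℂ) + (y.2 : ℂ) * Complex.I) := by
    simp only [Prod.smul_fst, Prod.smul_snd, smul_eq_mul]; push_cast; ring
  have hr' : (r : ℂ) ≠ 0 := by exact_mod_cast hr
  have habs : ((|r| : ℝ) : ℂ) ^ 2 = (r : ℂ) ^ 2 := by
    rw [← Complex.ofReal_pow, sq_abs, Complex.ofReal_pow]
  rw [lineClass, lineClass, e, norm_mul, Complex.norm_real, Real.norm_eq_abs, Complex.ofReal_mul,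
    div_pow, div_pow, mul_pow, mul_pow, habs, mul_div_mul_left _ _ (pow_ne_zero 2 hr')]

theorem cross_eq_zero_of_lineClass_eq {y y' : ℝ × ℝ} (h : lineClass y = lineClass y') :
    cross y y' = 0 := by
  set z : ℂ := (y.1 : ℂ) + (y.2 : ℂ) * Complex.I with hz
  set z' : ℂ := (y'.1 : ℂ) + (y'.2 : ℂ) * Complex.I with hz'
  have h' : (z / (‖z‖ : ℂ)) ^ 2 = (z' / (‖z'‖ : ℂ)) ^ 2 := h
  by_cases h0 : z = 0
  · have e1 : y.1 = 0 := by simpa [hz] using congrArg Complex.re h0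
    have e2 : y.2 = 0 := by simpa [hz] using congrArg Complex.im h0
    simp [cross, e1, e2]
  by_cases h0' : z' = 0
  · have e1 : y'.1 = 0 := by simpa [hz'] using congrArg Complex.re h0'
    have e2 : y'.2 = 0 := by simpa [hz'] using congrArg Complex.im h0'
    simp [cross, e1, e2]
  have hn : (‖z‖ : ℂ) ≠ 0 := by simpa using h0
  have hn' : (‖z'‖ : ℂ) ≠ 0 := by simpa using h0'
  have key : ∃ r : ℝ, r ≠ 0 ∧ ((‖z'‖ : ℝ) : ℂ) * z = (r : ℂ) * z' := by
    rcases sq_eq_sq_iff_eq_or_eq_neg.1 h' with e | e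
    · refine ⟨‖z‖, by simpa using h0, ?_⟩
      field_simp at e
      linear_combination e
    · refine ⟨-‖z‖, by simpa using h0, ?_⟩
      field_simp at e
      push_cast
      linear_combination e
  obtain ⟨r, hr, e⟩ := key
  have e1 := congrArg Complex.re e
  have e2 := congrArg Complex.im e
  simp [hz, hz'] at e1 e2
  have hn'' : ‖z'‖ ≠ 0 := by simpa using h0'
  apply mul_left_cancel₀ hn''
  simp only [cross, mul_zero]
  linear_combination y'.2 * e1 - y'.1 * e2

namespace TropPoly

variable {C : TropPoly}

theorem weight_neg_of_isSmoothAt {x : ℝ × ℝ} {m : ℤ × ℤ} (hm : C.IsSmoothAt x m) {u : ℤ × ℤ}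
    (hu : (C.face x (toReal u)).Nontrivial) : C.weight x (-u) = C.weight x u := by
  have h0 := (hm.2 _).2 hu
  rw [weight, weight, dominantAlong_eq_face, dominantAlong_eq_face, (hm.2 _).1 h0,
    (hm.2 _).1 (by rw [toReal_neg, pairing_neg_right, h0, neg_zero])]

theorem exists_isSmoothAt_of_notMem (hs : C.IsSimple) {x : ℝ × ℝ} (hx : x ∈ C.curve)
    (hv : x ∉ C.vertices) (hn : x ∉ C.nodes) : ∃ m, C.IsSmoothAt x m := by
  refine exists_isSmoothAt hx fun h => ?_
  rcases hs x h with h | h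
  · exact hv h
  · exact hn h

/-- At a point that is not a vertex the curve is locally a line or a union of two lines, and its
weights are the same in opposite directions. -/
theorem exists_lines (hs : C.IsSimple) {x : ℝ × ℝ} (hx : x ∈ C.curve) (hv : x ∉ C.vertices) :
    ∃ m m' : ℤ × ℤ, m ≠ 0 ∧ m' ≠ 0 ∧
      (∀ d, (C.face x d).Nontrivial ↔ pairing m d = 0 ∨ pairing m' d = 0) ∧
      (m = m' ∨ (x ∈ C.nodes ∧ 0 < m.1 * m'.2 - m.2 * m'.1)) ∧
      ∀ u, (C.face x (toReal u)).Nontrivial → C.weight x (-u) = C.weight x u := by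
  by_cases hn : x ∈ C.nodes
  · obtain ⟨A, X, Y, h⟩ := exists_hasParallelogram hn
    refine ⟨X, Y, ?_, ?_, fun d => face_nontrivial_iff_of_hasParallelogram h, Or.inr ⟨hn, h.pos⟩, fun u hu => ?_⟩
    · rintro rfl; simpa using h.pos
    · rintro rfl; simpa using h.pos
    · rcases (face_nontrivial_iff_of_hasParallelogram h).1 hu with h0 | h0
      · exact weight_neg_of_hasParallelogram h h0
      · exact weight_neg_of_hasParallelogram h.rotate h0
  · obtain ⟨m, hm⟩ := exists_isSmoothAt_of_notMem hs hx hv hn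
    refine ⟨m, m, hm.1, hm.1, fun d => ?_, Or.inl rfl, fun u hu => weight_neg_of_isSmoothAt hm hu⟩
    rw [or_self]
    exact ⟨(hm.2 d).2, fun h => by rw [(hm.2 d).1 h]; exact hx⟩

/-- Vertices and nodes are isolated. -/
theorem exists_ball (C : TropPoly) (x : ℝ × ℝ) : ∃ ε > 0, ∀ y, dist y x < ε →
    C.dominant y = C.face x (y - x) ∧ (y ≠ x → y ∉ C.vertices ∧ y ∉ C.nodes) := by
  obtain ⟨ε, hε, h⟩ := Metric.eventually_nhds_iff.1 (C.eventually_dominant_eq_face x)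
  refine ⟨ε, hε, fun y hy => ⟨h hy, fun hne => ?_⟩⟩
  have hpair : ∀ {A X Y : ℤ × ℤ}, 0 < X.1 * Y.2 - X.2 * Y.1 → A ∈ C.dominant y →
      A + X ∈ C.dominant y → A + Y ∈ C.dominant y → False := by
    intro A X Y hpos h0 h1 h2
    rw [h hy] at h0 h1 h2
    have e1 := C.pairing_face h0 h1
    have e2 := C.pairing_face h0 h2
    rw [pairing_add_left, left_eq_add] at e1 e2
    have := eq_smul_rot hpos e1
    rw [e2] at this
    simp only [neg_zero, zero_div, zero_smul, sub_eq_zero] at this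
    exact hne this
  constructor
  · intro hv
    obtain ⟨A, X, Y, h⟩ := exists_hasTriangle hv
    exact hpair h.pos h.mem₀ h.mem₁ h.mem₂
  · intro hv
    obtain ⟨A, X, Y, h⟩ := exists_hasParallelogram hv
    exact hpair h.pos h.mem₀ h.mem₁ h.mem₂

/-! ### Weights along an edge -/

theorem eventually_weight (x : ℝ × ℝ) (u : ℤ × ℤ) : ∀ᶠ s : ℝ in 𝓝[>] 0,
    C.weight (x + s • toReal u) u = C.weight x u ∧
      C.weight (x + s • toReal u) (-u) = C.weight x u := by
  filter_upwards [C.eventually_dominant x u] with s hs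
  have hall : ∀ d, d = toReal u ∨ d = -toReal u →
      C.face (x + s • toReal u) d = C.dominant (x + s • toReal u) := by
    intro d hd
    ext a
    refine ⟨fun ha => ha.1, fun ha => ⟨ha, fun a' ha' => ?_⟩⟩
    rw [hs] at ha ha'
    have := C.pairing_face ha ha'
    rcases hd with rfl | rfl
    · exact this.ge
    · rw [pairing_neg_right, pairing_neg_right, this]
  simp only [weight, dominantAlong_eq_face, toReal_neg]
  rw [hall _ (Or.inl rfl), hall _ (Or.inr rfl), hs, dominantAlong_eq_face]
  exact ⟨rfl, rfl⟩

theorem exists_pos_of_eventually {P : ℝ → Prop} (h : ∀ᶠ s in 𝓝[>] (0 : ℝ), P s) :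
    ∃ ε > 0, ∀ s, 0 < s → s < ε → P s := by
  obtain ⟨ε, hε, h⟩ := mem_nhdsGT_iff_exists_Ioo_subset.1 h
  exact ⟨ε, hε, fun s h1 h2 => h ⟨h1, h2⟩⟩

/-- The weight is the same at both ends of an edge: it stays constant at nodes because opposite
sides of a parallelogram have the same length. -/
theorem weight_neg_eq_of_openSegment (hs : C.IsSimple) {v : ℝ × ℝ} {u : ℤ × ℤ}
    {l : ℝ} (hl : 0 < l)
    (h : ∀ t : ℝ, 0 < t → t < l → v + t • toReal u ∈ C.curve \ C.vertices) :
    C.weight (v + l • toReal u) (-u) = C.weight v u := by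
  -- The weight along the edge is locally constant, since both one-sided limits agree with its value.
  set f : ℝ → ℕ := fun t => C.weight (v + t • toReal u) u with hf
  have right : ∀ t, ∃ ε > 0, ∀ s, 0 < s → s < ε → f (t + s) = f t := by
    intro t
    obtain ⟨ε, hε, he⟩ := exists_pos_of_eventually (C.eventually_weight (v + t • toReal u) u)
    refine ⟨ε, hε, fun s h1 h2 => ?_⟩
    have := (he s h1 h2).1
    rwa [add_assoc, ← add_smul] at this
  have left : ∀ t, ∃ ε > 0, ∀ s, 0 < s → s < ε →
      f (t - s) = C.weight (v + t • toReal u) (-u) := by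
    intro t
    obtain ⟨ε, hε, he⟩ := exists_pos_of_eventually (C.eventually_weight (v + t • toReal u) (-u))
    refine ⟨ε, hε, fun s h1 h2 => ?_⟩
    have := (he s h1 h2).2
    rwa [neg_neg, toReal_neg, smul_neg, add_assoc, ← sub_eq_add_neg, ← sub_smul] at this
  have hcont : ContinuousOn f (Set.Ioo 0 l) := by
    intro t ht
    apply ContinuousAt.continuousWithinAt
    have hflip : C.weight (v + t • toReal u) (-u) = f t := by
      obtain ⟨hc, hv⟩ := h t ht.1 ht.2
      obtain ⟨m, m', -, -, -, -, hw⟩ := exists_lines hs hc hv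
      apply hw
      obtain ⟨ε, hε, he⟩ := exists_pos_of_eventually (C.eventually_dominant (v + t • toReal u) u)
      have h2 := ht.2
      have hpos : 0 < min ε (l - t) := lt_min hε (by linarith)
      have h3 := min_le_left ε (l - t)
      have h4 := min_le_right ε (l - t)
      have := he (min ε (l - t) / 2) (by linarith) (by linarith)
      rw [dominantAlong_eq_face] at this
      rw [← this, add_assoc, ← add_smul]
      exact (h _ (by linarith [ht.1]) (by linarith)).1
    obtain ⟨ε, hε, he⟩ := right t
    obtain ⟨ε', hε', he'⟩ := left t
    have : ∀ᶠ t' in 𝓝 t, f t' = f t := by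
      rw [Metric.eventually_nhds_iff]
      refine ⟨min ε ε', lt_min hε hε', fun t' ht' => ?_⟩
      rw [Real.dist_eq, abs_lt] at ht'
      have h3 := min_le_left ε ε'
      have h4 := min_le_right ε ε'
      rcases lt_trichotomy t' t with hlt | rfl | hlt
      · have := he' (t - t') (by linarith) (by linarith)
        rwa [sub_sub_cancel, hflip] at this
      · rfl
      · have := he (t' - t) (by linarith) (by linarith)
        rwa [add_sub_cancel] at this
    exact (continuousAt_const (y := f t)).congr (this.mono fun _ h => h.symm)
  obtain ⟨ε, hε, he⟩ := right 0
  obtain ⟨ε', hε', he'⟩ := left l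
  have h3 := min_le_left (min ε ε') l
  have h4 := min_le_right (min ε ε') l
  have h5 := min_le_left ε ε'
  have h6 := min_le_right ε ε'
  have hpos : 0 < min (min ε ε') l := lt_min (lt_min hε hε') hl
  set s := min (min ε ε') l / 2 with hsdef
  have e1 := he s (by linarith) (by linarith)
  have e2 := he' s (by linarith) (by linarith)
  have e3 := isPreconnected_Ioo.constant hcont (x := 0 + s) (y := l - s)
    ⟨by linarith, by linarith⟩ ⟨by linarith, by linarith⟩
  rw [← e2, ← e3, e1, hf]
  simp

/-! ### Connectedness of the graph of edges -/

theorem IsLegSystem.isOutgoing_iff {v : ℝ × ℝ} {u : Fin 3 → ℤ × ℤ} (h : C.IsLegSystem v u)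
    {w : ℤ × ℤ} : C.IsOutgoing v w ↔ ∃ i, w = u i := by
  rw [C.isOutgoing_iff]
  constructor
  · rintro ⟨hw, hf⟩
    rcases (h.face_nontrivial _).1 hf with h0 | ⟨i, r, hr, e⟩
    · exact absurd h0 (toReal_ne_zero hw.ne_zero)
    · exact ⟨i, (h.primitive i).eq_of_pos_smul hw hr e⟩
  · rintro ⟨i, rfl⟩
    exact ⟨h.primitive i, (h.face_nontrivial _).2 (Or.inr ⟨i, 1, one_pos, (one_smul _ _).symm⟩)⟩

theorem IsLegSystem.outgoing {v : ℝ × ℝ} {u : Fin 3 → ℤ × ℤ} (h : C.IsLegSystem v u)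
    (i : Fin 3) : C.IsOutgoing v (u i) := h.isOutgoing_iff.2 ⟨i, rfl⟩

theorem mem_curve_of_mem_vertices {v : ℝ × ℝ} (hv : v ∈ C.vertices) : v ∈ C.curve := by
  obtain ⟨u, h⟩ := exists_isLegSystem hv
  have := (h.face_nontrivial 0).2 (Or.inl rfl)
  rwa [face_zero] at this

/-- Near a vertex the curve consists of the vertex and its three branches. -/
theorem exists_ball_vertex {v : ℝ × ℝ} {u : Fin 3 → ℤ × ℤ} (h : C.IsLegSystem v u) :
    ∃ ε > 0, (∀ y ∈ C.curve, dist y v < ε → y ≠ v → ∃ i, ∃ r : ℝ, 0 < r ∧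
        y = v + r • toReal (u i) ∧
        ∀ s : ℝ, 0 < s → s ≤ r → v + s • toReal (u i) ∈ C.curve \ C.vertices) ∧
      ∀ y, dist y v < ε → y ≠ v → y ∉ C.vertices ∧ y ∉ C.nodes := by
  obtain ⟨ε, hε, hb⟩ := C.exists_ball v
  refine ⟨ε, hε, fun y hy hd hne => ?_, fun y hd => (hb y hd).2⟩
  have hy' : (C.face v (y - v)).Nontrivial := by rw [← (hb y hd).1]; exact hy
  rcases (h.face_nontrivial _).1 hy' with h0 | ⟨i, r, hr, e⟩
  · exact absurd (sub_eq_zero.1 h0) hne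
  · have hyr : y = v + r • toReal (u i) := by rw [← e]; abel
    have hu0 : toReal (u i) ≠ 0 := toReal_ne_zero (h.primitive i).ne_zero
    refine ⟨i, r, hr, hyr, fun s h1 h2 => ?_⟩
    have hd' : dist (v + s • toReal (u i)) v < ε := by
      refine lt_of_le_of_lt ?_ hd
      rw [hyr, dist_self_add_left, dist_self_add_left, norm_smul, norm_smul, Real.norm_eq_abs,
        Real.norm_eq_abs, abs_of_pos h1, abs_of_pos hr]
      gcongr
    refine ⟨?_, ((hb _ hd').2 ?_).1⟩
    · rw [curve, Set.mem_ofPred_eq, (hb _ hd').1, add_sub_cancel_left, C.face_smul _ _ h1]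
      exact (h.face_nontrivial _).2 (Or.inr ⟨i, 1, one_pos, (one_smul _ _).symm⟩)
    · simpa [h1.ne'] using hu0

theorem exists_branch {v : ℝ × ℝ} {u : Fin 3 → ℤ × ℤ} (h : C.IsLegSystem v u) (i : Fin 3) :
    ∃ ε > 0, ∀ s : ℝ, 0 < s → s < ε → v + s • toReal (u i) ∈ C.branch v (u i) := by
  obtain ⟨ε, hε, hb⟩ := C.exists_ball v
  have hu0 : toReal (u i) ≠ 0 := toReal_ne_zero (h.primitive i).ne_zero
  refine ⟨ε / ‖toReal (u i)‖, div_pos hε (norm_pos_iff.2 hu0), fun t h1 h2 =>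
    ⟨t, h1, rfl, fun s h3 h4 => ?_⟩⟩
  have hd' : dist (v + s • toReal (u i)) v < ε := by
    rw [dist_self_add_left, norm_smul, Real.norm_eq_abs, abs_of_pos h3]
    exact (mul_le_mul_of_nonneg_right h4 (norm_nonneg _)).trans_lt
      ((lt_div_iff₀ (norm_pos_iff.2 hu0)).1 h2)
  refine ⟨?_, ((hb _ hd').2 ?_).1⟩
  · rw [curve, Set.mem_ofPred_eq, (hb _ hd').1, add_sub_cancel_left, C.face_smul _ _ h3]
    exact (h.face_nontrivial _).2 (Or.inr ⟨i, 1, one_pos, (one_smul _ _).symm⟩)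
  · simpa [h3.ne'] using hu0

/-- A smooth point of the curve determines the line that carries any segment of the curve through
it. -/
theorem pairing_eq_zero_of_segment {y : ℝ × ℝ} {m : ℤ × ℤ} (hm : C.IsSmoothAt y m) {d : ℝ × ℝ}
    (h : ∀ s : ℝ, 0 < s → s < 1 → y + s • d ∈ C.curve) : pairing m d = 0 := by
  obtain ⟨ε, hε, hb⟩ := C.exists_ball y
  have hpos : 0 < min (1 / 2) (ε / (2 * (‖d‖ + 1))) := by positivity
  set s := min (1 / 2) (ε / (2 * (‖d‖ + 1))) with hs
  have h1 : s ≤ 1 / 2 := min_le_left _ _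
  have h2 : s * (2 * (‖d‖ + 1)) ≤ ε := by
    rw [← le_div_iff₀ (by positivity)]; exact min_le_right _ _
  have hd : dist (y + s • d) y < ε := by
    rw [dist_self_add_left, norm_smul, Real.norm_eq_abs, abs_of_pos hpos]
    nlinarith [norm_nonneg d]
  have hc := h s hpos (by linarith)
  rw [curve, Set.mem_ofPred_eq, (hb _ hd).1, add_sub_cancel_left, C.face_smul _ _ hpos] at hc
  exact (hm.2 d).2 hc

/-- A point of the tripod can be moved along a segment of the curve that avoids the vertices. -/
theorem mem_tripod_of_segment {v y y' : ℝ × ℝ} (hv : v ∈ C.vertices) (hy : y ∈ C.tripod v)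
    {m : ℤ × ℤ} (hm : C.IsSmoothAt y m) (hseg : segment ℝ y y' ⊆ C.curve \ C.vertices) :
    y' ∈ C.tripod v := by
  rcases hy with rfl | ⟨u, hu, t, ht, rfl, hb⟩
  · exact absurd hv (hseg (left_mem_segment ℝ _ _)).2
  have h1 : pairing m (-(t • toReal u)) = 0 := by
    refine pairing_eq_zero_of_segment hm fun s h1 h2 => ?_
    have := (hb ((1 - s) * t) (mul_pos (by linarith) ht)
      (mul_le_of_le_one_left ht.le (by linarith))).1
    convert this using 1
    module
  have h2 : pairing m (y' - (v + t • toReal u)) = 0 := by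
    refine pairing_eq_zero_of_segment hm fun s h1 h2 => ?_
    apply (hseg _).1
    rw [segment_eq_image']
    exact ⟨s, ⟨h1.le, h2.le⟩, rfl⟩
  rw [pairing_neg_right, neg_eq_zero, pairing_smul_right] at h1
  obtain ⟨r, hr⟩ := exists_smul_of_pairing_eq_zero hm.1 (toReal_ne_zero hu.1.ne_zero)
    ((mul_eq_zero.1 h1).resolve_left ht.ne') h2
  have hy' : y' = v + (t + r) • toReal u := by
    rw [add_smul, ← hr]; abel
  have hmem : ∀ s : ℝ, 0 ≤ s → s ≤ 1 → v + (t + s * r) • toReal u ∈ C.curve \ C.vertices := by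
    intro s h1 h2
    apply hseg
    rw [segment_eq_image']
    refine ⟨s, ⟨h1, h2⟩, ?_⟩
    simp only [hr]
    module
  have htr : 0 < t + r := by
    by_contra! hneg
    have hr0 : r < 0 := by linarith
    have := hmem (-t / r) (div_nonneg_of_nonpos (by linarith) hr0.le)
      ((div_le_one_of_neg hr0).2 (by linarith))
    rw [div_mul_cancel₀ _ hr0.ne, add_neg_cancel, zero_smul, add_zero] at this
    exact this.2 hv
  refine Or.inr ⟨u, hu, t + r, htr, hy', fun s h1 h2 => ?_⟩
  rcases le_or_gt s t with h3 | h3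
  · exact hb s h1 h3
  · have hr0 : 0 < r := by linarith
    have := hmem ((s - t) / r) (div_nonneg (by linarith) hr0.le)
      ((div_le_one hr0).2 (by linarith))
    rwa [div_mul_cancel₀ _ hr0.ne', add_sub_cancel] at this

/-- If the tripod of `v` contains points close to a vertex `x`, then `v` is `x` or a neighbour
of `x`. -/
theorem isEdge_of_tripod (hs : C.IsSimple) {x : ℝ × ℝ} (hx : x ∈ C.vertices) : ∃ ε > 0,
    ∀ v ∈ C.vertices, ∀ y ∈ C.tripod v, y ∈ C.curve → y ∉ C.nodes → dist y x < ε →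
      v = x ∨ C.IsEdge v x := by
  obtain ⟨w, hw⟩ := exists_isLegSystem hx
  obtain ⟨ε, hε, hb, hb'⟩ := exists_ball_vertex hw
  refine ⟨ε, hε, fun v hv y hy hyc hyn hd => ?_⟩
  by_cases hvx : v = x
  · exact Or.inl hvx
  right
  rcases hy with rfl | ⟨u, hu, t, ht, rfl, hbr⟩
  · exact absurd hv (hb' _ hd hvx).1
  have hyv := (hbr t ht le_rfl).2
  obtain ⟨i, r, hr, e, hbx⟩ := hb _ hyc hd (fun h => hyv (h ▸ hx))
  obtain ⟨m, hm⟩ := exists_isSmoothAt_of_notMem hs hyc hyv hyn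
  have h1 : pairing m (-(t • toReal u)) = 0 := by
    refine pairing_eq_zero_of_segment hm fun s h1 h2 => ?_
    have := (hbr ((1 - s) * t) (mul_pos (by linarith) ht)
      (mul_le_of_le_one_left ht.le (by linarith))).1
    convert this using 1
    module
  have h2 : pairing m (-(r • toReal (w i))) = 0 := by
    rw [e] at hm
    refine pairing_eq_zero_of_segment hm fun s h1 h2 => ?_
    have := (hbx ((1 - s) * r) (mul_pos (by linarith) hr)
      (mul_le_of_le_one_left hr.le (by linarith))).1
    convert this using 1
    module
  rw [pairing_neg_right, neg_eq_zero, pairing_smul_right] at h1 h2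
  obtain ⟨ρ, hρ⟩ := exists_smul_of_pairing_eq_zero hm.1
    (toReal_ne_zero (hw.primitive i).ne_zero)
    ((mul_eq_zero.1 h2).resolve_left hr.ne') ((mul_eq_zero.1 h1).resolve_left ht.ne')
  -- The branch of `v` runs along the same line as the branch of `x`; it has to come from ahead.
  have hvr : v = x + (r - t * ρ) • toReal (w i) := by
    rw [sub_smul, mul_smul, ← hρ, ← add_sub_assoc, ← e, add_sub_cancel_right]
  have hxnot : ∀ s : ℝ, 0 < s → s ≤ t → r - t * ρ + s * ρ ≠ 0 := by
    intro s h3 h4 h0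
    refine (hbr s h3 h4).2 ?_
    rw [hρ, hvr, add_assoc, smul_smul, ← add_smul, h0, zero_smul, add_zero]
    exact hx
  have hvpos : r < r - t * ρ := by
    by_contra! hle
    rcases le_or_gt (r - t * ρ) 0 with h0 | h0
    · have hρ0 : 0 < ρ := by
        by_contra! hneg
        nlinarith
      refine hxnot (t - r / ρ) ?_ ?_ ?_
      · rcases h0.eq_or_lt with h0 | h0
        · exfalso
          apply hvx
          rw [hvr, h0, zero_smul, add_zero]
        · rw [sub_pos, div_lt_iff₀ hρ0]; linarith
      · have : 0 < r / ρ := by positivity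
        linarith
      · rw [sub_mul, div_mul_cancel₀ _ hρ0.ne']; ring
    · have := (hbx _ h0 hle).2
      rw [← hvr] at this
      exact this hv
  refine ⟨hv, hx, hvx, ?_⟩
  rw [openSegment_symm, openSegment_eq_image']
  rintro _ ⟨θ, ⟨h3, h4⟩, rfl⟩
  have e1 : v - x = (r - t * ρ) • toReal (w i) := by rw [hvr]; abel
  simp only [e1, smul_smul]
  rcases le_or_gt (θ * (r - t * ρ)) r with h5 | h5
  · exact hbx _ (mul_pos h3 (by linarith)) h5
  · have hρ0 : ρ < 0 := by nlinarith
    have h6 := hbr ((1 - θ) * (r - t * ρ) / (-ρ))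
      (div_pos (mul_pos (by linarith) (by linarith)) (by linarith))
      ((div_le_iff₀ (by linarith)).2 (by linarith))
    have e2 : v + ((1 - θ) * (r - t * ρ) / (-ρ)) • toReal u =
        x + (θ * (r - t * ρ)) • toReal (w i) := by
      rw [hvr, hρ, smul_smul, add_assoc, ← add_smul]
      congr 2
      field_simp [hρ0.ne]
      ring
    rwa [e2] at h6

/-- The tripods of a set of vertices that is closed under adjacency are locally separated from the
rest of the normalization. -/
theorem exists_transfer (hs : C.IsSimple) {K : Set (ℝ × ℝ)} (hKv : K ⊆ C.vertices)
    (hK : ∀ v ∈ K, ∀ x, C.IsEdge v x → x ∈ K) (x : ℝ × ℝ) :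
    ∃ ε > 0, ∀ y y', y ∈ C.curve → y' ∈ C.curve → y ∉ C.nodes → y' ∉ C.nodes → dist y x < ε →
      dist y' x < ε →
      (x ∈ C.nodes → dist (lineClass (y - x)) (lineClass (y' - x)) < ε) →
      (∃ v ∈ K, y ∈ C.tripod v) → ∃ v ∈ K, y' ∈ C.tripod v := by
  by_cases hxv : x ∈ C.vertices
  · obtain ⟨w, hw⟩ := exists_isLegSystem hxv
    obtain ⟨ε, hε, hb, -⟩ := exists_ball_vertex hw
    obtain ⟨ε', hε', hb'⟩ := isEdge_of_tripod hs hxv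
    refine ⟨min ε ε', lt_min hε hε', ?_⟩
    rintro y y' hy hy' hn hn' hd hd' - ⟨v, hvK, hyv⟩
    refine ⟨x, ?_, ?_⟩
    · rcases hb' v (hKv hvK) y hyv hy hn (hd.trans_le (min_le_right _ _)) with rfl | h
      · exact hvK
      · exact hK v hvK x h
    · by_cases hyx : y' = x
      · exact Or.inl hyx
      · obtain ⟨i, r, hr, e, h⟩ := hb y' hy' (hd'.trans_le (min_le_left _ _)) hyx
        exact Or.inr ⟨w i, hw.outgoing i, r, hr, e, h⟩
  obtain ⟨ε, hε, hb⟩ := C.exists_ball x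
  by_cases hxc : x ∈ C.curve
  swap
  · refine ⟨ε, hε, ?_⟩
    rintro y y' hy hy' hn hn' hd hd' - -
    rw [curve, Set.mem_ofPred_eq, (hb y hd).1] at hy
    exact absurd (hy.mono fun a ha => ha.1) hxc
  obtain ⟨m, m', hm, hm', hface, hmm, -⟩ := exists_lines hs hxc hxv
  -- Two points on the same line through `x`.
  have same : ∀ {m : ℤ × ℤ}, (∀ d, pairing m d = 0 → (C.face x d).Nontrivial) → ∀ y y',
      y ∈ C.curve → y ∉ C.nodes → dist y x < ε → dist y' x < ε → pairing m (y - x) = 0 →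
      pairing m (y' - x) = 0 →
      (∃ v ∈ K, y ∈ C.tripod v) → ∃ v ∈ K, y' ∈ C.tripod v := by
    rintro m hface y y' hy hn hd hd' hp hp' ⟨v, hvK, hyv⟩
    have hseg : segment ℝ y y' ⊆ C.curve \ C.vertices := by
      intro z hz
      have hdz : dist z x < ε := (convex_ball x ε).segment_subset hd hd' hz
      refine ⟨?_, ?_⟩
      · rw [curve, Set.mem_ofPred_eq, (hb z hdz).1]
        apply hface
        obtain ⟨a, b, ha, hb, hab, rfl⟩ := hz
        have : a • y + b • y' - x = a • (y - x) + b • (y' - x) := by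
          obtain rfl : b = 1 - a := by linarith
          module
        rw [this, pairing_add_right, pairing_smul_right, pairing_smul_right, hp, hp']
        ring
      · by_cases hzx : z = x
        · rwa [hzx]
        · exact ((hb z hdz).2 hzx).1
    obtain ⟨m₀, hm₀⟩ :=
      exists_isSmoothAt_of_notMem hs hy (hseg (left_mem_segment ℝ _ _)).2 hn
    exact ⟨v, hvK, mem_tripod_of_segment (hKv hvK) hyv hm₀ hseg⟩
  have hf : ∀ y ∈ C.curve, dist y x < ε → pairing m (y - x) = 0 ∨ pairing m' (y - x) = 0 := by
    intro y hy hd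
    rw [curve, Set.mem_ofPred_eq, (hb y hd).1] at hy
    exact (hface _).1 hy
  rcases hmm with rfl | ⟨hxn, hpos⟩
  · refine ⟨ε, hε, ?_⟩
    rintro y y' hy hy' hn hn' hd hd' - h
    exact same (fun d h => (hface d).2 (Or.inl h)) y y' hy hn hd hd' (or_self_iff.1 (hf y hy hd))
      (or_self_iff.1 (hf y' hy' hd')) h
  -- At a node, the projective line of the blow-up separates the two lines.
  · have hne : lineClass (toReal (rot m)) ≠ lineClass (toReal (rot m')) := by
      intro h
      have := cross_eq_zero_of_lineClass_eq h
      rw [cross_toReal] at this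
      have h0 : (rot m).1 * (rot m').2 - (rot m).2 * (rot m').1 = 0 := by exact_mod_cast this
      simp only [rot] at h0
      linarith
    have hrot : ∀ {m : ℤ × ℤ}, m ≠ 0 → ∀ {d : ℝ × ℝ}, d ≠ 0 → pairing m d = 0 →
        lineClass d = lineClass (toReal (rot m)) := by
      intro m hm d hd h
      have hr : toReal (rot m) ≠ 0 := toReal_ne_zero (rot_ne_zero hm)
      obtain ⟨r, rfl⟩ := exists_smul_of_pairing_eq_zero hm hr (pairing_rot_self m) h
      exact lineClass_smul (fun h0 => hd (by rw [h0, zero_smul])) _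
    refine ⟨min ε (dist (lineClass (toReal (rot m))) (lineClass (toReal (rot m')))),
      lt_min hε (dist_pos.2 hne), ?_⟩
    rintro y y' hy hy' hn hn' hd hd' hl h
    have hl := (hl hxn).trans_le (min_le_right _ _)
    have hd := hd.trans_le (min_le_left _ _)
    have hd' := hd'.trans_le (min_le_left _ _)
    have hyx : y - x ≠ 0 := sub_ne_zero.2 fun h => hn (h ▸ hxn)
    have hyx' : y' - x ≠ 0 := sub_ne_zero.2 fun h => hn' (h ▸ hxn)
    rcases hf y hy hd with h1 | h1 <;> rcases hf y' hy' hd' with h2 | h2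
    · exact same (fun d h => (hface d).2 (Or.inl h)) y y' hy hn hd hd' h1 h2 h
    · rw [hrot hm hyx h1, hrot hm' hyx' h2] at hl
      exact absurd hl (lt_irrefl _)
    · rw [hrot hm' hyx h1, hrot hm hyx' h2, dist_comm] at hl
      exact absurd hl (lt_irrefl _)
    · exact same (fun d h => (hface d).2 (Or.inr h)) y y' hy hn hd hd' h1 h2 h

theorem exists_near_vertex {v : ℝ × ℝ} (hv : v ∈ C.vertices) {ε : ℝ} (hε : 0 < ε) :
    ∃ y ∈ C.tripod v, y ∈ C.curve ∧ y ∉ C.nodes ∧ dist y v < ε := by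
  obtain ⟨u, hu⟩ := exists_isLegSystem hv
  obtain ⟨ε₁, hε₁, h₁⟩ := exists_branch hu 0
  obtain ⟨ε₂, hε₂, -, h₂⟩ := exists_ball_vertex hu
  have hu0 := toReal_ne_zero (hu.primitive 0).ne_zero
  have hn : 0 < ‖toReal (u 0)‖ := norm_pos_iff.2 hu0
  have hpos : 0 < min ε₁ (min ε ε₂ / ‖toReal (u 0)‖) :=
    lt_min hε₁ (div_pos (lt_min hε hε₂) hn)
  obtain ⟨s, hs0, hs⟩ := exists_between hpos
  have hb := h₁ s hs0 (hs.trans_le (min_le_left _ _))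
  have hd : dist (v + s • toReal (u 0)) v < min ε ε₂ := by
    rw [dist_self_add_left, norm_smul, Real.norm_eq_abs, abs_of_pos hs0]
    exact (lt_div_iff₀ hn).1 (hs.trans_le (min_le_right _ _))
  refine ⟨_, Or.inr ⟨u 0, hu.outgoing 0, hb⟩, ?_, ?_, hd.trans_le (min_le_left _ _)⟩
  · obtain ⟨t, ht, e, h⟩ := hb
    rw [e]
    exact (h t ht le_rfl).1
  · exact (h₂ _ (hd.trans_le (min_le_right _ _)) (by simpa [hs0.ne'] using hu0)).2

/-- The tripods of a nonempty set of vertices that is closed under adjacency cover the curve away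
from the nodes. Otherwise the closures, in the normalization, of the part that they cover and of
the rest meet, and this contradicts their local separation. -/
theorem mem_tripod_of_closed (hs : C.IsSimple) (hirr : C.IsIrreducible) {K : Set (ℝ × ℝ)}
    (hKv : K ⊆ C.vertices) (hK : ∀ v ∈ K, ∀ x, C.IsEdge v x → x ∈ K) (hne : K.Nonempty)
    {y : ℝ × ℝ} (hy : y ∈ C.curve) (hn : y ∉ C.nodes) : ∃ v ∈ K, y ∈ C.tripod v := by
  set T : Set (ℝ × ℝ) := {y | ∃ v ∈ K, y ∈ C.tripod v} with hT
  set D : Set ((ℝ × ℝ) × (C.nodes → ℂ)) :=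
    {q | q.1 ∈ C.curve ∧ q.1 ∉ C.nodes ∧ ∀ n : C.nodes, q.2 n = lineClass (q.1 - n)} with hD
  by_contra hyT
  have hpre : IsPreconnected (closure D) := hirr.2
  have hcov : closure D ⊆ closure (D ∩ {q | q.1 ∈ T}) ∪ closure (D ∩ {q | q.1 ∉ T}) := by
    rw [← closure_union]
    apply closure_mono
    intro q hq
    by_cases h : q.1 ∈ T
    · exact Or.inl ⟨hq, h⟩
    · exact Or.inr ⟨hq, h⟩
  have hlift : ∀ y ∈ C.curve, y ∉ C.nodes → (y, fun n : C.nodes => lineClass (y - n)) ∈ D :=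
    fun y h1 h2 => ⟨h1, h2, fun _ => rfl⟩
  obtain ⟨v₀, hv₀⟩ := hne
  obtain ⟨y₀, hy₀, hy₀c, hy₀n, -⟩ := exists_near_vertex (hKv hv₀) one_pos
  obtain ⟨q, -, hq1, hq2⟩ := (isPreconnected_closed_iff.1 hpre) _ _ isClosed_closure
    isClosed_closure hcov
    ⟨_, subset_closure (hlift y₀ hy₀c hy₀n), subset_closure ⟨hlift y₀ hy₀c hy₀n, v₀, hv₀, hy₀⟩⟩
    ⟨_, subset_closure (hlift y hy hn), subset_closure ⟨hlift y hy hn, hyT⟩⟩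
  obtain ⟨ε, hε, htr⟩ := exists_transfer hs hKv hK q.1
  have hU : ∀ᶠ p in 𝓝 q, dist p.1 q.1 < ε ∧
      ∀ h : q.1 ∈ C.nodes, dist (p.2 ⟨q.1, h⟩) (q.2 ⟨q.1, h⟩) < ε / 2 := by
    apply Filter.Eventually.and
    · exact (continuous_fst.continuousAt (x := q)).eventually (Metric.ball_mem_nhds _ hε)
    · by_cases h : q.1 ∈ C.nodes
      · have hc : Continuous fun p : (ℝ × ℝ) × (C.nodes → ℂ) => p.2 ⟨q.1, h⟩ := by fun_prop
        filter_upwards [hc.continuousAt.eventually (Metric.ball_mem_nhds _ (half_pos hε))]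
          with p hp _ using hp
      · exact Eventually.of_forall fun p h' => absurd h' h
  obtain ⟨p, ⟨⟨hpc, hpn, hpl⟩, hpT⟩, hp⟩ :=
    ((mem_closure_iff_frequently.1 hq1).and_eventually hU).exists
  obtain ⟨p', ⟨⟨hpc', hpn', hpl'⟩, hpT'⟩, hp'⟩ :=
    ((mem_closure_iff_frequently.1 hq2).and_eventually hU).exists
  refine hpT' (htr p.1 p'.1 hpc hpc' hpn hpn' hp.1 hp'.1 (fun h => ?_) hpT)
  have e1 := hp.2 h
  have e2 := hp'.2 h
  rw [hpl] at e1
  rw [hpl'] at e2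
  calc _ ≤ _ := dist_triangle_right _ _ (q.2 ⟨q.1, h⟩)
    _ < ε := by linarith

/-- The graph of edges of an irreducible curve is connected. -/
theorem mem_of_closed (hs : C.IsSimple) (hirr : C.IsIrreducible) {K : Set (ℝ × ℝ)}
    (hKv : K ⊆ C.vertices) (hK : ∀ v ∈ K, ∀ x, C.IsEdge v x → x ∈ K) (hne : K.Nonempty)
    {x : ℝ × ℝ} (hx : x ∈ C.vertices) : x ∈ K := by
  obtain ⟨ε, hε, h⟩ := isEdge_of_tripod hs hx
  obtain ⟨y, -, hyc, hyn, hd⟩ := exists_near_vertex hx hε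
  obtain ⟨v, hvK, hyv⟩ := mem_tripod_of_closed hs hirr hKv hK hne hyc hyn
  rcases h v (hKv hvK) y hyv hyc hyn hd with rfl | h
  · exact hvK
  · exact hK v hvK x h

/-- An irreducible curve with a vertex is the union of its tripods: a leaf or edge without end
would be a straight line, and a component of the normalization. -/
theorem exists_mem_tripod (hs : C.IsSimple) (hirr : C.IsIrreducible) (hne : C.vertices.Nonempty)
    {x : ℝ × ℝ} (hx : x ∈ C.curve) : ∃ v ∈ C.vertices, x ∈ C.tripod v := by
  have hall : ∀ y ∈ C.curve, y ∉ C.nodes → ∃ v ∈ C.vertices, y ∈ C.tripod v := fun y h1 h2 =>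
    mem_tripod_of_closed hs hirr subset_rfl (fun v _ x h => h.2.1) hne h1 h2
  by_cases hxv : x ∈ C.vertices
  · exact ⟨x, hxv, Or.inl rfl⟩
  by_cases hxn : x ∈ C.nodes
  swap
  · exact hall x hx hxn
  obtain ⟨m, m', hm, -, hface, -, -⟩ := exists_lines hs hx hxv
  obtain ⟨ε, hε, hb⟩ := C.exists_ball x
  have hr0 : toReal (rot m) ≠ 0 := toReal_ne_zero (rot_ne_zero hm)
  have hn : 0 < ‖toReal (rot m)‖ := norm_pos_iff.2 hr0
  obtain ⟨s, hs0, hs1⟩ := exists_between (div_pos hε hn)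
  have key : ∀ t : ℝ, 0 ≤ t → t ≤ s → x + t • toReal (rot m) ∈ C.curve \ C.vertices := by
    intro t h1 h2
    rcases h1.eq_or_lt with rfl | h1
    · simpa using ⟨hx, hxv⟩
    have hd : dist (x + t • toReal (rot m)) x < ε := by
      rw [dist_self_add_left, norm_smul, Real.norm_eq_abs, abs_of_pos h1]
      exact (lt_div_iff₀ hn).1 (h2.trans_lt hs1)
    refine ⟨?_, ((hb _ hd).2 (by simpa [h1.ne'] using hr0)).1⟩
    rw [curve, Set.mem_ofPred_eq, (hb _ hd).1, add_sub_cancel_left, C.face_smul _ _ h1]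
    exact (hface _).2 (Or.inl (pairing_rot_self m))
  have hd : dist (x + s • toReal (rot m)) x < ε := by
    rw [dist_self_add_left, norm_smul, Real.norm_eq_abs, abs_of_pos hs0]
    exact (lt_div_iff₀ hn).1 hs1
  have hyn := ((hb _ hd).2 (by simpa [hs0.ne'] using hr0)).2
  have hy := key s hs0.le le_rfl
  obtain ⟨v, hv, hyv⟩ := hall _ hy.1 hyn
  obtain ⟨m₀, hm₀⟩ := exists_isSmoothAt_of_notMem hs hy.1 hy.2 hyn
  refine ⟨v, hv, mem_tripod_of_segment hv hyv hm₀ ?_⟩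
  rw [segment_symm, segment_eq_image']
  rintro _ ⟨θ, ⟨h1, h2⟩, rfl⟩
  simp only [add_sub_cancel_left, smul_smul]
  exact key _ (mul_nonneg h1 hs0.le) (mul_le_of_le_one_left hs0.le h2)

end TropPoly

/-! ### Signs of integer vectors -/

/-- The signs `((-1) ^ m₁, (-1) ^ m₂)`, which record an integer vector modulo `2`. -/
def signOf (m : ℤ × ℤ) : ℤˣ × ℤˣ := ((-1) ^ m.1, (-1) ^ m.2)

theorem signOf_add (m n : ℤ × ℤ) : signOf (m + n) = signOf m * signOf n := by
  simp [signOf, zpow_add]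

theorem signs_mul_self (a : ℤˣ × ℤˣ) : a * a = 1 :=
  Prod.ext (Int.units_mul_self _) (Int.units_mul_self _)

theorem signs_inv (a : ℤˣ × ℤˣ) : a⁻¹ = a := inv_eq_of_mul_eq_one_left (signs_mul_self a)

theorem signOf_zero : signOf 0 = 1 := by simp [signOf]

theorem signOf_neg (m : ℤ × ℤ) : signOf (-m) = signOf m := by
  have h : signOf (-m) * signOf m = 1 := by rw [← signOf_add, neg_add_cancel, signOf_zero]
  rw [eq_inv_of_mul_eq_one_left h, signs_inv]

theorem signOf_sum {ι : Type*} (s : Finset ι) (f : ι → ℤ × ℤ) :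
    signOf (∑ i ∈ s, f i) = ∏ i ∈ s, signOf (f i) := by
  classical
  induction s using Finset.induction_on with
  | empty => simp [signOf_zero]
  | insert a s ha ih => rw [Finset.sum_insert ha, Finset.prod_insert ha, signOf_add, ih]

theorem signOf_eq_one_iff {m : ℤ × ℤ} : signOf m = 1 ↔ ∃ k : ℤ × ℤ, m = (2 : ℤ) • k := by
  have h : ∀ n : ℤ, ((-1 : ℤˣ) ^ n = 1 ↔ Even n) := by
    intro n
    rcases Int.even_or_odd n with hn | hn
    · simp [hn, hn.neg_one_zpow]
    · simp only [hn.neg_one_zpow, ← Int.not_odd_iff_even, hn, not_true_eq_false, iff_false]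
      decide
  rw [signOf, Prod.mk_eq_one, h, h]
  constructor
  · rintro ⟨⟨a, ha⟩, ⟨b, hb⟩⟩
    exact ⟨(a, b), by ext <;> simp <;> omega⟩
  · rintro ⟨k, rfl⟩
    exact ⟨⟨k.1, by simp; ring⟩, ⟨k.2, by simp; ring⟩⟩

/-! ### Cochains on a graph -/

section Graph

variable {V M : Type*} [CommGroup M] {G : SimpleGraph V}

/-- The product of a function of oriented edges along a walk. -/
def walkProd (δ : V → V → M) {u v : V} (p : G.Walk u v) : M :=
  (p.darts.map fun d => δ d.fst d.snd).prod

theorem walkProd_cons (δ : V → V → M) {u v w : V} (h : G.Adj u v) (p : G.Walk v w) :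
    walkProd δ (.cons h p) = δ u v * walkProd δ p := by
  simp [walkProd]

theorem walkProd_append (δ : V → V → M) {u v w : V} (p : G.Walk u v) (q : G.Walk v w) :
    walkProd δ (p.append q) = walkProd δ p * walkProd δ q := by
  simp [walkProd, SimpleGraph.Walk.darts_append]

theorem walkProd_eq_prod_range (δ : V → V → M) {u v : V} (p : G.Walk u v) :
    walkProd δ p = ∏ i ∈ Finset.range p.length, δ (p.getVert i) (p.getVert (i + 1)) := by
  induction p with
  | nil => simp [walkProd]
  | cons h p ih =>
    rw [walkProd_cons, SimpleGraph.Walk.length_cons, Finset.prod_range_succ', ih,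
      mul_comm]
    simp

theorem walkProd_reverse {δ : V → V → M}
    (hδ : ∀ u v, G.Adj u v → δ u v * δ v u = 1) {u v : V} (p : G.Walk u v) :
    walkProd δ p * walkProd δ p.reverse = 1 := by
  induction p with
  | nil => simp [walkProd]
  | @cons u v w h p ih =>
    rw [SimpleGraph.Walk.reverse_cons, walkProd_append, walkProd_cons, walkProd_cons]
    have : walkProd δ (.nil : G.Walk u u) = 1 := by simp [walkProd]
    rw [this, mul_one, mul_assoc, ← mul_assoc (walkProd δ p), ih, one_mul, hδ u v h]

/-- Removing the detours of a walk does not change the product: each of them is a cycle, or an edge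
run through back and forth. -/
theorem walkProd_bypass [DecidableEq V] {δ : V → V → M}
    (hδ : ∀ u v, G.Adj u v → δ u v * δ v u = 1)
    (hcyc : ∀ (v : V) (p : G.Walk v v), p.IsCycle → walkProd δ p = 1) {u v : V} (p : G.Walk u v) :
    walkProd δ p.bypass = walkProd δ p := by
  induction p with
  | nil => rfl
  | @cons u v w h p ih =>
    rw [walkProd_cons, ← ih, SimpleGraph.Walk.bypass]
    split_ifs with hs
    · have hp := p.bypass_isPath
      have hspec := p.bypass.take_spec hs
      have hr := hp.takeUntil hs
      set r := p.bypass.takeUntil u hs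
      have key : δ u v * walkProd δ r = 1 := by
        by_cases he : s(u, v) ∈ r.edges
        · clear_value r
          cases r with
          | nil => exact absurd h G.irrefl
          | @cons _ x _ h' r' =>
            rw [SimpleGraph.Walk.cons_isPath_iff] at hr
            rw [SimpleGraph.Walk.edges_cons, List.mem_cons] at he
            rcases he with he | he
            · have hx : u = x := by
                rcases Sym2.eq_iff.1 he with ⟨h1, h2⟩ | ⟨h1, h2⟩
                · exact h1.trans (h2 ▸ rfl)
                · exact h1
              subst hx
              rw [(SimpleGraph.Walk.isPath_iff_nil.1 hr.1).eq_nil, walkProd_cons]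
              simpa [walkProd] using hδ u v h
            · exact absurd (SimpleGraph.Walk.snd_mem_support_of_mem_edges _ he) hr.2
        · have := hcyc u (.cons h r) ((SimpleGraph.Walk.cons_isCycle_iff _ _).2 ⟨hr, he⟩)
          rwa [walkProd_cons] at this
      have hsplit : walkProd δ p.bypass = walkProd δ r * walkProd δ (p.bypass.dropUntil u hs) := by
        rw [← walkProd_append, hspec]
      rw [hsplit, ← mul_assoc, key, one_mul]
    · rw [walkProd_cons]

theorem walkProd_closed {δ : V → V → M}
    (hδ : ∀ u v, G.Adj u v → δ u v * δ v u = 1)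
    (hcyc : ∀ (v : V) (p : G.Walk v v), p.IsCycle → walkProd δ p = 1) {v : V} (p : G.Walk v v) :
    walkProd δ p = 1 := by
  classical
  rw [← walkProd_bypass hδ hcyc, (SimpleGraph.Walk.isPath_iff_nil.1 p.bypass_isPath).eq_nil]
  simp [walkProd]

/-- On a connected graph a cocycle that is trivial on all cycles is a coboundary. -/
theorem exists_potential {δ : V → V → M}
    (hδ : ∀ u v, G.Adj u v → δ u v * δ v u = 1)
    (hcyc : ∀ (v : V) (p : G.Walk v v), p.IsCycle → walkProd δ p = 1)
    (hconn : G.Connected) :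
    ∃ β : V → M, ∀ u v, G.Adj u v → β v = β u * δ u v := by
  obtain ⟨v₀⟩ := hconn.nonempty
  choose p _ using fun v => (⟨(hconn.preconnected v₀ v).some, trivial⟩ : ∃ _ : G.Walk v₀ v, True)
  refine ⟨fun v => walkProd δ (p v), fun u v h => ?_⟩
  have h1 := walkProd_closed hδ hcyc ((p u).append (.cons h (p v).reverse))
  rw [walkProd_append, walkProd_cons] at h1
  have h2 := walkProd_reverse hδ (p v)
  rw [← mul_assoc] at h1
  exact (eq_inv_of_mul_eq_one_left h2).trans (eq_inv_of_mul_eq_one_left h1).symm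

end Graph

namespace TropPoly

variable {C : TropPoly}

/-! ### The legs of a vertex and the edges between vertices -/

/-- The primitive vectors of the three leaves or edges at a vertex, in counterclockwise order. -/
def leg (v : C.vertices) : Fin 3 → ℤ × ℤ := (exists_isLegSystem v.2).choose

theorem isLegSystem_leg (v : C.vertices) : C.IsLegSystem v (leg v) :=
  (exists_isLegSystem v.2).choose_spec

/-- The primitive vector of a leaf or edge at a vertex, multiplied by the weight. -/
def legVec (v : C.vertices) (i : Fin 3) : ℤ × ℤ := (C.weight v (leg v i) : ℤ) • leg v i

theorem sum_legVec (v : C.vertices) (i : Fin 3) :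
    legVec v i + legVec v (i + 1) + legVec v (i + 2) = 0 := by
  have h := (isLegSystem_leg v).balanced
  rw [Fin.sum_univ_three] at h
  rw [← h]
  fin_cases i <;> simp [legVec] <;> abel

theorem IsEdge.symm {v v' : ℝ × ℝ} (h : C.IsEdge v v') : C.IsEdge v' v :=
  ⟨h.2.1, h.1, h.2.2.1.symm, by rw [openSegment_symm]; exact h.2.2.2⟩

theorem IsEdge.exists_leg {v v' : C.vertices} (h : C.IsEdge v v') :
    ∃ i, ∃ l : ℝ, 0 < l ∧ (v' : ℝ × ℝ) = v + l • toReal (leg v i) := by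
  have hd0 : (v' : ℝ × ℝ) - v ≠ 0 := sub_ne_zero.2 h.2.2.1.symm
  obtain ⟨ε, hε, hb⟩ := C.exists_ball v
  have hn : 0 < ‖(v' : ℝ × ℝ) - v‖ := norm_pos_iff.2 hd0
  obtain ⟨s, hs0, hs⟩ := exists_between (lt_min one_pos (div_pos hε hn))
  have hd : dist ((v : ℝ × ℝ) + s • ((v' : ℝ × ℝ) - v)) v < ε := by
    rw [dist_self_add_left, norm_smul, Real.norm_eq_abs, abs_of_pos hs0]
    exact (lt_div_iff₀ hn).1 (hs.trans_le (min_le_right _ _))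
  have hc : (v : ℝ × ℝ) + s • ((v' : ℝ × ℝ) - v) ∈ C.curve := by
    apply (h.2.2.2 _).1
    rw [openSegment_eq_image']
    exact ⟨s, ⟨hs0, hs.trans_le (min_le_left _ _)⟩, rfl⟩
  rw [curve, Set.mem_ofPred_eq, (hb _ hd).1, add_sub_cancel_left, C.face_smul _ _ hs0] at hc
  rcases ((isLegSystem_leg v).face_nontrivial _).1 hc with h0 | ⟨i, r, hr, e⟩
  · exact absurd h0 hd0
  · exact ⟨i, r, hr, by rw [← e]; abel⟩

open Classical in
/-- The position of the edge from `v` to `v'` among the legs of `v`; zero if there is no edge. -/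
def idx (v v' : C.vertices) : Fin 3 :=
  if h : ∃ i, ∃ l : ℝ, 0 < l ∧ (v' : ℝ × ℝ) = v + l • toReal (leg v i) then h.choose else 0

theorem IsEdge.idx_spec {v v' : C.vertices} (h : C.IsEdge v v') :
    ∃ l : ℝ, 0 < l ∧ (v' : ℝ × ℝ) = v + l • toReal (leg v (idx v v')) := by
  rw [idx, dif_pos h.exists_leg]
  exact h.exists_leg.choose_spec

theorem IsEdge.mem_of_lt {v v' : C.vertices} (h : C.IsEdge v v') {l : ℝ}
    (e : (v' : ℝ × ℝ) = v + l • toReal (leg v (idx v v'))) (hl : 0 < l) {t : ℝ} (h0 : 0 < t)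
    (h1 : t < l) : (v : ℝ × ℝ) + t • toReal (leg v (idx v v')) ∈ C.curve \ C.vertices := by
  apply h.2.2.2
  rw [openSegment_eq_image']
  refine ⟨t / l, ⟨div_pos h0 hl, (div_lt_one hl).2 h1⟩, ?_⟩
  rw [e, add_sub_cancel_left]
  simp only [smul_smul]
  rw [div_mul_cancel₀ _ hl.ne']

theorem IsEdge.leg_neg {v v' : C.vertices} (h : C.IsEdge v v') :
    leg v' (idx v' v) = -leg v (idx v v') := by
  obtain ⟨l, hl, e⟩ := h.idx_spec
  obtain ⟨l', hl', e'⟩ := h.symm.idx_spec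
  refine ((isLegSystem_leg v).primitive _).neg.eq_of_pos_smul
    ((isLegSystem_leg v').primitive _) (div_pos hl hl') ?_
  have : l' • toReal (leg v' (idx v' v)) = -(l • toReal (leg v (idx v v'))) := by
    have h1 : (v : ℝ × ℝ) = v + l • toReal (leg v (idx v v')) +
      l' • toReal (leg v' (idx v' v)) := by rw [← e, ← e']
    rw [add_assoc, left_eq_add] at h1
    exact eq_neg_of_add_eq_zero_right h1
  rw [toReal_neg, smul_neg, div_eq_inv_mul, ← smul_smul, ← smul_neg, ← this, smul_smul,
    inv_mul_cancel₀ hl'.ne', one_smul]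

theorem IsEdge.weight_eq (hs : C.IsSimple) {v v' : C.vertices} (h : C.IsEdge v v') :
    C.weight v' (leg v' (idx v' v)) = C.weight v (leg v (idx v v')) := by
  obtain ⟨l, hl, e⟩ := h.idx_spec
  rw [h.leg_neg, e]
  exact weight_neg_eq_of_openSegment hs hl fun t h0 h1 => h.mem_of_lt e hl h0 h1

theorem IsEdge.legVec_neg (hs : C.IsSimple) {v v' : C.vertices} (h : C.IsEdge v v') :
    legVec v' (idx v' v) = -legVec v (idx v v') := by
  rw [legVec, h.weight_eq hs, h.leg_neg, smul_neg, legVec]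

theorem IsEdge.eq_of_idx_eq {v x y : C.vertices} (hx : C.IsEdge v x) (hy : C.IsEdge v y)
    (h : idx v x = idx v y) : x = y := by
  obtain ⟨l, hl, e⟩ := hx.idx_spec
  obtain ⟨l', hl', e'⟩ := hy.idx_spec
  apply Subtype.ext
  rcases lt_trichotomy l l' with hlt | rfl | hlt
  · have := (hy.mem_of_lt e' hl' hl hlt).2
    rw [← h, ← e] at this
    exact absurd x.2 this
  · rw [e, e', h]
  · have := (hx.mem_of_lt e hl hl' hlt).2
    rw [h, ← e'] at this
    exact absurd y.2 this

/-! ### The sign cocycle -/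

/-- The change of sign along the edge from `v` to `v'`. At either end it involves the leg on the
right of the oriented edge: the real arc opposite to this leg runs along the edge and the leg on
its left. -/
def signCocycle (v v' : C.vertices) : ℤˣ × ℤˣ :=
  signOf (legVec v (idx v v' + 2)) * signOf (legVec v' (idx v' v + 1))

theorem signOf_legVec (v : C.vertices) (i : Fin 3) :
    signOf (legVec v (i + 2)) = signOf (legVec v i) * signOf (legVec v (i + 1)) := by
  rw [← signOf_add, ← signOf_neg, eq_neg_of_add_eq_zero_right (sum_legVec v i), neg_neg]

theorem signCocycle_symm (hs : C.IsSimple) {v v' : C.vertices} (h : C.IsEdge v v') :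
    signCocycle v' v = signCocycle v v' := by
  rw [signCocycle, signCocycle, signOf_legVec, signOf_legVec v, h.legVec_neg hs, signOf_neg]
  ac_rfl

/-- On a loop the sign cocycle is the loop condition: a vertex where the loop turns left contributes
nothing, and one where it turns right contributes its two edges, so that an edge counts if the loop
turns right at exactly one of its ends. -/
theorem prod_signCocycle_loop (hs : C.IsSimple) {n : ℕ} [NeZero n] (l : C.Loop n)
    [DecidablePred l.IsInflection] :
    ∏ i : ZMod n, signCocycle (⟨l.vert i, (l.isEdge i).1⟩ : C.vertices)
        ⟨l.vert (i + 1), (l.isEdge i).2.1⟩ =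
      signOf (∑ i : ZMod n with l.IsInflection i,
        (C.weight (l.vert i) (l.vec i) : ℤ) • l.vec i) := by
  classical
  let P : ZMod n → C.vertices := fun i => ⟨l.vert i, (l.isEdge i).1⟩
  have hP : ∀ i, C.IsEdge (P i) (P (i + 1)) := l.isEdge
  have hP' : ∀ i, C.IsEdge (P i) (P (i - 1)) := fun i => by
    have := (hP (i - 1)).symm
    rwa [sub_add_cancel] at this
  let a : ZMod n → Fin 3 := fun i => idx (P i) (P (i + 1))
  let b : ZMod n → Fin 3 := fun i => idx (P i) (P (i - 1))
  let W : ZMod n → ℤ × ℤ := fun i => (C.weight (l.vert i) (l.vec i) : ℤ) • l.vec i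
  -- `R i`: the loop turns right at its vertex with number `i`.
  let R : ZMod n → Prop := fun i => cross (toReal (l.vec (i - 1))) (toReal (l.vec i)) < 0
  -- The loop has at least three edges, so it does not go back along the same edge.
  have hab : ∀ i, a i ≠ b i := by
    intro i h
    have h1 := (hP i).eq_of_idx_eq (hP' i) h
    have h2 : i + 1 = i - 1 := l.vert_injective (congrArg Subtype.val h1)
    have h3 : ((2 : ℕ) : ZMod n) = 0 := by
      push_cast
      linear_combination h2
    rw [ZMod.natCast_eq_zero_iff] at h3
    have := Nat.le_of_dvd two_pos h3
    have := l.three_le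
    omega
  have hleg : ∀ i, leg (P i) (a i) = l.vec i := by
    intro i
    obtain ⟨t, ht, e⟩ := (hP i).idx_spec
    obtain ⟨t', ht', e'⟩ := l.vec_spec i
    refine (l.vec_primitive i).eq_of_pos_smul ((isLegSystem_leg _).primitive _)
      (div_pos ht' ht) ?_
    have h1 : t • toReal (leg (P i) (a i)) = t' • toReal (l.vec i) := by
      have : (l.vert i : ℝ × ℝ) + t • toReal (leg (P i) (a i)) =
        l.vert i + t' • toReal (l.vec i) := e.symm.trans e'
      exact add_left_cancel this
    rw [div_eq_inv_mul, ← smul_smul, ← h1, smul_smul, inv_mul_cancel₀ ht.ne', one_smul]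
  have hback : ∀ i, leg (P i) (b i) = -l.vec (i - 1) := by
    intro i
    have h1 := (hP (i - 1)).leg_neg
    rw [sub_add_cancel] at h1
    rw [← hleg (i - 1), show a (i - 1) = idx (P (i - 1)) (P i) by simp only [a, sub_add_cancel]]
    exact h1
  have hW : ∀ i, legVec (P i) (a i) = W i := by
    intro i
    rw [legVec, hleg]
  have hWback : ∀ i, signOf (legVec (P i) (b i)) = signOf (W (i - 1)) := by
    intro i
    have h1 := (hP (i - 1)).legVec_neg hs
    rw [sub_add_cancel] at h1
    rw [← hW, show a (i - 1) = idx (P (i - 1)) (P i) by simp only [a, sub_add_cancel],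
      ← signOf_neg (legVec (P (i - 1)) _), ← h1]
  have hcase : ∀ i, (R i ∧ signOf (legVec (P i) (a i + 2)) * signOf (legVec (P i) (b i + 1)) =
      signOf (W i) * signOf (W (i - 1))) ∨
      (0 < cross (toReal (l.vec (i - 1))) (toReal (l.vec i)) ∧
        signOf (legVec (P i) (a i + 2)) * signOf (legVec (P i) (b i + 1)) = 1) := by
    intro i
    have hfin : ∀ a b : Fin 3, a ≠ b →
        (a = b + 1 ∧ a + 2 = b) ∨ (b = a + 1 ∧ b + 1 = a + 2) := by decide
    rcases hfin _ _ (hab i) with ⟨h1, h2⟩ | ⟨h1, h2⟩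
    · left
      have hc := (isLegSystem_leg (P i)).ccw (b i)
      rw [← h1, hleg, hback, toReal_neg] at hc
      refine ⟨?_, ?_⟩
      · simp only [R, cross, Prod.fst_neg, Prod.snd_neg] at hc ⊢; linarith
      · rw [h2, ← h1, hW, hWback, mul_comm]
    · right
      have hc := (isLegSystem_leg (P i)).ccw (a i)
      rw [← h1, hleg, hback, toReal_neg] at hc
      refine ⟨?_, ?_⟩
      · simp only [cross, Prod.fst_neg, Prod.snd_neg] at hc ⊢; linarith
      · rw [h2, signs_mul_self]
  have hshift : ∀ f : ZMod n → ℤˣ × ℤˣ, ∏ i, f (i + 1) = ∏ i, f i := fun f =>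
    Equiv.prod_comp (Equiv.addRight (1 : ZMod n)) f
  calc ∏ i : ZMod n, signCocycle (P i) (P (i + 1))
      = (∏ i, signOf (legVec (P i) (a i + 2))) *
          ∏ i, signOf (legVec (P (i + 1)) (b (i + 1) + 1)) := by
        rw [← Finset.prod_mul_distrib]
        refine Finset.prod_congr rfl fun i _ => ?_
        simp only [signCocycle, a, b, add_sub_cancel_right]
    _ = ∏ i, (signOf (legVec (P i) (a i + 2)) * signOf (legVec (P i) (b i + 1))) := by
        rw [hshift fun i => signOf (legVec (P i) (b i + 1)), Finset.prod_mul_distrib]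
    _ = ∏ i, ((if R i then signOf (W i) else 1) * (if R i then signOf (W (i - 1)) else 1)) := by
        refine Finset.prod_congr rfl fun i _ => ?_
        rcases hcase i with ⟨h1, h2⟩ | ⟨h1, h2⟩
        · rw [h2, if_pos h1, if_pos h1]
        · rw [h2, if_neg (not_lt.2 h1.le), if_neg (not_lt.2 h1.le), one_mul]
    _ = ∏ i, ((if R i then signOf (W i) else 1) * (if R (i + 1) then signOf (W i) else 1)) := by
        rw [Finset.prod_mul_distrib, Finset.prod_mul_distrib,
          ← hshift fun i => if R i then signOf (W (i - 1)) else 1]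
        simp only [add_sub_cancel_right]
    _ = ∏ i, (if l.IsInflection i then signOf (W i) else 1) := by
        refine Finset.prod_congr rfl fun i _ => ?_
        have hinf : l.IsInflection i ↔ cross (toReal (l.vec (i - 1))) (toReal (l.vec i)) *
          cross (toReal (l.vec i)) (toReal (l.vec (i + 1))) < 0 := Iff.rfl
        have hR1 : R (i + 1) ↔ cross (toReal (l.vec i)) (toReal (l.vec (i + 1))) < 0 := by
          simp only [R, add_sub_cancel_right]
        have hc1 := hcase (i + 1)
        rw [add_sub_cancel_right] at hc1
        rcases hcase i with ⟨h1, -⟩ | ⟨h1, -⟩ <;> rcases hc1 with ⟨h2, -⟩ | ⟨h2, -⟩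
        · rw [if_pos h1, if_pos h2, signs_mul_self, if_neg]
          rw [hinf, not_lt]
          exact (mul_pos_of_neg_of_neg h1 (hR1.1 h2)).le
        · rw [if_pos h1, if_neg (fun h => not_lt.2 h2.le (hR1.1 h)), mul_one, if_pos]
          exact hinf.2 (mul_neg_of_neg_of_pos h1 h2)
        · rw [if_neg (not_lt.2 h1.le), if_pos h2, one_mul, if_pos]
          exact hinf.2 (mul_neg_of_pos_of_neg h1 (hR1.1 h2))
        · rw [if_neg (not_lt.2 h1.le), if_neg (fun h => not_lt.2 h2.le (hR1.1 h)), mul_one, if_neg]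
          rw [hinf, not_lt]
          exact (mul_pos h1 h2).le
    _ = signOf (∑ i : ZMod n with l.IsInflection i, W i) := by
        rw [signOf_sum, Finset.prod_filter]

variable (C) in
/-- The graph whose vertices and edges are the vertices and edges of the curve. -/
def edgeGraph : SimpleGraph C.vertices where
  Adj v v' := C.IsEdge v v'
  symm := ⟨fun _ _ h => IsEdge.symm h⟩
  loopless := ⟨fun _ h => h.2.2.1 rfl⟩

theorem edgeGraph_connected (hs : C.IsSimple) (hirr : C.IsIrreducible)
    (hne : C.vertices.Nonempty) : C.edgeGraph.Connected := by
  have : Nonempty C.vertices := hne.to_subtype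
  refine ⟨fun v w => ?_⟩
  have := mem_of_closed hs hirr (K := {x | ∃ h : x ∈ C.vertices, C.edgeGraph.Reachable v ⟨x, h⟩})
    (fun x hx => hx.1) (fun y hy x hxy => ⟨hxy.2.1, hy.2.trans
      (SimpleGraph.Adj.reachable (G := C.edgeGraph) (v := ⟨x, hxy.2.1⟩) hxy)⟩)
    ⟨v, v.2, SimpleGraph.Reachable.refl v⟩ w.2
  exact this.2

theorem prod_zmod_eq_prod_range {M : Type*} [CommMonoid M] {n : ℕ} [NeZero n] (f : ℕ → M) :
    ∏ i : ZMod n, f i.val = ∏ i ∈ Finset.range n, f i := by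
  refine Finset.prod_bij (fun i _ => i.val) (fun i _ => Finset.mem_range.2 (ZMod.val_lt i))
    (fun i _ j _ h => ZMod.val_injective n h) (fun i hi => ?_) (fun _ _ => rfl)
  exact ⟨i, Finset.mem_univ _, ZMod.val_cast_of_lt (Finset.mem_range.1 hi)⟩

/-- A cycle of the graph of edges is a loop of the curve. -/
theorem prod_signCocycle_cycle (hs : C.IsSimple) (hH : C.IsHarnack) {v : C.vertices}
    (w : C.edgeGraph.Walk v v) (hw : w.IsCycle) : walkProd signCocycle w = 1 := by
  classical
  have h3 := hw.three_le_length
  have : NeZero w.length := ⟨by omega⟩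
  have hsucc : ∀ i : ZMod w.length, w.getVert (i + 1).val = w.getVert (i.val + 1) := by
    intro i
    rw [ZMod.val_add, ZMod.val_one'' (by omega)]
    have := ZMod.val_lt i
    rcases (by omega : i.val + 1 < w.length ∨ i.val + 1 = w.length) with h | h
    · rw [Nat.mod_eq_of_lt h]
    · rw [h, Nat.mod_self, w.getVert_zero, w.getVert_length]
  have hadj : ∀ i : ZMod w.length, C.IsEdge (w.getVert i.val) (w.getVert (i + 1).val) := by
    intro i
    rw [hsucc]
    exact w.adj_getVert_succ (ZMod.val_lt i)
  let l : C.Loop w.length :=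
    { three_le := h3
      vert := fun i => w.getVert i.val
      vert_injective := by
        intro i j h
        apply ZMod.val_injective
        have h1 := ZMod.val_lt i
        have h2 := ZMod.val_lt j
        refine hw.getVert_injOn' ?_ ?_ (Subtype.ext h)
        · show i.val ≤ w.length - 1; omega
        · show j.val ≤ w.length - 1; omega
      isEdge := hadj
      vec := fun i => leg (w.getVert i.val) (idx (w.getVert i.val) (w.getVert (i + 1).val))
      vec_primitive := fun i => (isLegSystem_leg _).primitive _
      vec_spec := fun i => (hadj i).idx_spec }
  have h := prod_signCocycle_loop hs l
  rw [signOf_eq_one_iff.2 (by convert hH w.length l)] at h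
  rw [walkProd_eq_prod_range, ← prod_zmod_eq_prod_range (n := w.length)
    (f := fun i => signCocycle (w.getVert i) (w.getVert (i + 1))), ← h]
  refine Finset.prod_congr rfl fun i _ => ?_
  rw [← hsucc]

/-- The loop condition says that the sign cocycle is a coboundary. -/
theorem isHarnack_iff_exists_potential (hs : C.IsSimple) (hirr : C.IsIrreducible)
    (hne : C.vertices.Nonempty) : C.IsHarnack ↔ ∃ β : C.vertices → ℤˣ × ℤˣ,
      ∀ v v' : C.vertices, C.IsEdge v v' → β v' = β v * signCocycle v v' := by
  constructor
  · intro hH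
    refine exists_potential (G := C.edgeGraph) (fun u v h => ?_)
      (fun v w hw => prod_signCocycle_cycle hs hH w hw) (edgeGraph_connected hs hirr hne)
    rw [signCocycle_symm hs h, signs_mul_self]
  · rintro ⟨β, hβ⟩ n _ l
    classical
    rw [← signOf_eq_one_iff]
    let P : ZMod n → C.vertices := fun i => ⟨l.vert i, (l.isEdge i).1⟩
    have h : ∏ i, signCocycle (P i) (P (i + 1)) = signOf (∑ i : ZMod n with l.IsInflection i,
        (C.weight (l.vert i) (l.vec i) : ℤ) • l.vec i) := prod_signCocycle_loop hs l
    have h' : ∀ i, signCocycle (P i) (P (i + 1)) = β (P (i + 1)) / β (P i) := by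
      intro i
      rw [hβ (P i) (P (i + 1)) (l.isEdge i), mul_div_cancel_left]
    have hshift : ∏ i, β (P (i + 1)) = ∏ i, β (P i) :=
      Equiv.prod_comp (Equiv.addRight (1 : ZMod n)) fun i => β (P i)
    rw [Finset.prod_congr rfl fun i _ => h' i, Finset.prod_div_distrib, hshift, div_self'] at h
    exact h.symm

end TropPoly

/-! ### Points of the torus -/

/-- The point `(t ^ m₁, t ^ m₂)` of the one-parameter subgroup with direction `m`. -/
def monomialPoint (t : ℂˣ) (m : ℤ × ℤ) : Torus := (t ^ m.1, t ^ m.2)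

/-- The points of the torus whose coordinates are signs. -/
def signPoint : ℤˣ × ℤˣ →* Torus :=
  (Units.map (Int.castRingHom ℂ).toMonoidHom).prodMap (Units.map (Int.castRingHom ℂ).toMonoidHom)

/-- A positive real number as a unit of `ℂ`, given by its logarithm. -/
def expUnit (r : ℝ) : ℂˣ := Units.mk0 (Real.exp r : ℂ) (by exact_mod_cast (Real.exp_pos r).ne')

/-- The positive real point of the torus above a point of the plane. -/
def expPoint (x : ℝ × ℝ) : Torus := (expUnit x.1, expUnit x.2)

theorem signChange_eq (ε : ℤˣ × ℤˣ) (p : Torus) : signChange ε p = signPoint ε * p := rfl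

theorem expUnit_add (r s : ℝ) : expUnit (r + s) = expUnit r * expUnit s := by
  ext; simp [expUnit, Real.exp_add]

theorem expUnit_zsmul (r : ℝ) (n : ℤ) : expUnit (r * n) = expUnit r ^ n := by
  ext
  simp only [expUnit, Units.val_mk0, Units.val_zpow_eq_zpow_val]
  rw [mul_comm, Complex.ofReal_exp, Complex.ofReal_exp, ← Complex.exp_int_mul]
  push_cast
  rfl

theorem expPoint_add (x y : ℝ × ℝ) : expPoint (x + y) = expPoint x * expPoint y := by
  simp [expPoint, expUnit_add]

theorem expPoint_smul (r : ℝ) (m : ℤ × ℤ) :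
    expPoint (r • toReal m) = monomialPoint (expUnit r) m := by
  simp [expPoint, monomialPoint, toReal, expUnit_zsmul]

theorem expPoint_zero : expPoint 0 = 1 := by
  ext <;> simp [expPoint, expUnit]

theorem monomialPoint_neg (t : ℂˣ) (m : ℤ × ℤ) :
    monomialPoint (-t) m = signPoint (signOf m) * monomialPoint t m := by
  have h : ∀ n : ℤ, (-t) ^ n = Units.map (Int.castRingHom ℂ).toMonoidHom ((-1) ^ n) * t ^ n := by
    intro n
    rw [map_zpow, ← mul_zpow]
    congr 1
    ext; simp
  exact Prod.ext (h _) (h _)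

theorem monomialPoint_mul (s t : ℂˣ) (m : ℤ × ℤ) :
    monomialPoint (s * t) m = monomialPoint s m * monomialPoint t m := by
  simp [monomialPoint, mul_zpow]

theorem monomialPoint_inv (t : ℂˣ) (m : ℤ × ℤ) :
    monomialPoint t⁻¹ m = monomialPoint t (-m) := by
  simp [monomialPoint]

theorem signPoint_signOf (m : ℤ × ℤ) : signPoint (signOf m) = monomialPoint (-1) m := by
  rw [monomialPoint_neg]
  simp [monomialPoint]

theorem amoeba_mul (p q : Torus) : amoeba (p * q) = amoeba p + amoeba q := by
  have h : ∀ z w : ℂˣ, Real.log ‖((z * w : ℂˣ) : ℂ)‖ = Real.log ‖(z : ℂ)‖ + Real.log ‖(w : ℂ)‖ := by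
    intro z w
    rw [Units.val_mul, norm_mul, Real.log_mul] <;> simp
  exact Prod.ext (h _ _) (h _ _)

theorem norm_intUnit (ε : ℤˣ) :
    ‖((Units.map (Int.castRingHom ℂ).toMonoidHom ε : ℂˣ) : ℂ)‖ = 1 := by
  rcases Int.units_eq_one_or ε with rfl | rfl <;> simp

theorem amoeba_signPoint (ε : ℤˣ × ℤˣ) : amoeba (signPoint ε) = 0 := by
  have h := norm_intUnit ε.1
  have h' := norm_intUnit ε.2
  ext
  · simp only [amoeba, signPoint, MonoidHom.prodMap_def, MonoidHom.prod_apply,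
      MonoidHom.comp_apply, MonoidHom.coe_fst, h, Real.log_one, Prod.fst_zero]
  · simp only [amoeba, signPoint, MonoidHom.prodMap_def, MonoidHom.prod_apply,
      MonoidHom.comp_apply, MonoidHom.coe_snd, h', Real.log_one, Prod.snd_zero]

theorem amoeba_expPoint (x : ℝ × ℝ) : amoeba (expPoint x) = x := by
  have h : ∀ r : ℝ, Real.log ‖(expUnit r : ℂ)‖ = r := by
    intro r
    rw [expUnit, Units.val_mk0, Complex.norm_real, Real.norm_eq_abs, Real.abs_exp, Real.log_exp]
  exact Prod.ext (h _) (h _)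

theorem amoeba_monomialPoint (t : ℂˣ) (m : ℤ × ℤ) :
    amoeba (monomialPoint t m) = Real.log ‖(t : ℂ)‖ • toReal m := by
  ext <;> simp [amoeba, monomialPoint, toReal, Real.log_zpow, mul_comm]

theorem amoeba_signPoint_mul_expPoint (ε : ℤˣ × ℤˣ) (x : ℝ × ℝ) :
    amoeba (signPoint ε * expPoint x) = x := by
  rw [amoeba_mul, amoeba_signPoint, amoeba_expPoint, zero_add]

theorem conj_mul (p q : Torus) : conj (p * q) = conj p * conj q := by
  simp [conj]

theorem conj_signPoint (ε : ℤˣ × ℤˣ) : conj (signPoint ε) = signPoint ε := by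
  have h : ∀ ε : ℤˣ, Units.map (starRingEnd ℂ).toMonoidHom
      (Units.map (Int.castRingHom ℂ).toMonoidHom ε) =
      Units.map (Int.castRingHom ℂ).toMonoidHom ε := by
    intro ε; ext; simp
  exact Prod.ext (h _) (h _)

theorem conj_expPoint (x : ℝ × ℝ) : conj (expPoint x) = expPoint x := by
  have h : ∀ r : ℝ, Units.map (starRingEnd ℂ).toMonoidHom (expUnit r) = expUnit r := by
    intro r; ext; simp [expUnit, -Complex.ofReal_exp]
  exact Prod.ext (h _) (h _)

theorem isRealPoint_signPoint_mul_expPoint (ε : ℤˣ × ℤˣ) (x : ℝ × ℝ) :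
    IsRealPoint (signPoint ε * expPoint x) := by
  rw [IsRealPoint, conj_mul, conj_signPoint, conj_expPoint]

/-- A real point is determined by its signs and its amoeba. -/
theorem IsRealPoint.exists_signs {p : Torus} (hp : IsRealPoint p) :
    ∃ ε, p = signPoint ε * expPoint (amoeba p) := by
  have h : ∀ z : ℂˣ, Units.map (starRingEnd ℂ).toMonoidHom z = z →
      ∃ ε : ℤˣ, z = Units.map (Int.castRingHom ℂ).toMonoidHom ε *
        expUnit (Real.log ‖(z : ℂ)‖) := by
    intro z hz
    have hz' : (starRingEnd ℂ) (z : ℂ) = z := congrArg Units.val hz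
    obtain ⟨r, hr⟩ := Complex.conj_eq_iff_real.1 hz'
    have hr0 : r ≠ 0 := by
      rintro rfl
      exact z.ne_zero (by simp [hr])
    have hexp : (expUnit (Real.log ‖(z : ℂ)‖) : ℂ) = ((|r| : ℝ) : ℂ) := by
      rw [expUnit, Units.val_mk0, hr, Complex.norm_real, Real.norm_eq_abs,
        Real.exp_log (abs_pos.2 hr0)]
    rcases lt_or_gt_of_ne hr0 with h | h
    · refine ⟨-1, Units.ext ?_⟩
      rw [Units.val_mul, hexp, abs_of_neg h, hr]; simp
    · refine ⟨1, Units.ext ?_⟩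
      rw [Units.val_mul, hexp, abs_of_pos h, hr]; simp
  obtain ⟨ε, hε⟩ := h p.1 (congrArg Prod.fst hp)
  obtain ⟨ε', hε'⟩ := h p.2 (congrArg Prod.snd hp)
  exact ⟨(ε, ε'), Prod.ext hε hε'⟩

theorem signs_signPoint_mul_expPoint (ε : ℤˣ × ℤˣ) (x : ℝ × ℝ) :
    signs (signPoint ε * expPoint x) =
      (SignType.sign ((ε.1 : ℤ) : ℝ), SignType.sign ((ε.2 : ℤ) : ℝ)) := by
  have h : ∀ (ε : ℤˣ) (r : ℝ),
      SignType.sign ((Units.map (Int.castRingHom ℂ).toMonoidHom ε * expUnit r : ℂˣ) : ℂ).re =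
        SignType.sign ((ε : ℤ) : ℝ) := by
    intro ε r
    rcases Int.units_eq_one_or ε with rfl | rfl <;>
      simp [expUnit, Real.exp_pos, -Complex.ofReal_exp]
  exact Prod.ext (h _ _) (h _ _)

theorem signs_eq_signs_iff {ε ε' : ℤˣ × ℤˣ} {x x' : ℝ × ℝ} :
    signs (signPoint ε * expPoint x) = signs (signPoint ε' * expPoint x') ↔ ε = ε' := by
  rw [signs_signPoint_mul_expPoint, signs_signPoint_mul_expPoint]
  obtain ⟨a, b⟩ := ε
  obtain ⟨c, d⟩ := ε'
  rcases Int.units_eq_one_or a with rfl | rfl <;> rcases Int.units_eq_one_or b with rfl | rfl <;>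
    rcases Int.units_eq_one_or c with rfl | rfl <;>
    rcases Int.units_eq_one_or d with rfl | rfl <;>
    simp

/-- A reflection multiplies determinants by a sign, which cancels in a product of two. -/
theorem cross_reflect_mul (ε : ℤˣ × ℤˣ) (x : ℝ × ℝ) (a b c d e : ℝ × ℝ) :
    let s := signs (signPoint ε * expPoint x)
    cross (reflect s b - reflect s a) (reflect s c - reflect s a) *
      cross (reflect s b - reflect s a) (reflect s d - reflect s e) =
    cross (b - a) (c - a) * cross (b - a) (d - e) := by
  intro s
  have hs : s = _ := signs_signPoint_mul_expPoint ε x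
  clear_value s
  subst hs
  obtain ⟨a, b⟩ := ε
  rcases Int.units_eq_one_or a with rfl | rfl <;> rcases Int.units_eq_one_or b with rfl | rfl <;>
    simp [reflect, cross] <;> ring

/-! ### Toric morphisms -/

namespace ToricMorphism

theorem toFun_monomialPoint_mul (A : ToricMorphism) (s t : ℂˣ) (m n : ℤ × ℤ) :
    A.toFun (monomialPoint s m * monomialPoint t n) =
      A.b * (monomialPoint s (A.linear m) * monomialPoint t (A.linear n)) := by
  have h : ∀ (b s t : ℂˣ) (a c m₁ m₂ n₁ n₂ : ℤ),
      b * (s ^ m₁ * t ^ n₁) ^ a * (s ^ m₂ * t ^ n₂) ^ c =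
        b * (s ^ (a * m₁ + c * m₂) * t ^ (a * n₁ + c * n₂)) := by
    intro b s t a c m₁ m₂ n₁ n₂
    rw [mul_zpow, mul_zpow, ← zpow_mul, ← zpow_mul, ← zpow_mul, ← zpow_mul, zpow_add, zpow_add,
      mul_comm m₁, mul_comm n₁, mul_comm m₂, mul_comm n₂]
    simp only [mul_assoc, mul_left_comm]
  exact Prod.ext (h _ _ _ _ _ _ _ _ _) (h _ _ _ _ _ _ _ _ _)

theorem toFun_signPoint_mul (A : ToricMorphism) (t : ℂˣ) (m n : ℤ × ℤ) :
    A.toFun (signPoint (signOf m) * monomialPoint t n) =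
      A.b * (signPoint (signOf (A.linear m)) * monomialPoint t (A.linear n)) := by
  rw [signPoint_signOf, signPoint_signOf, toFun_monomialPoint_mul]

theorem amoeba_toFun (A : ToricMorphism) (p : Torus) :
    amoeba (A.toFun p) = amoeba A.b +
      (A.a 0 0 * (amoeba p).1 + A.a 0 1 * (amoeba p).2,
        A.a 1 0 * (amoeba p).1 + A.a 1 1 * (amoeba p).2) := by
  have h : ∀ (b z w : ℂˣ) (m n : ℤ), Real.log ‖((b * z ^ m * w ^ n : ℂˣ) : ℂ)‖ =
      Real.log ‖(b : ℂ)‖ + (m * Real.log ‖(z : ℂ)‖ + n * Real.log ‖(w : ℂ)‖) := by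
    intro b z w m n
    rw [Units.val_mul, Units.val_mul, norm_mul, norm_mul, Real.log_mul, Real.log_mul]
    · simp [Real.log_zpow, add_assoc]
    all_goals simp [zpow_ne_zero]
  exact Prod.ext (h _ _ _ _ _) (h _ _ _ _ _)

theorem amoeba_toFun_of_smul (A : ToricMorphism) {p : Torus} {r : ℝ} {m : ℤ × ℤ}
    (h : amoeba p = r • toReal m) :
    amoeba (A.toFun p) = amoeba A.b + r • toReal (A.linear m) := by
  rw [amoeba_toFun, h]
  congr 1
  ext <;> simp [toReal, linear] <;> ring

theorem amoeba_toFun_of_zero (A : ToricMorphism) {p : Torus} (h : amoeba p = 0) :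
    amoeba (A.toFun p) = amoeba A.b := by
  rw [amoeba_toFun, h]; simp

theorem continuous_toFun (A : ToricMorphism) : Continuous A.toFun := by
  unfold toFun
  fun_prop

theorem toFun_conj (A : ToricMorphism) (h : conj A.b = A.b) (p : Torus) :
    A.toFun (conj p) = conj (A.toFun p) := by
  have h1 : Units.map (starRingEnd ℂ).toMonoidHom A.b.1 = A.b.1 := congrArg Prod.fst h
  have h2 : Units.map (starRingEnd ℂ).toMonoidHom A.b.2 = A.b.2 := congrArg Prod.snd h
  ext <;> simp only [toFun, conj, map_mul, map_zpow, h1, h2]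

theorem toFun_one (A : ToricMorphism) : A.toFun 1 = A.b := by
  simp [toFun]

end ToricMorphism

/-! ### The phase-tropical line -/

/-- The directions of the three legs of the tropical line, in counterclockwise order. -/
def dir : Fin 3 → ℤ × ℤ := ![(-1, 0), (0, -1), (1, 1)]

theorem signOf_dir_mul {i j k : Fin 3} (hij : i ≠ j) (hik : i ≠ k) (hjk : j ≠ k) :
    signOf (dir k) * signOf (dir i) = signOf (dir j) := by
  fin_cases i <;> fin_cases j <;> fin_cases k <;> simp_all [signOf, dir]

theorem signPoint_dir_eq {i j k : Fin 3} (hij : i ≠ j) (hik : i ≠ k) (hjk : j ≠ k) (t : ℂˣ) :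
    signPoint (signOf (dir k)) * monomialPoint (-t) (dir i) =
      signPoint (signOf (dir j)) * monomialPoint t (dir i) := by
  rw [monomialPoint_neg, ← mul_assoc, ← map_mul, signOf_dir_mul hij hik hjk]

theorem signOf_dir_injective : Function.Injective fun i => signOf (dir i) := by
  intro i j h
  fin_cases i <;> fin_cases j <;> simp_all [signOf, dir]

/-- The leg in direction `dir i` of the tropical line carries an annulus of the phase-tropical
line. -/
theorem mem_phaseLine {i j : Fin 3} (hij : i ≠ j) {t : ℂˣ} (ht : 1 < ‖(t : ℂ)‖) :
    signPoint (signOf (dir j)) * monomialPoint t (dir i) ∈ phaseLine := by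
  have ht' : ‖(t : ℂ)‖⁻¹ < 1 := inv_lt_one_of_one_lt₀ ht
  fin_cases i
  · refine Or.inl (Or.inl (Or.inr ?_))
    fin_cases j <;> simp_all [signOf, dir, signPoint, monomialPoint]
  · refine Or.inl (Or.inr ?_)
    fin_cases j <;> simp_all [signOf, dir, signPoint, monomialPoint]
  · refine Or.inr ?_
    fin_cases j <;> simp_all [signOf, dir, signPoint, monomialPoint]

theorem norm_eq_one_of_mem_closure {p : Torus} (hp : p ∈ closure coamoebaLine) :
    ‖(p.1 : ℂ)‖ = 1 ∧ ‖(p.2 : ℂ)‖ = 1 := by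
  have hc1 : Continuous fun p : Torus => ‖(p.1 : ℂ)‖ :=
    (Units.continuous_val.comp continuous_fst).norm
  have hc2 : Continuous fun p : Torus => ‖(p.2 : ℂ)‖ :=
    (Units.continuous_val.comp continuous_snd).norm
  have hcl : IsClosed {p : Torus | ‖(p.1 : ℂ)‖ = 1 ∧ ‖(p.2 : ℂ)‖ = 1} :=
    (isClosed_eq hc1 continuous_const).inter (isClosed_eq hc2 continuous_const)
  exact closure_minimal (fun q hq => And.intro hq.1 hq.2.1) hcl hp

theorem amoeba_eq_zero_of_mem_closure {p : Torus} (hp : p ∈ closure coamoebaLine) :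
    amoeba p = 0 := by
  obtain ⟨h1, h2⟩ := norm_eq_one_of_mem_closure hp
  simp [amoeba, h1, h2]

/-- The closed coamoeba has no point with two positive coordinates. -/
theorem re_nonpos_of_mem_closure {p : Torus} (hp : p ∈ closure coamoebaLine) :
    (p.1 : ℂ).re ≤ 0 ∨ (p.2 : ℂ).re ≤ 0 := by
  have hc1 : Continuous fun p : Torus => (p.1 : ℂ).re :=
    Complex.continuous_re.comp (Units.continuous_val.comp continuous_fst)
  have hc2 : Continuous fun p : Torus => (p.2 : ℂ).re :=
    Complex.continuous_re.comp (Units.continuous_val.comp continuous_snd)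
  have hcl : IsClosed {p : Torus | (p.1 : ℂ).re ≤ 0 ∨ (p.2 : ℂ).re ≤ 0} :=
    (isClosed_le hc1 continuous_const).union (isClosed_le hc2 continuous_const)
  refine closure_minimal ?_ hcl hp
  intro p hp'
  obtain ⟨-, -, r, s, hr, hs, h⟩ := hp'
  by_contra hneg
  rw [Set.mem_ofPred_eq] at hneg
  push Not at hneg
  have := congrArg Complex.re h
  simp at this
  nlinarith [mul_pos hr hneg.1, mul_pos hs hneg.2]

theorem exists_ne_fin (i : Fin 3) : ∃ j, i ≠ j := by
  revert i; decide

theorem exists_third {i j : Fin 3} (h : i ≠ j) : ∃ k, i ≠ k ∧ j ≠ k := by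
  revert i j; decide

/-- A point of the phase-tropical line lies over the apex, or on the annulus over a leg. The annulus
over the leg in direction `dir i` has two coordinates `t`, one for each `j ≠ i`; they differ by
sign. -/
theorem mem_phaseLine_cases {p : Torus} (hp : p ∈ phaseLine) :
    p ∈ closure coamoebaLine ∨ ∃ i, ∀ j, i ≠ j → ∃ t : ℂˣ, 1 < ‖(t : ℂ)‖ ∧
      p = signPoint (signOf (dir j)) * monomialPoint t (dir i) := by
  have key : ∀ i j, i ≠ j → (∃ t : ℂˣ, 1 < ‖(t : ℂ)‖ ∧
      p = signPoint (signOf (dir j)) * monomialPoint t (dir i)) →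
      ∃ i, ∀ j, i ≠ j → ∃ t : ℂˣ, 1 < ‖(t : ℂ)‖ ∧
        p = signPoint (signOf (dir j)) * monomialPoint t (dir i) := by
    rintro i j hij ⟨t, ht, e⟩
    refine ⟨i, fun k hik => ?_⟩
    by_cases hjk : j = k
    · exact ⟨t, ht, by rw [e, hjk]⟩
    · exact ⟨-t, by simpa using ht, by rw [e, signPoint_dir_eq hij hik hjk]⟩
  rcases hp with ((hp | ⟨h1, h2⟩) | ⟨h1, h2⟩) | ⟨h1, h2⟩
  · exact Or.inl hp
  · refine Or.inr (key 0 1 (by decide) ⟨p.1⁻¹, ?_, ?_⟩)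
    · simpa using (one_lt_inv₀ (norm_pos_iff.2 p.1.ne_zero)).2 h1
    · refine Prod.ext (Units.ext ?_) (Units.ext ?_)
      · simp [signOf, dir, signPoint, monomialPoint]
      · simp [signOf, dir, signPoint, monomialPoint, h2]
  · refine Or.inr (key 1 0 (by decide) ⟨p.2⁻¹, ?_, ?_⟩)
    · simpa using (one_lt_inv₀ (norm_pos_iff.2 p.2.ne_zero)).2 h1
    · refine Prod.ext (Units.ext ?_) (Units.ext ?_)
      · simp [signOf, dir, signPoint, monomialPoint, h2]
      · simp [signOf, dir, signPoint, monomialPoint]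
  · refine Or.inr (key 2 1 (by decide) ⟨p.1, h1, ?_⟩)
    refine Prod.ext (Units.ext ?_) (Units.ext ?_)
    · simp [signOf, dir, signPoint, monomialPoint]
    · simp [signOf, dir, signPoint, monomialPoint, h2]

theorem mem_phaseLine_real {i j : Fin 3} (hij : i ≠ j) {r : ℝ} (hr : 0 < r) :
    signPoint (signOf (dir j)) * expPoint (r • toReal (dir i)) ∈ phaseLine := by
  rw [expPoint_smul]
  refine mem_phaseLine hij ?_
  rw [expUnit, Units.val_mk0, Complex.norm_real, Real.norm_eq_abs, Real.abs_exp]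
  exact Real.one_lt_exp_iff.2 hr

/-- The real part of the phase-tropical line consists of three arcs. The arc with signs
`signOf (dir j)` lies over the two legs other than the one in direction `dir j`. -/
theorem IsRealPoint.phaseLine_cases {p : Torus} (hr : IsRealPoint p) (hp : p ∈ phaseLine) :
    ∃ j, p = signPoint (signOf (dir j)) * expPoint (amoeba p) ∧
      (amoeba p = 0 ∨ ∃ i, i ≠ j ∧ ∃ r : ℝ, 0 < r ∧ amoeba p = r • toReal (dir i)) := by
  obtain ⟨ε, e⟩ := hr.exists_signs
  rcases mem_phaseLine_cases hp with hc | ⟨i, hi⟩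
  · have h0 := amoeba_eq_zero_of_mem_closure hc
    have h := re_nonpos_of_mem_closure hc
    obtain ⟨j, rfl⟩ : ∃ j, ε = signOf (dir j) := by
      rw [e, h0, expPoint_zero, mul_one] at h
      obtain ⟨a, b⟩ := ε
      rcases Int.units_eq_one_or a with rfl | rfl <;>
        rcases Int.units_eq_one_or b with rfl | rfl
      · exfalso
        simp [signPoint] at h
        linarith
      · exact ⟨1, by simp [signOf, dir]⟩
      · exact ⟨0, by simp [signOf, dir]⟩
      · exact ⟨2, by simp [signOf, dir]⟩
    exact ⟨j, e, Or.inl h0⟩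
  · obtain ⟨j, hij⟩ := exists_ne_fin i
    obtain ⟨k, hik, hjk⟩ := exists_third hij
    obtain ⟨t, ht, et⟩ := hi j hij
    have ha : amoeba p = Real.log ‖(t : ℂ)‖ • toReal (dir i) := by
      rw [et, amoeba_mul, amoeba_signPoint, amoeba_monomialPoint, zero_add]
    have hm : IsRealPoint (monomialPoint t (dir i)) := by
      have h1 : conj (signPoint (signOf (dir j))) * conj (monomialPoint t (dir i)) =
          signPoint (signOf (dir j)) * monomialPoint t (dir i) := by
        rw [← conj_mul, ← et]; exact hr
      rw [conj_signPoint] at h1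
      exact mul_left_cancel h1
    obtain ⟨δ, eδ⟩ := hm.exists_signs
    -- The coordinate `t` is real, as one of the coordinates of the point is `t` or `t⁻¹`.
    have hδ : δ = 1 ∨ δ = signOf (dir i) := by
      rw [amoeba_monomialPoint, expPoint_smul] at eδ
      obtain ⟨a, b⟩ := δ
      have e1 := congrArg Units.val (congrArg Prod.fst eδ)
      have e2 := congrArg Units.val (congrArg Prod.snd eδ)
      rcases Int.units_eq_one_or a with rfl | rfl <;>
        rcases Int.units_eq_one_or b with rfl | rfl <;>
        fin_cases i <;>
        simp [signOf, dir, signPoint, monomialPoint, Prod.ext_iff] at e1 e2 ⊢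
      all_goals have hone : (1 : ℂ) ≠ -1 := by norm_num
      all_goals have hne : (expUnit (Real.log ‖(t : ℂ)‖) : ℂ) ≠ 0 := Units.ne_zero _
      all_goals first
        | exact absurd e1 hone
        | exact absurd e2 hone
        | exact absurd (self_eq_neg.1 (e1.symm.trans e2)) hne
        | exact absurd (self_eq_neg.1 (e2.symm.trans e1)) hne
    have hlog := Real.log_pos ht
    rcases hδ with rfl | rfl
    · refine ⟨j, ?_, Or.inr ⟨i, hij, _, hlog, ha⟩⟩
      rw [et, eδ, map_one, one_mul, amoeba_mul, amoeba_signPoint, zero_add, amoeba_expPoint]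
    · refine ⟨k, ?_, Or.inr ⟨i, hik, _, hlog, ha⟩⟩
      rw [et, eδ, ← mul_assoc, ← map_mul, signOf_dir_mul hik hij hjk.symm, amoeba_mul,
        amoeba_signPoint, zero_add, amoeba_expPoint]

theorem neg_one_mem_coamoebaLine : ((-1, -1) : Torus) ∈ coamoebaLine :=
  ⟨by simp, by simp, 1 / 2, 1 / 2, by norm_num, by norm_num, by push_cast; norm_num⟩

/-- The toric automorphism that permutes the three directions of the tropical line. -/
def permMorphism (π : Equiv.Perm (Fin 3)) : ToricMorphism where
  b := 1
  a := !![-(dir (π 0)).1, -(dir (π 1)).1; -(dir (π 0)).2, -(dir (π 1)).2]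

theorem sum_dir_perm (π : Equiv.Perm (Fin 3)) : dir (π 0) + dir (π 1) + dir (π 2) = 0 := by
  have h : ∑ i, dir (π i) = ∑ i, dir i := Equiv.sum_comp π dir
  rw [Fin.sum_univ_three, Fin.sum_univ_three] at h
  rw [h]
  simp [dir]

theorem permMorphism_linear (π : Equiv.Perm (Fin 3)) (i : Fin 3) :
    (permMorphism π).linear (dir i) = dir (π i) := by
  fin_cases i
  · ext <;> simp [permMorphism, ToricMorphism.linear, dir]
  · ext <;> simp [permMorphism, ToricMorphism.linear, dir]
  · have h := eq_neg_of_add_eq_zero_right (sum_dir_perm π)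
    have e : (permMorphism π).linear (dir 2) = -(dir (π 0) + dir (π 1)) := by
      ext <;> simp [permMorphism, ToricMorphism.linear, dir] <;> ring
    exact e.trans h.symm

/-- The symmetry of the line `z + w + 1 = 0` under permutations of its homogeneous coordinates. -/
theorem permMorphism_mem_coamoebaLine (π : Equiv.Perm (Fin 3)) {p : Torus}
    (hp : p ∈ coamoebaLine) : (permMorphism π).toFun p ∈ coamoebaLine := by
  obtain ⟨h1, h2, r, s, hr, hs, h⟩ := hp
  have hz := p.1.ne_zero
  have hw := p.2.ne_zero
  have hr' : (r : ℂ) ≠ 0 := by exact_mod_cast hr.ne'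
  have hs' : (s : ℂ) ≠ 0 := by exact_mod_cast hs.ne'
  have hne : π 0 ≠ π 1 := fun h => absurd (π.injective h) (by decide)
  have hcase : (π 0 = 0 ∧ π 1 = 1) ∨ (π 0 = 1 ∧ π 1 = 0) ∨ (π 0 = 0 ∧ π 1 = 2) ∨
      (π 0 = 2 ∧ π 1 = 0) ∨ (π 0 = 1 ∧ π 1 = 2) ∨ (π 0 = 2 ∧ π 1 = 1) := by
    revert hne
    generalize π 0 = a
    generalize π 1 = b
    revert a b
    decide
  have key : ∀ q : Torus, (permMorphism π).toFun p = q →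
      (‖(q.1 : ℂ)‖ = 1 ∧ ‖(q.2 : ℂ)‖ = 1 ∧
        ∃ r s : ℝ, 0 < r ∧ 0 < s ∧ (r : ℂ) * q.1 + (s : ℂ) * q.2 + 1 = 0) →
      (permMorphism π).toFun p ∈ coamoebaLine := fun q e h => e ▸ h
  rcases hcase with ⟨e0, e1⟩ | ⟨e0, e1⟩ | ⟨e0, e1⟩ | ⟨e0, e1⟩ | ⟨e0, e1⟩ | ⟨e0, e1⟩
  · refine key (p.1, p.2) ?_ ⟨h1, h2, r, s, hr, hs, h⟩
    simp [permMorphism, ToricMorphism.toFun, e0, e1, dir]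
  · refine key (p.2, p.1) ?_ ⟨h2, h1, s, r, hs, hr, by linear_combination h⟩
    simp [permMorphism, ToricMorphism.toFun, e0, e1, dir]
  · refine key (p.1 * p.2⁻¹, p.2⁻¹) ?_ ⟨by simp [h1, h2], by simp [h2], r / s, 1 / s,
      by positivity, by positivity, ?_⟩
    · simp [permMorphism, ToricMorphism.toFun, e0, e1, dir]
    · push_cast
      field_simp
      linear_combination h
  · refine key (p.1⁻¹ * p.2, p.1⁻¹) ?_ ⟨by simp [h1, h2], by simp [h1], s / r, 1 / r,
      by positivity, by positivity, ?_⟩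
    · simp [permMorphism, ToricMorphism.toFun, e0, e1, dir]
    · push_cast
      field_simp
      linear_combination h
  · refine key (p.2⁻¹, p.1 * p.2⁻¹) ?_ ⟨by simp [h2], by simp [h1, h2], 1 / s, r / s,
      by positivity, by positivity, ?_⟩
    · simp [permMorphism, ToricMorphism.toFun, e0, e1, dir]
    · push_cast
      field_simp
      linear_combination h
  · refine key (p.1⁻¹, p.1⁻¹ * p.2) ?_ ⟨by simp [h1], by simp [h1, h2], 1 / r, s / r,
      by positivity, by positivity, ?_⟩
    · simp [permMorphism, ToricMorphism.toFun, e0, e1, dir]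
    · push_cast
      field_simp
      linear_combination h

theorem permMorphism_mem_phaseLine (π : Equiv.Perm (Fin 3)) {p : Torus} (hp : p ∈ phaseLine) :
    (permMorphism π).toFun p ∈ phaseLine := by
  rcases mem_phaseLine_cases hp with hc | ⟨i, hi⟩
  · exact Or.inl (Or.inl (Or.inl (map_mem_closure (permMorphism π).continuous_toFun hc
      fun q hq => permMorphism_mem_coamoebaLine π hq)))
  · obtain ⟨j, hij⟩ := exists_ne_fin i
    obtain ⟨t, ht, e⟩ := hi j hij
    have hb : (permMorphism π).b = 1 := rfl
    rw [e, ToricMorphism.toFun_signPoint_mul, permMorphism_linear, permMorphism_linear, hb, one_mul]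
    exact mem_phaseLine (fun h => hij (π.injective h)) ht

/-- Permuting the directions changes the chart of a general phase-tropical line, not its image. -/
theorem ToricMorphism.toFun_permMorphism {A A' : ToricMorphism} {π : Equiv.Perm (Fin 3)}
    (h : ∀ i, A'.linear (dir i) = A.linear (dir (π i))) (p : Torus) :
    A'.toFun p = A'.b * A.b⁻¹ * A.toFun ((permMorphism π).toFun p) := by
  have h0 := h 0
  have h1 := h 1
  have e00 : A'.a 0 0 = -(A.a 0 0 * (dir (π 0)).1 + A.a 0 1 * (dir (π 0)).2) := by
    have := congrArg Prod.fst h0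
    simp only [linear, dir, Matrix.cons_val_zero] at this ⊢
    linarith
  have e10 : A'.a 1 0 = -(A.a 1 0 * (dir (π 0)).1 + A.a 1 1 * (dir (π 0)).2) := by
    have := congrArg Prod.snd h0
    simp only [linear, dir, Matrix.cons_val_zero] at this ⊢
    linarith
  have e01 : A'.a 0 1 = -(A.a 0 0 * (dir (π 1)).1 + A.a 0 1 * (dir (π 1)).2) := by
    have := congrArg Prod.fst h1
    simp only [linear, dir, Matrix.cons_val_one, Matrix.cons_val_zero] at this ⊢
    linarith
  have e11 : A'.a 1 1 = -(A.a 1 0 * (dir (π 1)).1 + A.a 1 1 * (dir (π 1)).2) := by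
    have := congrArg Prod.snd h1
    simp only [linear, dir, Matrix.cons_val_one, Matrix.cons_val_zero] at this ⊢
    linarith
  have key : ∀ (b b' z w : ℂˣ) (a c m₁ m₂ n₁ n₂ : ℤ),
      b' * z ^ (-(a * m₁ + c * m₂)) * w ^ (-(a * n₁ + c * n₂)) =
        b' * b⁻¹ * (b * (1 * z ^ (-m₁) * w ^ (-n₁)) ^ a * (1 * z ^ (-m₂) * w ^ (-n₂)) ^ c) := by
    intro b b' z w a c m₁ m₂ n₁ n₂
    have e1 : -(a * m₁ + c * m₂) = -m₁ * a + -m₂ * c := by ring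
    have e2 : -(a * n₁ + c * n₂) = -n₁ * a + -n₂ * c := by ring
    rw [e1, e2, one_mul, one_mul, mul_zpow, mul_zpow, zpow_add, zpow_add, zpow_mul, zpow_mul,
      zpow_mul, zpow_mul]
    simp only [mul_assoc, inv_mul_cancel_left]
    congr 2
    simp only [mul_left_comm]
  refine Prod.ext ?_ ?_
  · simp only [toFun, e00, e01]
    exact key _ _ _ _ _ _ _ _ _ _
  · simp only [toFun, e10, e11]
    exact key _ _ _ _ _ _ _ _ _ _

variable {C : TropPoly}

open TropPoly

/-! ### Charts of phase-tropical curves -/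

theorem leg_smul_eq {v : C.vertices} {i k : Fin 3} {r s : ℝ} (hr : 0 < r)
    (h : r • toReal (leg v k) = s • toReal (leg v i)) : k = i ∧ r = s := by
  have hc : r * cross (toReal (leg v k)) (toReal (leg v i)) = 0 := by
    have h1 := congrArg Prod.fst h
    have h2 := congrArg Prod.snd h
    simp only [Prod.smul_fst, Prod.smul_snd, smul_eq_mul] at h1 h2
    simp only [cross]
    linear_combination (toReal (leg v i)).2 * h1 - (toReal (leg v i)).1 * h2
  have hc' := (mul_eq_zero.1 hc).resolve_left hr.ne'
  have hki : k = i := by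
    by_contra hne
    have hfin : ∀ k i : Fin 3, k ≠ i → i = k + 1 ∨ k = i + 1 := by decide
    rcases hfin k i hne with e | e
    · have := (isLegSystem_leg v).ccw k
      rw [← e, hc'] at this
      exact lt_irrefl _ this
    · have := (isLegSystem_leg v).ccw i
      rw [← e] at this
      simp only [cross] at this hc'
      linarith
  subst hki
  have h0 := toReal_ne_zero ((isLegSystem_leg v).primitive k).ne_zero
  exact ⟨rfl, smul_left_injective ℝ h0 h⟩

/-- The length of the edge from `v` to `v'`, measured in primitive vectors. -/
def edgeLength (v v' : C.vertices) : ℝ :=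
  ‖(v' : ℝ × ℝ) - v‖ / ‖toReal (leg v (idx v v'))‖

theorem _root_.TropHarnack.TropPoly.IsEdge.edgeLength_spec {v v' : C.vertices}
    (h : C.IsEdge v v') : 0 < edgeLength v v' ∧
      (v' : ℝ × ℝ) = v + edgeLength v v' • toReal (leg v (idx v v')) := by
  obtain ⟨l, hl, e⟩ := h.idx_spec
  have h0 := toReal_ne_zero ((isLegSystem_leg v).primitive (idx v v')).ne_zero
  have hlen : edgeLength v v' = l := by
    rw [edgeLength, e, add_sub_cancel_left, norm_smul, Real.norm_eq_abs, abs_of_pos hl,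
      mul_div_cancel_right₀ _ (norm_ne_zero_iff.2 h0)]
  rw [hlen]
  exact ⟨hl, e⟩

theorem _root_.TropHarnack.TropPoly.IsEdge.edgeLength_symm {v v' : C.vertices}
    (h : C.IsEdge v v') : edgeLength v' v = edgeLength v v' := by
  rw [edgeLength, edgeLength, h.leg_neg, toReal_neg, norm_neg, norm_sub_rev]

theorem _root_.TropHarnack.TropPoly.IsEdge.mem_openSegment {v v' : C.vertices}
    (h : C.IsEdge v v') {x : ℝ × ℝ} : x ∈ openSegment ℝ (v : ℝ × ℝ) v' ↔
      ∃ t : ℝ, 0 < t ∧ t < edgeLength v v' ∧ x = v + t • toReal (leg v (idx v v')) := by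
  obtain ⟨hl, e⟩ := h.edgeLength_spec
  have e' : (v' : ℝ × ℝ) - v = edgeLength v v' • toReal (leg v (idx v v')) := by
    nth_rewrite 1 [e]; rw [add_sub_cancel_left]
  rw [openSegment_eq_image', e']
  constructor
  · rintro ⟨θ, ⟨h0, h1⟩, rfl⟩
    exact ⟨θ * edgeLength v v', mul_pos h0 hl, mul_lt_of_lt_one_left hl h1,
      by simp only [smul_smul]⟩
  · rintro ⟨t, h0, h1, rfl⟩
    refine ⟨t / edgeLength v v', ⟨div_pos h0 hl, (div_lt_one hl).2 h1⟩, ?_⟩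
    simp only [smul_smul]
    rw [div_mul_cancel₀ _ hl.ne']

/-- The toric morphism `A` is a real chart at the vertex `v` with signs `β`, and sends the leg
in direction `dir (π i)` to the `i`-th leg of `v`. -/
structure IsChart (A : ToricMorphism) (v : C.vertices) (β : ℤˣ × ℤˣ)
    (π : Equiv.Perm (Fin 3)) : Prop where
  b_eq : A.b = signPoint β * expPoint v
  linear_eq : ∀ i, A.linear (dir (π i)) = legVec v i

namespace IsChart

variable {A : ToricMorphism} {v v' : C.vertices} {β : ℤˣ × ℤˣ} {π : Equiv.Perm (Fin 3)}

theorem amoeba_b (hA : IsChart A v β π) : amoeba A.b = v := by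
  rw [hA.b_eq, amoeba_signPoint_mul_expPoint]

theorem amoeba_toFun (hA : IsChart A v β π) {p : Torus} {r : ℝ} {i : Fin 3}
    (h : amoeba p = r • toReal (dir (π i))) :
    amoeba (A.toFun p) = v + (r * C.weight v (leg v i)) • toReal (leg v i) := by
  rw [A.amoeba_toFun_of_smul h, hA.linear_eq, hA.amoeba_b, legVec, toReal_smul, smul_smul,
    Int.cast_natCast]

theorem toFun_real (hA : IsChart A v β π) (i j : Fin 3) (r : ℝ) :
    A.toFun (signPoint (signOf (dir (π j))) * expPoint (r • toReal (dir (π i)))) =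
      signPoint (β * signOf (legVec v j)) *
        expPoint (v + (r * C.weight v (leg v i)) • toReal (leg v i)) := by
  rw [expPoint_smul, A.toFun_signPoint_mul, hA.linear_eq, hA.linear_eq, hA.b_eq, map_mul,
    expPoint_add, ← expPoint_smul, legVec, legVec, toReal_smul, smul_smul, Int.cast_natCast]
  rw [mul_mul_mul_comm]

theorem _root_.TropHarnack.IsRealPoint.phaseLine_cases_perm {p : Torus} (hr : IsRealPoint p)
    (hp : p ∈ phaseLine) (π : Equiv.Perm (Fin 3)) :
    ∃ j, p = signPoint (signOf (dir (π j))) * expPoint (amoeba p) ∧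
      (amoeba p = 0 ∨ ∃ i, i ≠ j ∧ ∃ r : ℝ, 0 < r ∧ amoeba p = r • toReal (dir (π i))) := by
  obtain ⟨j, e, h⟩ := hr.phaseLine_cases hp
  refine ⟨π.symm j, by simpa using e, h.imp id ?_⟩
  rintro ⟨i, hij, r, hr, e'⟩
  exact ⟨π.symm i, fun h => hij (π.symm.injective h), r, hr, by simpa using e'⟩

theorem weight_pos (v : C.vertices) (i : Fin 3) : (0 : ℝ) < C.weight v (leg v i) := by
  exact_mod_cast (isLegSystem_leg v).weight_pos i

/-- Above an edge, the phase-tropical line is an annulus. -/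
theorem exists_of_mem_above (hA : IsChart A v β π) (h : C.IsEdge v v') {p : Torus}
    (hp : p ∈ A.above v v') {j : Fin 3} (hj : idx v v' ≠ j) : ∃ t : ℂˣ, 1 < ‖(t : ℂ)‖ ∧
      Real.log ‖(t : ℂ)‖ * C.weight v (leg v (idx v v')) < edgeLength v v' ∧
      p = signPoint (signOf (dir (π j))) * monomialPoint t (dir (π (idx v v'))) := by
  obtain ⟨hp, hseg⟩ := hp
  obtain ⟨s, hs, hsl, e⟩ := h.mem_openSegment.1 hseg
  have hu0 := toReal_ne_zero ((isLegSystem_leg v).primitive (idx v v')).ne_zero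
  rcases mem_phaseLine_cases hp with hc | ⟨i, hi⟩
  · rw [A.amoeba_toFun_of_zero (amoeba_eq_zero_of_mem_closure hc), hA.amoeba_b, left_eq_add] at e
    exact absurd e (smul_ne_zero hs.ne' hu0)
  · have ham : ∀ j : Fin 3, i ≠ j → ∀ t : ℂˣ,
        p = signPoint (signOf (dir j)) * monomialPoint t (dir i) →
        amoeba p = Real.log ‖(t : ℂ)‖ • toReal (dir (π (π.symm i))) := by
      intro j hij t et
      rw [et, amoeba_mul, amoeba_signPoint, amoeba_monomialPoint, zero_add,
        Equiv.apply_symm_apply]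
    have hi' : π.symm i = idx v v' := by
      obtain ⟨k, hk⟩ := exists_ne_fin i
      obtain ⟨t, ht, et⟩ := hi k hk
      rw [hA.amoeba_toFun (ham k hk t et)] at e
      exact (leg_smul_eq (mul_pos (Real.log_pos ht) (weight_pos v _)) (add_left_cancel e)).1
    obtain rfl : i = π (idx v v') := by rw [← hi', Equiv.apply_symm_apply]
    obtain ⟨t, ht, et⟩ := hi (π j) (fun h => hj (π.injective h))
    refine ⟨t, ht, ?_, et⟩
    rw [hA.amoeba_toFun (ham _ (fun h => hj (π.injective h)) t et), Equiv.symm_apply_apply] at e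
    rw [(leg_smul_eq (mul_pos (Real.log_pos ht) (weight_pos v _)) (add_left_cancel e)).2]
    exact hsl

theorem mem_above (hA : IsChart A v β π) (h : C.IsEdge v v') {j : Fin 3} (hj : idx v v' ≠ j)
    {t : ℂˣ} (ht : 1 < ‖(t : ℂ)‖)
    (ht' : Real.log ‖(t : ℂ)‖ * C.weight v (leg v (idx v v')) < edgeLength v v') :
    signPoint (signOf (dir (π j))) * monomialPoint t (dir (π (idx v v'))) ∈ A.above v v' := by
  refine ⟨mem_phaseLine (fun h => hj (π.injective h)) ht, ?_⟩
  rw [h.mem_openSegment]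
  refine ⟨_, mul_pos (Real.log_pos ht) (weight_pos v _), ht', hA.amoeba_toFun ?_⟩
  rw [amoeba_mul, amoeba_signPoint, amoeba_monomialPoint, zero_add]

/-- A real arc leaves the edge along one of the two other legs, the one that it is not opposite
to. -/
theorem exists_third_leg (hA : IsChart A v β π) (h : C.IsEdge v v') {q : Torus} {j : Fin 3}
    (hr : IsRealPoint q) (hq : q ∈ phaseLine)
    (e : q = signPoint (signOf (dir (π j))) * expPoint (amoeba q))
    (ht : amoeba (A.toFun q) ∈ C.tripod v \ ({(v : ℝ × ℝ)} ∪ openSegment ℝ (v : ℝ × ℝ) v')) :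
    ∃ k, k ≠ j ∧ k ≠ idx v v' ∧ ∃ ρ : ℝ, 0 < ρ ∧
      amoeba (A.toFun q) = v + ρ • toReal (leg v k) := by
  obtain ⟨j', e', hcase⟩ := hr.phaseLine_cases_perm hq π
  obtain rfl : j' = j := by
    have h1 : signs (signPoint (signOf (dir (π j'))) * expPoint (amoeba q)) =
        signs (signPoint (signOf (dir (π j))) * expPoint (amoeba q)) := by rw [← e, ← e']
    exact π.injective (signOf_dir_injective (signs_eq_signs_iff.1 h1))
  obtain ⟨htri, hnot⟩ := ht
  rcases hcase with h0 | ⟨k, hk, r, hr, ea⟩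
  · exact absurd (Or.inl ((A.amoeba_toFun_of_zero h0).trans hA.amoeba_b)) hnot
  have ea' := hA.amoeba_toFun ea
  have hρ := mul_pos hr (weight_pos v k)
  refine ⟨k, hk, ?_, _, hρ, ea'⟩
  rintro rfl
  refine hnot (Or.inr (h.mem_openSegment.2 ⟨_, hρ, ?_, ea'⟩))
  obtain ⟨hl, el⟩ := h.edgeLength_spec
  rw [ea'] at htri
  have hu0 := toReal_ne_zero ((isLegSystem_leg v).primitive (idx v v')).ne_zero
  rcases htri with h0 | ⟨u, hu, t, ht, et, hb⟩
  · rw [add_eq_left] at h0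
    exact absurd h0 (smul_ne_zero hρ.ne' hu0)
  · obtain ⟨m, rfl⟩ := (isLegSystem_leg v).isOutgoing_iff.1 hu
    obtain ⟨e1, e2⟩ := leg_smul_eq hρ (add_left_cancel et)
    rw [← e1, ← e2] at hb
    by_contra hle
    have := (hb _ hl (not_lt.1 hle)).2
    rw [← el] at this
    exact this v'.2

end IsChart

/-! ### The signs of a phase-tropical Harnack curve -/

namespace SimplePhaseCurve

/-- Up to the numbering of the legs, a real chart is determined by a pair of signs. -/
theorem exists_isChart (V : SimplePhaseCurve C) (hV : V.IsReal) (v : C.vertices) :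
    ∃ β π, IsChart (V.chart v) v β π := by
  have hreal : IsRealPoint (V.chart v).b := by
    have := hV.1 v 1
    rw [show conj 1 = 1 by simp [conj], ToricMorphism.toFun_one] at this
    exact this.symm
  obtain ⟨β, hβ⟩ := hreal.exists_signs
  rw [V.chart_vertex] at hβ
  have hd : ∀ i, ∃ k, (V.chart v).linear (dir k) = legVec v i := by
    intro i
    obtain ⟨d, hd, e⟩ := V.chart_weight v (leg v i) ((isLegSystem_leg v).outgoing i)
    rcases hd with rfl | rfl | rfl
    · exact ⟨0, e⟩
    · exact ⟨1, e⟩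
    · exact ⟨2, e⟩
  choose f hf using hd
  have hinj : Function.Injective f := by
    intro i k h
    have h1 : legVec v i = legVec v k := by rw [← hf, ← hf, h]
    have h2 := congrArg toReal h1
    rw [legVec, legVec, toReal_smul, toReal_smul, Int.cast_natCast, Int.cast_natCast] at h2
    exact (leg_smul_eq (IsChart.weight_pos v i) h2).1
  exact ⟨β, Equiv.ofBijective f (Finite.injective_iff_bijective.1 hinj), hβ, hf⟩

theorem fin_ne_add (i : Fin 3) : i ≠ i + 1 ∧ i ≠ i + 2 ∧ i + 1 ≠ i + 2 ∧ i + 2 + 1 = i := by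
  revert i; decide

theorem exists_small_leg {v : C.vertices} (i : Fin 3) : ∃ r : ℝ, 0 < r ∧
    (v : ℝ × ℝ) + (r * C.weight v (leg v i)) • toReal (leg v i) ∈ C.branch v (leg v i) := by
  obtain ⟨ε, hε, h⟩ := exists_branch (isLegSystem_leg v) i
  have hw := IsChart.weight_pos v i
  refine ⟨ε / 2 / C.weight v (leg v i), by positivity, h _ (by positivity) ?_⟩
  rw [div_mul_cancel₀ _ hw.ne']
  linarith

theorem notMem_edge {v v' : C.vertices} (h : C.IsEdge v v') {k : Fin 3} (hk : k ≠ idx v v')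
    {s : ℝ} (hs : 0 < s) : (v : ℝ × ℝ) + s • toReal (leg v k) ∉
      ({(v : ℝ × ℝ)} ∪ openSegment ℝ (v : ℝ × ℝ) v' : Set (ℝ × ℝ)) := by
  have hu0 := toReal_ne_zero ((isLegSystem_leg v).primitive k).ne_zero
  rintro (h0 | h0)
  · rw [Set.mem_singleton_iff, add_eq_left] at h0
    exact smul_ne_zero hs.ne' hu0 h0
  · obtain ⟨t, -, -, e⟩ := h.mem_openSegment.1 h0
    exact hk (leg_smul_eq hs (add_left_cancel e)).1

/-- Without inflection patterns, the arc that leaves the oriented edge from `v` to `v'` on its left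
at `v` is glued to the one that leaves it on its left at `v'`, so that both have the same signs. -/
theorem sign_relation (V : SimplePhaseCurve C) (hV : V.IsReal) (hinf : ¬ V.HasInflectionPattern)
    {v v' : C.vertices} (h : C.IsEdge v v') {β β' : ℤˣ × ℤˣ} {π π' : Equiv.Perm (Fin 3)}
    (hA : IsChart (V.chart v) v β π) (hA' : IsChart (V.chart v') v' β' π') :
    β' = β * signCocycle v v' := by
  obtain ⟨hl, el⟩ := h.edgeLength_spec
  obtain ⟨hl', el'⟩ := h.symm.edgeLength_spec
  set i := idx v v' with hi
  set i' := idx v' v with hi'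
  have hfi := fin_ne_add i
  have hfi' := fin_ne_add i'
  have hw := IsChart.weight_pos v i
  -- A real point in the middle of the edge, on the arc with the left leg at `v`.
  set r : ℝ := edgeLength v v' / 2 / C.weight v (leg v i) with hr
  have hr0 : 0 < r := by positivity
  set p : Torus := signPoint (signOf (dir (π (i + 2)))) * expPoint (r • toReal (dir (π i))) with hp
  have hpabove : p ∈ (V.chart v).above v v' := by
    have hlog : Real.log ‖(expUnit r : ℂ)‖ = r := by
      rw [expUnit, Units.val_mk0, Complex.norm_real, Real.norm_eq_abs, Real.abs_exp, Real.log_exp]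
    rw [hp, expPoint_smul]
    refine hA.mem_above h hfi.2.1 ?_ ?_
    · rw [expUnit, Units.val_mk0, Complex.norm_real, Real.norm_eq_abs, Real.abs_exp]
      exact Real.one_lt_exp_iff.2 hr0
    · rw [hlog, hr, div_mul_cancel₀ _ hw.ne']
      linarith
  have hpreal : IsRealPoint p := isRealPoint_signPoint_mul_expPoint _ _
  set p' := V.glue v v' h ⟨p, hpabove⟩ with hp'
  have hp'real : IsRealPoint (p' : Torus) :=
    (hV.2 v v' h ⟨p, hpabove⟩ ⟨p, hpabove⟩ hpreal.symm).symm
  obtain ⟨j, ej, hcase⟩ := hp'real.phaseLine_cases_perm p'.2.1 π'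
  obtain ⟨t, ht, -, et⟩ := hA'.exists_of_mem_above h.symm p'.2 hfi'.1
  have ham : amoeba (p' : Torus) = Real.log ‖(t : ℂ)‖ • toReal (dir (π' i')) := by
    rw [et, amoeba_mul, amoeba_signPoint, amoeba_monomialPoint, zero_add]
  have hlogt := Real.log_pos ht
  have hji : j ≠ i' := by
    rintro rfl
    have e1 := hA'.amoeba_toFun ham
    rcases hcase with h0 | ⟨k, hk, s, hs, es⟩
    · rw [(V.chart v').amoeba_toFun_of_zero h0, hA'.amoeba_b, left_eq_add] at e1
      exact smul_ne_zero (mul_pos hlogt (IsChart.weight_pos v' i')).ne'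
        (toReal_ne_zero ((isLegSystem_leg v').primitive _).ne_zero) e1
    · rw [hA'.amoeba_toFun es] at e1
      exact hk (leg_smul_eq (mul_pos hs (IsChart.weight_pos v' k)) (add_left_cancel e1)).1
  have hmap : (V.chart v').toFun p' = (V.chart v).toFun p := V.glue_map v v' h ⟨p, hpabove⟩
  have hsign : β' * signOf (legVec v' j) = β * signOf (legVec v (i + 2)) := by
    have e1 := congrArg signs hmap
    rw [ej, ham, hA'.toFun_real, hp, hA.toFun_real] at e1
    exact signs_eq_signs_iff.1 e1
  have hfin : ∀ j i : Fin 3, j ≠ i → j = i + 1 ∨ j = i + 2 := by decide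
  rcases hfin j i' hji with rfl | rfl
  · rw [signCocycle, ← mul_assoc, ← hsign, mul_assoc, signs_mul_self, mul_one]
  · -- Otherwise this arc is glued to the one with the right leg at `v'`, an inflection pattern.
    exfalso
    apply hinf
    obtain ⟨ρ, hρ, hbr⟩ := exists_small_leg (v := v) (i + 1)
    obtain ⟨ρ', hρ', hbr'⟩ := exists_small_leg (v := v') (i' + 1)
    set q : Torus := signPoint (signOf (dir (π (i + 2)))) *
      expPoint (ρ • toReal (dir (π (i + 1)))) with hq
    set q' : Torus := signPoint (signOf (dir (π' (i' + 2)))) *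
      expPoint (ρ' • toReal (dir (π' (i' + 1)))) with hq'
    have eq := hA.toFun_real (i + 1) (i + 2) ρ
    have eq' := hA'.toFun_real (i' + 1) (i' + 2) ρ'
    have ep := hA.toFun_real i (i + 2) r
    rw [← hq] at eq
    rw [← hq'] at eq'
    rw [← hp] at ep
    have eaq : amoeba ((V.chart v).toFun q) =
        v + (ρ * C.weight v (leg v (i + 1))) • toReal (leg v (i + 1)) := by
      rw [eq, amoeba_signPoint_mul_expPoint]
    have eaq' : amoeba ((V.chart v').toFun q') =
        v' + (ρ' * C.weight v' (leg v' (i' + 1))) • toReal (leg v' (i' + 1)) := by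
      rw [eq', amoeba_signPoint_mul_expPoint]
    have hs1 : signs ((V.chart v).toFun q) = signs ((V.chart v).toFun p) := by
      rw [eq, ep]; exact signs_eq_signs_iff.2 rfl
    have hs2 : signs ((V.chart v').toFun q') = signs ((V.chart v).toFun p) := by
      rw [eq', ep]; exact signs_eq_signs_iff.2 hsign
    have hk1 := mul_pos hρ (IsChart.weight_pos v (i + 1))
    have hk2 := mul_pos hρ' (IsChart.weight_pos v' (i' + 1))
    refine ⟨v, v', h, ⟨p, hpabove⟩, q, q', signs ((V.chart v).toFun p),
      reflect (signs ((V.chart v).toFun p)) (amoeba ((V.chart v).toFun q)),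
      reflect (signs ((V.chart v).toFun p)) (amoeba ((V.chart v').toFun q')),
      ⟨hpabove.1, ?_, hpreal, isRealPoint_signPoint_mul_expPoint _ _, ?_⟩, ⟨?_, ?_⟩,
      ⟨p'.2.1, ?_, hp'real, isRealPoint_signPoint_mul_expPoint _ _, ?_⟩, ⟨?_, ?_⟩,
      rfl, ?_, ?_, ?_⟩
    · exact mem_phaseLine_real (fun h => hfi.2.2.1 (π.injective h)) hρ
    · exact signs_eq_signs_iff.2 rfl
    · rw [eaq]
      exact Or.inr ⟨_, (isLegSystem_leg v).outgoing _, hbr⟩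
    · rw [eaq]
      exact notMem_edge h hfi.1.symm hk1
    · exact mem_phaseLine_real (fun h => hfi'.2.2.1 (π'.injective h)) hρ'
    · rw [← hp', ej, hq']
      exact signs_eq_signs_iff.2 rfl
    · rw [eaq']
      exact Or.inr ⟨_, (isLegSystem_leg v').outgoing _, hbr'⟩
    · rw [eaq', openSegment_symm]
      exact notMem_edge h.symm hfi'.1.symm hk2
    · rw [signedAmoeba, hs1]
    · rw [signedAmoeba, hs2]
    · rw [ep, cross_reflect_mul, eaq, eaq', add_sub_cancel_left, add_sub_cancel_left]
      have c1 := (isLegSystem_leg v).ccw i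
      have c2 := (isLegSystem_leg v').ccw i'
      have e1 : (v' : ℝ × ℝ) - v = edgeLength v v' • toReal (leg v i) := by
        nth_rewrite 1 [el]; rw [add_sub_cancel_left]
      have e2 : (v' : ℝ × ℝ) - v = -(edgeLength v' v • toReal (leg v' i')) := by
        nth_rewrite 1 [el']; rw [← sub_sub, sub_self, zero_sub]
      have d1 : cross ((v' : ℝ × ℝ) - v)
          ((ρ * C.weight v (leg v (i + 1))) • toReal (leg v (i + 1))) =
          edgeLength v v' * (ρ * C.weight v (leg v (i + 1))) *
            cross (toReal (leg v i)) (toReal (leg v (i + 1))) := by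
        rw [e1]
        simp only [cross, Prod.smul_fst, Prod.smul_snd, smul_eq_mul]
        ring
      have d2 : cross ((v' : ℝ × ℝ) - v)
          ((ρ' * C.weight v' (leg v' (i' + 1))) • toReal (leg v' (i' + 1))) =
          -(edgeLength v' v * (ρ' * C.weight v' (leg v' (i' + 1))) *
            cross (toReal (leg v' i')) (toReal (leg v' (i' + 1)))) := by
        rw [e2]
        simp only [cross, Prod.smul_fst, Prod.smul_snd, smul_eq_mul, Prod.fst_neg, Prod.snd_neg]
        ring
      rw [d1, d2]
      exact mul_neg_of_pos_of_neg (by positivity) (neg_neg_of_pos (by positivity))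

theorem exists_potential_of_isPhaseHarnack (V : SimplePhaseCurve C) (hV : V.IsPhaseHarnack) :
    ∃ β : C.vertices → ℤˣ × ℤˣ, (∀ v, ∃ π, IsChart (V.chart v) v (β v) π) ∧
      ∀ v v' : C.vertices, C.IsEdge v v' → β v' = β v * signCocycle v v' := by
  choose β π h using V.exists_isChart hV.1
  exact ⟨β, fun v => ⟨π v, h v⟩, fun v v' he => V.sign_relation hV.1 hV.2.2 he (h v) (h v')⟩

/-- The image of a chart depends only on its signs: two charts with the same signs differ by a
symmetry of the phase-tropical line. -/
theorem carrier_subset {V V' : SimplePhaseCurve C} {β β' : C.vertices → ℤˣ × ℤˣ}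
    {ε : ℤˣ × ℤˣ} (h : ∀ v, ∃ π, IsChart (V.chart v) v (β v) π)
    (h' : ∀ v, ∃ π, IsChart (V'.chart v) v (β' v) π) (hε : ∀ v, β' v = ε * β v) :
    V'.carrier ⊆ signChange ε '' V.carrier := by
  intro p hp
  obtain ⟨v, hv⟩ := Set.mem_iUnion.1 hp
  obtain ⟨⟨x, hx, rfl⟩, htri⟩ := hv
  obtain ⟨π, hA⟩ := h v
  obtain ⟨π', hA'⟩ := h' v
  have hlin : ∀ i, (V'.chart v).linear (dir i) =
      (V.chart v).linear (dir ((π'.symm.trans π) i)) := by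
    intro i
    rw [Equiv.trans_apply, hA.linear_eq, ← hA'.linear_eq, Equiv.apply_symm_apply]
  have e := ToricMorphism.toFun_permMorphism hlin x
  have hb : (V'.chart v).b * (V.chart v).b⁻¹ = signPoint ε := by
    rw [hA.b_eq, hA'.b_eq, hε, map_mul]
    group
  rw [hb] at e
  refine ⟨_, Set.mem_iUnion.2 ⟨v, ⟨_, permMorphism_mem_phaseLine _ hx, rfl⟩, ?_⟩, e.symm⟩
  rw [Set.mem_preimage, e, amoeba_mul, amoeba_signPoint, zero_add] at htri
  exact htri

theorem carrier_eq {V V' : SimplePhaseCurve C} {β β' : C.vertices → ℤˣ × ℤˣ}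
    {ε : ℤˣ × ℤˣ} (h : ∀ v, ∃ π, IsChart (V.chart v) v (β v) π)
    (h' : ∀ v, ∃ π, IsChart (V'.chart v) v (β' v) π) (hε : ∀ v, β' v = ε * β v) :
    V'.carrier = signChange ε '' V.carrier := by
  refine (carrier_subset h h' hε).antisymm ?_
  have hinv : ∀ p, signChange ε (signChange ε p) = p := by
    intro p
    rw [signChange_eq, signChange_eq, ← mul_assoc, ← map_mul, signs_mul_self, map_one, one_mul]
  rintro _ ⟨p, hp, rfl⟩
  obtain ⟨q, hq, rfl⟩ := carrier_subset h' h (ε := ε)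
    (fun v => by rw [hε, ← mul_assoc, signs_mul_self, one_mul]) hp
  rwa [hinv]

/-- That the amoeba is the whole curve uses irreducibility: a line without vertices lies under no
chart. -/
theorem amoeba_carrier (hs : C.IsSimple) (hirr : C.IsIrreducible) (hne : C.vertices.Nonempty)
    {V : SimplePhaseCurve C} {β : C.vertices → ℤˣ × ℤˣ}
    (h : ∀ v, ∃ π, IsChart (V.chart v) v (β v) π) : amoeba '' V.carrier = C.curve := by
  apply Set.Subset.antisymm
  · rintro _ ⟨p, hp, rfl⟩
    obtain ⟨v, -, htri⟩ := Set.mem_iUnion.1 hp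
    rcases htri with h0 | ⟨u, -, t, ht, e, hb⟩
    · rw [h0]; exact mem_curve_of_mem_vertices v.2
    · rw [e]; exact (hb t ht le_rfl).1
  · intro x hx
    obtain ⟨v, hv, hxv⟩ := exists_mem_tripod hs hirr hne hx
    obtain ⟨π, hA⟩ := h ⟨v, hv⟩
    suffices ∃ p ∈ phaseLine, amoeba ((V.chart ⟨v, hv⟩).toFun p) = x by
      obtain ⟨p, hp, e⟩ := this
      exact ⟨_, Set.mem_iUnion.2 ⟨⟨v, hv⟩, ⟨p, hp, rfl⟩, by rw [Set.mem_preimage, e]; exact hxv⟩, e⟩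
    rcases hxv with rfl | ⟨u, hu, t, ht, rfl, -⟩
    · have hmem := subset_closure neg_one_mem_coamoebaLine
      exact ⟨(-1, -1), Or.inl (Or.inl (Or.inl hmem)),
        ((V.chart _).amoeba_toFun_of_zero (amoeba_eq_zero_of_mem_closure hmem)).trans hA.amoeba_b⟩
    · obtain ⟨i, rfl⟩ := (isLegSystem_leg ⟨v, hv⟩).isOutgoing_iff.1 hu
      have hw := IsChart.weight_pos (⟨v, hv⟩ : C.vertices) i
      refine ⟨_, mem_phaseLine_real (i := π i) (j := π (i + 1))
        (fun h => (fin_ne_add i).1 (π.injective h)) (div_pos ht hw), ?_⟩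
      rw [hA.toFun_real, amoeba_signPoint_mul_expPoint, div_mul_cancel₀ _ hw.ne']

end SimplePhaseCurve

/-! ### Construction of a phase-tropical curve from its signs -/

/-- The chart at `v` with signs `β` that respects the numbering of the legs. -/
def standardChart (v : C.vertices) (β : ℤˣ × ℤˣ) : ToricMorphism where
  b := signPoint β * expPoint v
  a := !![-(legVec v 0).1, -(legVec v 1).1; -(legVec v 0).2, -(legVec v 1).2]

theorem isChart_standardChart (v : C.vertices) (β : ℤˣ × ℤˣ) :
    IsChart (standardChart v β) v β (Equiv.refl _) where
  b_eq := rfl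
  linear_eq i := by
    rw [Equiv.refl_apply]
    fin_cases i
    · ext <;> simp [standardChart, ToricMorphism.linear, dir]
    · ext <;> simp [standardChart, ToricMorphism.linear, dir]
    · have h := eq_neg_of_add_eq_zero_right (sum_legVec v 0)
      have e : (standardChart v β).linear (dir 2) = -(legVec v 0 + legVec v 1) := by
        ext <;> simp [standardChart, ToricMorphism.linear, dir] <;> ring
      exact e.trans h.symm

/-- Exponents of a character that is dual to the direction of a leg of the tropical line. -/
def dualDir : Fin 3 → ℤ × ℤ := ![(-1, 0), (0, -1), (1, 0)]

/-- The coordinate on the annulus over the leg in direction `dir i`. -/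
def legCoord (i : Fin 3) (p : Torus) : ℂˣ := p.1 ^ (dualDir i).1 * p.2 ^ (dualDir i).2

theorem legCoord_monomialPoint (i : Fin 3) (t : ℂˣ) :
    legCoord i (monomialPoint t (dir i)) = t := by
  fin_cases i <;> simp [legCoord, monomialPoint, dir, dualDir]

/-- The map between annuli of two phase-tropical lines that is given by `t ↦ c / t` in the
coordinates that are positive on the real arcs opposite to the legs `j` and `j'`. -/
def annulusMap (i j i' j' : Fin 3) (c : ℂˣ) (p : Torus) : Torus :=
  signPoint (signOf (dir j')) *
    monomialPoint (c * (legCoord i (signPoint (signOf (dir j)) * p))⁻¹) (dir i')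

theorem annulusMap_apply (i j i' j' : Fin 3) (c t : ℂˣ) :
    annulusMap i j i' j' c (signPoint (signOf (dir j)) * monomialPoint t (dir i)) =
      signPoint (signOf (dir j')) * monomialPoint (c * t⁻¹) (dir i') := by
  rw [annulusMap, ← mul_assoc (signPoint _), ← map_mul, signs_mul_self, map_one, one_mul,
    legCoord_monomialPoint]

theorem continuous_annulusMap (i j i' j' : Fin 3) (c : ℂˣ) :
    Continuous (annulusMap i j i' j' c) := by
  unfold annulusMap legCoord monomialPoint
  fun_prop

theorem annulusMap_conj (i j i' j' : Fin 3) (r : ℝ) (p : Torus) :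
    annulusMap i j i' j' (expUnit r) (conj p) = conj (annulusMap i j i' j' (expUnit r) p) := by
  have hc : Units.map (starRingEnd ℂ).toMonoidHom (expUnit r) = expUnit r :=
    congrArg Prod.fst (conj_expPoint (r, r))
  have hl : ∀ q : Torus, legCoord i (conj q) =
      Units.map (starRingEnd ℂ).toMonoidHom (legCoord i q) := by
    intro q
    simp only [legCoord, conj, map_mul, map_zpow]
  have hm : ∀ (t : ℂˣ) (m : ℤ × ℤ), conj (monomialPoint t m) =
      monomialPoint (Units.map (starRingEnd ℂ).toMonoidHom t) m := by
    intro t m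
    simp only [monomialPoint, conj, map_zpow]
  have hs : signPoint (signOf (dir j)) * conj p = conj (signPoint (signOf (dir j)) * p) := by
    rw [conj_mul, conj_signPoint]
  rw [annulusMap, annulusMap, conj_mul, conj_signPoint, hm, map_mul, map_inv, hc, hs, hl]

/-- The logarithm of the constant `c` in the gluing map `t ↦ c / t` along an edge. With this
choice the map exchanges the two boundary circles of the annulus over the edge. -/
def gluingConstant (v v' : C.vertices) : ℝ :=
  edgeLength v v' / C.weight v (leg v (idx v v'))

theorem gluingConstant_symm (hs : C.IsSimple) {v v' : C.vertices} (h : C.IsEdge v v') :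
    gluingConstant v' v = gluingConstant v v' := by
  rw [gluingConstant, gluingConstant, h.edgeLength_symm, h.weight_eq hs]

/-- The gluing map along the edge from `v` to `v'`. At either end it uses the coordinate that is
positive on the real arc with the leg on the left of the oriented edge. -/
def gluingMap (v v' : C.vertices) : Torus → Torus :=
  annulusMap (idx v v') (idx v v' + 2) (idx v' v) (idx v' v + 1)
    (expUnit (gluingConstant v v'))

theorem log_norm_expUnit (r : ℝ) : Real.log ‖(expUnit r : ℂ)‖ = r := by
  rw [expUnit, Units.val_mk0, Complex.norm_real, Real.norm_eq_abs, Real.abs_exp, Real.log_exp]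

theorem one_lt_norm_iff (t : ℂˣ) : 1 < ‖(t : ℂ)‖ ↔ 0 < Real.log ‖(t : ℂ)‖ :=
  (Real.log_pos_iff (norm_nonneg _)).symm

theorem log_norm_expUnit_mul_inv (r : ℝ) (t : ℂˣ) :
    Real.log ‖((expUnit r * t⁻¹ : ℂˣ) : ℂ)‖ = r - Real.log ‖(t : ℂ)‖ := by
  rw [Units.val_mul, norm_mul, Real.log_mul (norm_ne_zero_iff.2 (Units.ne_zero _))
    (norm_ne_zero_iff.2 (Units.ne_zero _)), log_norm_expUnit, Units.val_inv_eq_inv_val, norm_inv,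
    Real.log_inv, sub_eq_add_neg]

section Gluing

variable {v v' : C.vertices} {β β' : ℤˣ × ℤˣ}

theorem exists_of_mem_above_standardChart (h : C.IsEdge v v') {p : Torus}
    (hp : p ∈ (standardChart v β).above v v') {j : Fin 3} (hj : idx v v' ≠ j) :
    ∃ t : ℂˣ, 0 < Real.log ‖(t : ℂ)‖ ∧ Real.log ‖(t : ℂ)‖ < gluingConstant v v' ∧
      p = signPoint (signOf (dir j)) * monomialPoint t (dir (idx v v')) := by
  obtain ⟨t, h1, h2, e⟩ := (isChart_standardChart v β).exists_of_mem_above h hp hj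
  exact ⟨t, Real.log_pos h1, (lt_div_iff₀ (IsChart.weight_pos v _)).2 h2, e⟩

theorem mem_above_standardChart (h : C.IsEdge v v') {j : Fin 3} (hj : idx v v' ≠ j) {t : ℂˣ}
    (h1 : 0 < Real.log ‖(t : ℂ)‖) (h2 : Real.log ‖(t : ℂ)‖ < gluingConstant v v') :
    signPoint (signOf (dir j)) * monomialPoint t (dir (idx v v')) ∈
      (standardChart v β).above v v' :=
  (isChart_standardChart v β).mem_above h hj ((one_lt_norm_iff t).2 h1)
    ((lt_div_iff₀ (IsChart.weight_pos v _)).1 h2)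

theorem gluingMap_mem (hs : C.IsSimple) (h : C.IsEdge v v') {p : Torus}
    (hp : p ∈ (standardChart v β).above v v') :
    gluingMap v v' p ∈ (standardChart v' β').above v' v := by
  obtain ⟨t, h1, h2, rfl⟩ := exists_of_mem_above_standardChart h hp
    (SimplePhaseCurve.fin_ne_add _).2.1
  rw [gluingMap, annulusMap_apply]
  refine mem_above_standardChart h.symm (SimplePhaseCurve.fin_ne_add _).1 ?_ ?_
  · rw [log_norm_expUnit_mul_inv]; linarith
  · rw [log_norm_expUnit_mul_inv, gluingConstant_symm hs h]; linarith

theorem gluingMap_gluingMap (hs : C.IsSimple) (h : C.IsEdge v v') {p : Torus}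
    (hp : p ∈ (standardChart v β).above v v') : gluingMap v' v (gluingMap v v' p) = p := by
  have hi := SimplePhaseCurve.fin_ne_add (idx v v')
  have hi' := SimplePhaseCurve.fin_ne_add (idx v' v)
  obtain ⟨t, h1, h2, rfl⟩ := exists_of_mem_above_standardChart h hp hi.2.1
  -- Seen from the other end, left and right are exchanged, which changes `t` to `-t`.
  rw [gluingMap, gluingMap, annulusMap_apply,
    ← signPoint_dir_eq hi'.1 hi'.2.1 hi'.2.2.1, annulusMap_apply,
    ← signPoint_dir_eq hi.2.1 hi.1 hi.2.2.1.symm, gluingConstant_symm hs h]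
  congr 2
  rw [inv_neg, mul_neg, mul_inv, inv_inv, mul_inv_cancel_left]

/-- The two charts agree over the edge exactly because of the relation between their signs. -/
theorem toFun_gluingMap (hs : C.IsSimple) (h : C.IsEdge v v')
    (hβ : β' = β * signCocycle v v') {p : Torus} (hp : p ∈ (standardChart v β).above v v') :
    (standardChart v' β').toFun (gluingMap v v' p) = (standardChart v β).toFun p := by
  obtain ⟨t, h1, h2, rfl⟩ := exists_of_mem_above_standardChart h hp
    (SimplePhaseCurve.fin_ne_add _).2.1
  have hA := (isChart_standardChart v β).linear_eq
  have hA' := (isChart_standardChart v' β').linear_eq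
  simp only [Equiv.refl_apply] at hA hA'
  obtain ⟨hl, el⟩ := h.edgeLength_spec
  have hc : monomialPoint (expUnit (gluingConstant v v')) (-legVec v (idx v v')) *
      expPoint v' = expPoint v := by
    rw [← expPoint_smul, ← expPoint_add, gluingConstant, toReal_neg, legVec, toReal_smul,
      smul_neg, smul_smul, Int.cast_natCast, div_mul_cancel₀ _ (IsChart.weight_pos v _).ne']
    rw [neg_add_eq_sub, sub_eq_iff_eq_add.2 el]
  have hm : monomialPoint (expUnit (gluingConstant v v') * t⁻¹) (-legVec v (idx v v')) =
      monomialPoint (expUnit (gluingConstant v v')) (-legVec v (idx v v')) *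
        monomialPoint t (legVec v (idx v v')) := by
    rw [monomialPoint_mul, monomialPoint_inv, neg_neg]
  have hsg : signPoint β' * signPoint (signOf (legVec v' (idx v' v + 1))) =
      signPoint β * signPoint (signOf (legVec v (idx v v' + 2))) := by
    rw [← map_mul, ← map_mul, hβ, signCocycle, mul_assoc, mul_assoc, signs_mul_self, mul_one]
  rw [gluingMap, annulusMap_apply, ToricMorphism.toFun_signPoint_mul,
    ToricMorphism.toFun_signPoint_mul, hA, hA, hA', hA', h.legVec_neg hs, hm]
  simp only [standardChart]
  rw [← hc, mul_mul_mul_comm, hsg]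
  ac_rfl

theorem gluingMap_conj (v v' : C.vertices) (p : Torus) :
    gluingMap v v' (conj p) = conj (gluingMap v v' p) := annulusMap_conj _ _ _ _ _ _

/-- The gluing map sends the real arc with the leg on the left of the oriented edge to the one with
the leg on the left at the other end, and likewise on the right. -/
theorem gluingMap_real (v v' : C.vertices) (r : ℝ) :
    gluingMap v v' (signPoint (signOf (dir (idx v v' + 2))) *
        expPoint (r • toReal (dir (idx v v')))) =
      signPoint (signOf (dir (idx v' v + 1))) *
        expPoint ((gluingConstant v v' - r) • toReal (dir (idx v' v))) ∧
    gluingMap v v' (signPoint (signOf (dir (idx v v' + 1))) *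
        expPoint (r • toReal (dir (idx v v')))) =
      signPoint (signOf (dir (idx v' v + 2))) *
        expPoint ((gluingConstant v v' - r) • toReal (dir (idx v' v))) := by
  have hi := SimplePhaseCurve.fin_ne_add (idx v v')
  have hi' := SimplePhaseCurve.fin_ne_add (idx v' v)
  have he : expUnit (gluingConstant v v' - r) =
      expUnit (gluingConstant v v') * (expUnit r)⁻¹ := by
    rw [eq_mul_inv_iff_mul_eq, ← expUnit_add, sub_add_cancel]
  rw [expPoint_smul, expPoint_smul, he]
  constructor
  · rw [gluingMap, annulusMap_apply]
  · rw [gluingMap, ← signPoint_dir_eq hi.1 hi.2.1 hi.2.2.1, annulusMap_apply,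
      ← signPoint_dir_eq hi'.2.1 hi'.1 hi'.2.2.1.symm, inv_neg, mul_neg]

end Gluing

namespace SimplePhaseCurve

/-- The real phase-tropical curve with given signs at the vertices. -/
def ofSigns (hs : C.IsSimple) (β : C.vertices → ℤˣ × ℤˣ)
    (hβ : ∀ v v' : C.vertices, C.IsEdge v v' → β v' = β v * signCocycle v v') :
    SimplePhaseCurve C where
  chart v := standardChart v (β v)
  chart_vertex v := (isChart_standardChart v (β v)).amoeba_b
  chart_weight v u hu := by
    obtain ⟨i, rfl⟩ := (isLegSystem_leg v).isOutgoing_iff.1 hu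
    refine ⟨dir i, ?_, (isChart_standardChart v (β v)).linear_eq i⟩
    fin_cases i <;> simp [dir]
  glue v v' h :=
    { toFun := fun p => ⟨gluingMap v v' p, gluingMap_mem hs h p.2⟩
      invFun := fun p => ⟨gluingMap v' v p, gluingMap_mem hs (IsEdge.symm h) p.2⟩
      left_inv := fun p => Subtype.ext (gluingMap_gluingMap hs h p.2)
      right_inv := fun p => Subtype.ext (gluingMap_gluingMap hs (IsEdge.symm h) p.2)
      continuous_toFun :=
        ((continuous_annulusMap _ _ _ _ _).comp continuous_subtype_val).subtype_mk _
      continuous_invFun :=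
        ((continuous_annulusMap _ _ _ _ _).comp continuous_subtype_val).subtype_mk _ }
  glue_map v v' h p := toFun_gluingMap hs h (hβ v v' h) p.2
  glue_symm v v' h h' p := Subtype.ext (gluingMap_gluingMap hs h p.2)

variable {hs : C.IsSimple} {β : C.vertices → ℤˣ × ℤˣ}
  {hβ : ∀ v v' : C.vertices, C.IsEdge v v' → β v' = β v * signCocycle v v'}

theorem ofSigns_isReal : (ofSigns hs β hβ).IsReal := by
  refine ⟨fun v p => ?_, fun v v' h p q hpq => ?_⟩
  · refine (standardChart v (β v)).toFun_conj ?_ p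
    exact isRealPoint_signPoint_mul_expPoint _ _
  · change gluingMap v v' q = conj (gluingMap v v' p)
    rw [hpq, gluingMap_conj]

theorem cross_edge {v v' : C.vertices} (h : C.IsEdge v v') (k : Fin 3) (ρ : ℝ) :
    cross ((v' : ℝ × ℝ) - v) (v + ρ • toReal (leg v k) - v) =
      edgeLength v v' * ρ * cross (toReal (leg v (idx v v'))) (toReal (leg v k)) := by
  have e1 : (v' : ℝ × ℝ) - v = edgeLength v v' • toReal (leg v (idx v v')) := by
    nth_rewrite 1 [h.edgeLength_spec.2]; rw [add_sub_cancel_left]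
  rw [e1, add_sub_cancel_left]
  simp only [cross, Prod.smul_fst, Prod.smul_snd, smul_eq_mul]
  ring

theorem cross_leg (v : C.vertices) (i : Fin 3) :
    0 < cross (toReal (leg v i)) (toReal (leg v (i + 1))) ∧
      cross (toReal (leg v i)) (toReal (leg v (i + 2))) < 0 := by
  refine ⟨(isLegSystem_leg v).ccw i, ?_⟩
  have := (isLegSystem_leg v).ccw (i + 2)
  rw [(fin_ne_add i).2.2.2] at this
  simp only [cross] at this ⊢
  linarith

theorem ofSigns_not_hasInflectionPattern : ¬ (ofSigns hs β hβ).HasInflectionPattern := by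
  rintro ⟨v, v', h, p, q, q', s, x, x', ⟨hp, hq, hpr, hqr, hsig⟩, htri,
    ⟨hp', hq', hpr', hqr', hsig'⟩, htri', hs, hx, hx', hcross⟩
  have hA := isChart_standardChart v (β v)
  have hA' := isChart_standardChart v' (β v')
  change amoeba ((standardChart v (β v)).toFun q) ∈ _ at htri
  change amoeba ((standardChart v' (β v')).toFun q') ∈ _ at htri'
  change signs (gluingMap v v' p) = signs q' at hsig'
  change signs ((standardChart v (β v)).toFun p) = s at hs
  change signedAmoeba ((standardChart v (β v)).toFun q) = (x, s) at hx
  change signedAmoeba ((standardChart v' (β v')).toFun q') = (x', s) at hx'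
  have hi := fin_ne_add (idx v v')
  have hfin : ∀ j i : Fin 3, j ≠ i → j = i + 1 ∨ j = i + 2 := by decide
  -- The signs of the real point `p` above the edge.
  obtain ⟨t, ht, -, et⟩ := exists_of_mem_above_standardChart h p.2 hi.1
  have ham : amoeba (p : Torus) = Real.log ‖(t : ℂ)‖ • toReal (dir (idx v v')) := by
    rw [et, amoeba_mul, amoeba_signPoint, amoeba_monomialPoint, zero_add]
  obtain ⟨j, ej, hcase⟩ := hpr.phaseLine_cases_perm hp (Equiv.refl _)
  simp only [Equiv.refl_apply] at ej hcase
  have hj : j ≠ idx v v' := by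
    rintro rfl
    have e1 := hA.amoeba_toFun (i := idx v v') ham
    rcases hcase with h0 | ⟨k, hk, r, hr, er⟩
    · rw [(standardChart v (β v)).amoeba_toFun_of_zero h0, hA.amoeba_b, left_eq_add] at e1
      exact smul_ne_zero (mul_pos ht (IsChart.weight_pos v _)).ne'
        (toReal_ne_zero ((isLegSystem_leg v).primitive _).ne_zero) e1
    · rw [hA.amoeba_toFun (i := k) er] at e1
      exact hk (leg_smul_eq (mul_pos hr (IsChart.weight_pos v k)) (add_left_cancel e1)).1
  obtain ⟨δ, eδ⟩ := hqr.exists_signs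
  obtain ⟨δ', eδ'⟩ := hqr'.exists_signs
  have hδ : δ = signOf (dir j) := by
    rw [ej, eδ] at hsig
    exact (signs_eq_signs_iff.1 hsig).symm
  rw [ej, ham] at hsig'
  have hqreal : signs ((standardChart v (β v)).toFun q) = s := congrArg Prod.snd hx
  have hq'real : signs ((standardChart v' (β v')).toFun q') = s := congrArg Prod.snd hx'
  have hxe : x = reflect s (amoeba ((standardChart v (β v)).toFun q)) := by
    rw [← hqreal]; exact (congrArg Prod.fst hx).symm
  have hxe' : x' = reflect s (amoeba ((standardChart v' (β v')).toFun q')) := by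
    rw [← hq'real]; exact (congrArg Prod.fst hx').symm
  have hse : s = signs (signPoint (β v * signOf (legVec v j)) * expPoint
      (v + (Real.log ‖(t : ℂ)‖ * C.weight v (leg v (idx v v'))) •
        toReal (leg v (idx v v')))) := by
    rw [← hs, ej, ham]
    exact congrArg signs (hA.toFun_real (idx v v') j _)
  obtain ⟨k, hkj, hki, ρ, hρ, ek⟩ := hA.exists_third_leg h (j := j) hqr hq
    (by rw [Equiv.refl_apply, ← hδ]; exact eδ) htri
  have third : ∀ j' : Fin 3, signs q' = signs (signPoint (signOf (dir j')) *
      expPoint ((gluingConstant v v' - Real.log ‖(t : ℂ)‖) • toReal (dir (idx v' v)))) →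
      ∃ k, k ≠ j' ∧ k ≠ idx v' v ∧ ∃ ρ : ℝ, 0 < ρ ∧
        amoeba ((standardChart v' (β v')).toFun q') = v' + ρ • toReal (leg v' k) := by
    intro j' he
    have hδ' : δ' = signOf (dir j') := by
      rw [eδ'] at he
      exact signs_eq_signs_iff.1 he
    exact hA'.exists_third_leg h.symm (j := j') hqr' hq'
      (by rw [Equiv.refl_apply, ← hδ']; exact eδ') (by rw [openSegment_symm]; exact htri')
  rw [hxe, hxe', hse, cross_reflect_mul, ek, cross_edge h] at hcross
  have hneg : ∀ y : ℝ × ℝ, cross ((v' : ℝ × ℝ) - v) y = -cross ((v : ℝ × ℝ) - v') y := by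
    intro y
    simp only [cross, Prod.fst_sub, Prod.snd_sub]
    ring
  have hl := h.edgeLength_spec.1
  have hl' := h.symm.edgeLength_spec.1
  -- The arc through `p` leaves the edge on the same side at both ends.
  rcases hfin j _ hj with rfl | rfl
  · rw [(gluingMap_real v v' _).2] at hsig'
    obtain ⟨k', hkj', hki', ρ', hρ', ek'⟩ := third _ hsig'.symm
    obtain rfl : k = idx v v' + 2 := (hfin k _ hki).resolve_left hkj
    obtain rfl : k' = idx v' v + 1 := (hfin k' _ hki').resolve_right hkj'
    rw [hneg, ek', cross_edge h.symm] at hcross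
    have c1 := (cross_leg v (idx v v')).2
    have c2 := (cross_leg v' (idx v' v)).1
    refine absurd hcross (not_lt.2 (mul_pos_of_neg_of_neg ?_ (neg_neg_of_pos ?_)).le)
    · exact mul_neg_of_pos_of_neg (mul_pos hl hρ) c1
    · exact mul_pos (mul_pos hl' hρ') c2
  · rw [(gluingMap_real v v' _).1] at hsig'
    obtain ⟨k', hkj', hki', ρ', hρ', ek'⟩ := third _ hsig'.symm
    obtain rfl : k = idx v v' + 1 := (hfin k _ hki).resolve_right hkj
    obtain rfl : k' = idx v' v + 2 := (hfin k' _ hki').resolve_left hkj'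
    rw [hneg, ek', cross_edge h.symm] at hcross
    have c1 := (cross_leg v (idx v v')).1
    have c2 := (cross_leg v' (idx v' v)).2
    refine absurd hcross (not_lt.2 (mul_pos ?_ (neg_pos.2 ?_)).le)
    · exact mul_pos (mul_pos hl hρ) c1
    · exact mul_neg_of_pos_of_neg (mul_pos hl' hρ') c2

theorem ofSigns_isPhaseHarnack (hirr : C.IsIrreducible) (hne : C.vertices.Nonempty) :
    (ofSigns hs β hβ).IsPhaseHarnack :=
  ⟨ofSigns_isReal, amoeba_carrier hs hirr hne (β := β)
    fun v => ⟨Equiv.refl _, isChart_standardChart v (β v)⟩, ofSigns_not_hasInflectionPattern⟩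

end SimplePhaseCurve

end

end TropHarnack

theorem mainTheorem9 (C : TropHarnack.TropPoly) (hsimple : C.IsSimple)
    (hirred : C.IsIrreducible) (hvert : C.vertices.Nonempty) :
    (C.IsHarnack ↔ ∃ V : TropHarnack.SimplePhaseCurve C, V.IsPhaseHarnack) ∧
    ∀ V V' : TropHarnack.SimplePhaseCurve C, V.IsPhaseHarnack → V'.IsPhaseHarnack →
      ∃ ε : ℤˣ × ℤˣ, V'.carrier = TropHarnack.signChange ε '' V.carrier := by
  refine ⟨?_, fun V V' hV hV' => ?_⟩
  · rw [TropHarnack.TropPoly.isHarnack_iff_exists_potential hsimple hirred hvert]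
    constructor
    · rintro ⟨β, hβ⟩
      exact ⟨TropHarnack.SimplePhaseCurve.ofSigns hsimple β hβ,
        TropHarnack.SimplePhaseCurve.ofSigns_isPhaseHarnack hirred hvert⟩
    · rintro ⟨V, hV⟩
      obtain ⟨β, -, hβ⟩ := V.exists_potential_of_isPhaseHarnack hV
      exact ⟨β, hβ⟩
  · obtain ⟨β, hA, hβ⟩ := V.exists_potential_of_isPhaseHarnack hV
    obtain ⟨β', hA', hβ'⟩ := V'.exists_potential_of_isPhaseHarnack hV'
    obtain ⟨v₀, hv₀⟩ := hvert
    -- Two solutions of the same equations differ by a constant, as the graph is connected.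
    have hconst : ∀ v w : C.vertices, C.edgeGraph.Walk v w → β' v * β v = β' w * β w := by
      intro v w p
      induction p with
      | nil => rfl
      | @cons u v w h p ih =>
        rw [← ih, hβ u v h, hβ' u v h, mul_mul_mul_comm, TropHarnack.signs_mul_self, mul_one]
    refine ⟨β' ⟨v₀, hv₀⟩ * β ⟨v₀, hv₀⟩, ?_⟩
    refine TropHarnack.SimplePhaseCurve.carrier_eq hA hA' fun v => ?_
    obtain ⟨p⟩ :=
      (TropHarnack.TropPoly.edgeGraph_connected hsimple hirred ⟨v₀, hv₀⟩).preconnected ⟨v₀, hv₀⟩ v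
    rw [hconst _ _ p, mul_assoc, TropHarnack.signs_mul_self, mul_one]
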